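/- Let $T>0$, $n\ge 1$, and let $\Omega\subset\mathbb R^n$ be an open set such that the embedding $H^1_0(\Omega)\to L^2(\Omega)$ is compact. For $0\le t\le T$ put $\Omega_t=(0,t)\times\Omega$. Let $H^{-1}(\Omega)$ be the dual of $H^1_0(\Omega)$, and put $\mathcal H^{-1}=L^2(0,T;H^{-1}(\Omega))$ and $W=\{F\in\mathcal H^{-1}:\ \partial_tF\in\mathcal H^{-1}\}$ with $\|F\|_W^2=\|F\|_{\mathcal H^{-1}}^2+\|\partial_tF\|_{\mathcal H^{-1}}^2$. All functions are real-valued. Let $\gamma=\gamma(t,x)>0$ be such that $\gamma,\gamma^{-1}\in C^0([0,T];L^\infty(\Omega))$ and $\partial_t\gamma\in L^\infty(\Omega_T)$ in the sense of distributions, and put $$b(t;u,w)=\int_\Omega\gamma(t,x)\,\nabla u(x)\cdot\nabla w(x)\,dx .$$ Then there is a constant $C$, depending only on $T$, $\Omega$ and $\gamma$, such that for all $F\in L^2(\Omega_T)\cup W$, $v_0\in H^1_0(\Omega)$ and $v_1\in L^2(\Omega)$ the following holds. There is exactly one weak solution $v$ of $$\partial_t^2v-\nabla\cdot(\gamma\nabla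 v)=F\ \text{ in }\Omega_T,\qquad v=0\ \text{ on }(0,T)\times\partial\Omega,\qquad v|_{t=0}=v_0,\qquad \partial_tv|_{t=0}=v_1,$$ that is, exactly one $v\in C([0,T];H^1_0(\Omega))$ with $\partial_tv\in C([0,T];L^2(\Omega))$, $v|_{t=0}=v_0$, $\partial_tv|_{t=0}=v_1$ and, for every $\phi\in H^1_0(\Omega)$, $$\frac{d}{dt}\,(\partial_tv\,|\,\phi)_{L^2(\Omega)}+b(t;v(t,\cdot),\phi)=\langle F(t,\cdot),\phi\rangle_{H^{-1}\times H^1_0}\quad\text{in }\mathcal D'(]0,T[).$$ Moreover, for all $t\in[0,T]$, $$\|\partial_tv(t,\cdot)\|_{L^2(\Omega)}+\|\nabla v(t,\cdot)\|_{L^2(\Omega)}\le C\left(\|F\|_{L^2(\Omega_t)+W}+\|v_0\|_{H^1_0(\Omega)}+\|v_1\|_{L^2(\Omega)}\right),$$ where $\|F\|_{L^2(\Omega_t)+W}$ is the infimum of $\|f\|_{L^2(\Omega_t)}+\|F_2\|_W$ over all $f\in L^2(\Omega_t)$ and $F_2\in W$ with $F=f+F_2$ on $(0,t)$. -/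

import Mathlib

open MeasureTheory Set
open scoped ENNReal ContDiff

noncomputable section

namespace WaveDirichlet

/-- `ℝⁿ` with its Euclidean structure. -/
abbrev Space (n : ℕ) : Type := EuclideanSpace ℝ (Fin n)

variable {n : ℕ}

/-- `L²(Ω)`, for Lebesgue measure. -/
abbrev L2 (Ω : Set (Space n)) : Type := Lp ℝ 2 (volume.restrict Ω)

/-- `L²(Ω; ℝⁿ)`. -/
abbrev L2Vec (Ω : Set (Space n)) : Type := Lp (Space n) 2 (volume.restrict Ω)

/-- The Hilbert space `L²(Ω) × L²(Ω; ℝⁿ)` with `‖(u, g)‖² = ‖u‖² + ‖g‖²`. By `u ↦ (u, ∇u)` the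
Sobolev space `H¹(Ω)` is isometric to a closed subspace of it. -/
abbrev L2Pair (Ω : Set (Space n)) : Type := WithLp 2 (L2 Ω × L2Vec Ω)

/-- `φ` is a test function on the set `U`: smooth, with compact support contained in `U`. -/
structure IsTest {E : Type*} [NormedAddCommGroup E] [NormedSpace ℝ E] (U : Set E)
    (φ : E → ℝ) : Prop where
  smooth : ContDiff ℝ ∞ φ
  compact : HasCompactSupport φ
  subset : tsupport φ ⊆ U

/-- The space of all pairs `(φ, ∇φ)`, `φ ∈ C_c^∞(Ω)`, in `L²(Ω) × L²(Ω; ℝⁿ)`. -/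
def testGraph (Ω : Set (Space n)) : Submodule ℝ (L2Pair Ω) where
  carrier := {p | ∃ φ : Space n → ℝ, IsTest Ω φ ∧
    p.fst =ᵐ[volume.restrict Ω] φ ∧ p.snd =ᵐ[volume.restrict Ω] gradient φ}
  zero_mem' := by
    refine ⟨0, ⟨contDiff_const, HasCompactSupport.zero, by simp [tsupport]⟩, ?_, ?_⟩
    · exact Lp.coeFn_zero ..
    · refine (Lp.coeFn_zero ..).trans (Filter.Eventually.of_forall fun x => ?_)
      simp [gradient]
  add_mem' := by
    rintro p q ⟨φ, hφ, h1, h2⟩ ⟨ψ, hψ, h3, h4⟩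
    refine ⟨φ + ψ, ⟨hφ.smooth.add hψ.smooth, hφ.compact.add hψ.compact,
      (tsupport_add φ ψ).trans (union_subset hφ.subset hψ.subset)⟩, ?_, ?_⟩
    · exact (Lp.coeFn_add _ _).trans (h1.add h3)
    · refine (Lp.coeFn_add _ _).trans ((h2.add h4).trans
        (Filter.Eventually.of_forall fun x => ?_))
      have a := hφ.smooth.differentiable (by simp) x
      have b := hψ.smooth.differentiable (by simp) x
      simp [gradient, fderiv_add a b]
  smul_mem' := by
    rintro c p ⟨φ, hφ, h1, h2⟩
    refine ⟨c • φ, ⟨hφ.smooth.const_smul c, hφ.compact.smul_left (f := fun _ => c),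
      (closure_mono (Function.support_const_smul_subset c φ)).trans hφ.subset⟩, ?_, ?_⟩
    · exact (Lp.coeFn_smul _ _).trans (h1.const_smul c)
    · refine (Lp.coeFn_smul _ _).trans ((h2.const_smul c).trans
        (Filter.Eventually.of_forall fun x => ?_))
      have a := hφ.smooth.differentiable (by simp) x
      simp [gradient, fderiv_const_smul a c]

/-- `H¹₀(Ω)`: the closure of `C_c^∞(Ω)` for the `H¹` norm, an element `u` being represented by the
pair `(u, ∇u)`. It carries the `H¹` norm `‖u‖² = ‖u‖²_{L²} + ‖∇u‖²_{L²}`. -/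
abbrev H10 (Ω : Set (Space n)) : Type := (testGraph Ω).topologicalClosure

/-- The embedding `H¹₀(Ω) → L²(Ω)`. -/
def toL2 (Ω : Set (Space n)) : H10 Ω →L[ℝ] L2 Ω :=
  (WithLp.fstL 2 ℝ (L2 Ω) (L2Vec Ω)).comp (testGraph Ω).topologicalClosure.subtypeL

/-- The gradient `H¹₀(Ω) → L²(Ω; ℝⁿ)`. -/
def grad (Ω : Set (Space n)) : H10 Ω →L[ℝ] L2Vec Ω :=
  (WithLp.sndL 2 ℝ (L2 Ω) (L2Vec Ω)).comp (testGraph Ω).topologicalClosure.subtypeL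

/-- `H⁻¹(Ω)`, the dual of `H¹₀(Ω)`, with the dual norm. -/
abbrev Hm1 (Ω : Set (Space n)) : Type := StrongDual ℝ (H10 Ω)

/-- The embedding `L²(Ω) ⊂ H⁻¹(Ω)`: `f` acts by `φ ↦ ∫_Ω f φ`. -/
def L2.toHm1 {Ω : Set (Space n)} (f : L2 Ω) : Hm1 Ω := (innerSL ℝ f).comp (toL2 Ω)

/-- `L²(Ω_t) = L²(0, t; L²(Ω))`, where `Ω_t = (0, t) × Ω`. -/
abbrev L2Time (Ω : Set (Space n)) (t : ℝ) : Type := Lp (L2 Ω) 2 (volume.restrict (Ioo 0 t))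

/-- `ℋ⁻¹ = L²(0, T; H⁻¹(Ω))`. -/
abbrev HH (Ω : Set (Space n)) (T : ℝ) : Type := Lp (Hm1 Ω) 2 (volume.restrict (Ioo 0 T))

/-- `∂ₜF = G` in the sense of (`H⁻¹(Ω)`-valued) distributions on `(0, T)`. -/
def HasTimeDeriv {Ω : Set (Space n)} {T : ℝ} (F G : HH Ω T) : Prop :=
  ∀ θ : ℝ → ℝ, IsTest (Ioo 0 T) θ →
    ∫ t in Ioo 0 T, deriv θ t • F t = -∫ t in Ioo 0 T, θ t • G t

/-- `F ∈ L²(Ω_T)`. -/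
def MemL2 {Ω : Set (Space n)} {T : ℝ} (F : HH Ω T) : Prop :=
  ∃ f : L2Time Ω T, ∀ᵐ t ∂volume.restrict (Ioo 0 T), F t = (f t).toHm1

/-- `F ∈ W`, that is `F ∈ ℋ⁻¹` and `∂ₜF ∈ ℋ⁻¹`. -/
def MemW {Ω : Set (Space n)} {T : ℝ} (F : HH Ω T) : Prop :=
  ∃ G : HH Ω T, HasTimeDeriv F G

/-- The norm in `L²(Ω_t) + W` of (the restriction to `(0, t)` of) `F`: the infimum of
`‖f‖_{L²(Ω_t)} + ‖F₂‖_W` over all decompositions `F = f + F₂` on `(0, t)` with `f ∈ L²(Ω_t)` and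
`F₂ ∈ W`, where `‖F₂‖_W² = ‖F₂‖²_{ℋ⁻¹} + ‖∂ₜF₂‖²_{ℋ⁻¹}`. -/
def sumNorm {Ω : Set (Space n)} {T : ℝ} (t : ℝ) (F : HH Ω T) : ℝ :=
  sInf {r | ∃ (f : L2Time Ω t) (F₂ G₂ : HH Ω T), HasTimeDeriv F₂ G₂ ∧
    (∀ᵐ s ∂volume.restrict (Ioo 0 t), F s = (f s).toHm1 + F₂ s) ∧
    r = ‖f‖ + Real.sqrt (‖F₂‖ ^ 2 + ‖G₂‖ ^ 2)}

/-- `γ ∈ C⁰([0, T]; L^∞(Ω))`. -/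
def IsContLinfty (Ω : Set (Space n)) (T : ℝ) (γ : ℝ → Space n → ℝ) : Prop :=
  ∃ Γ : ℝ → Lp ℝ ∞ (volume.restrict Ω), ContinuousOn Γ (Icc 0 T) ∧
    ∀ t ∈ Icc 0 T, γ t =ᵐ[volume.restrict Ω] Γ t

/-- `∂ₜγ ∈ L^∞(Ω_T)`, the derivative being taken in the sense of distributions on
`Ω_T = (0, T) × Ω`. -/
def HasTimeDerivLinfty (Ω : Set (Space n)) (T : ℝ) (γ : ℝ → Space n → ℝ) : Prop :=
  ∃ g : ℝ × Space n → ℝ, MemLp g ∞ (volume.restrict (Ioo 0 T ×ˢ Ω)) ∧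
    ∀ φ : ℝ × Space n → ℝ, IsTest (Ioo 0 T ×ˢ Ω) φ →
      ∫ t in Ioo 0 T, ∫ x in Ω, γ t x * deriv (fun s => φ (s, x)) t =
        -∫ p in Ioo 0 T ×ˢ Ω, g p * φ p

/-- The bilinear form `b(t; u, w) = ∫_Ω γ(t, x) ∇u(x) · ∇w(x) dx`. -/
def form {Ω : Set (Space n)} (γ : ℝ → Space n → ℝ) (t : ℝ) (u w : H10 Ω) : ℝ :=
  ∫ x in Ω, γ t x * inner ℝ (grad Ω u x) (grad Ω w x)

/-- The time derivative `∂ₜv(t)` of `v`, regarded as an `L²(Ω)`-valued function on `[0, T]`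
(one-sided at the end points). -/
def velocity {Ω : Set (Space n)} (T : ℝ) (v : ℝ → H10 Ω) (t : ℝ) : L2 Ω :=
  derivWithin (fun s => toL2 Ω (v s)) (Icc 0 T) t

/-- `v` (considered on `[0, T]` only) is a weak solution of `∂ₜ²v - ∇·(γ∇v) = F` in `Ω_T`, `v = 0`
on `∂Ω`, `v(0) = v₀`, `∂ₜv(0) = v₁`. -/
structure IsWeakSolution {Ω : Set (Space n)} {T : ℝ} (γ : ℝ → Space n → ℝ) (F : HH Ω T)
    (v₀ : H10 Ω) (v₁ : L2 Ω) (v : ℝ → H10 Ω) : Prop where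
  continuousOn : ContinuousOn v (Icc 0 T)
  differentiableOn : DifferentiableOn ℝ (fun t => toL2 Ω (v t)) (Icc 0 T)
  continuousOn_velocity : ContinuousOn (velocity T v) (Icc 0 T)
  initial : v 0 = v₀
  initial_velocity : velocity T v 0 = v₁
  equation : ∀ φ : H10 Ω, ∀ θ : ℝ → ℝ, IsTest (Ioo 0 T) θ →
    -(∫ t in Ioo 0 T, inner ℝ (velocity T v t) (toL2 Ω φ) * deriv θ t) +
        ∫ t in Ioo 0 T, form γ t (v t) φ * θ t =
      ∫ t in Ioo 0 T, F t φ * θ t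

end WaveDirichlet

end

noncomputable section

namespace WaveDirichlet

open Filter Topology

/-! ### Mean value and Gronwall inequalities for real functions -/

section Scalar

/-! Write `V = H¹₀(Ω)`, `H = L²(Ω)`, `i : V → H` for the embedding, `S = i†i`, and `B(t)` for the
operator on `V` representing `b(t; ·, ·)` plus the `L²` product. After the Riesz isometry the
equation becomes `(i v)' = u`, `(i†u)' = S v - B(t) v + F` in `V`, where `S v` cancels the added
product (`WaveForm`, `WaveForm.IsSolution`). By `exists_waveForm`, `B(t)` is symmetric, uniformly
coercive and Lipschitz in time; these properties carry the abstract argument.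

Approximation. With `S` replaced by `S + ε` in front of the acceleration, the equation is a linear
ODE with bounded coefficients in `V × V`, solvable from any initial time in both directions. The
energy `‖i w‖² + ε ‖w‖² + ⟨B v, v⟩`, where `w = v'`, is bounded independently of `ε`
(`WaveForm.exists_energy_estimate`). A source from `W` is a primitive `p` with `p'` in `L²(0, T;
V)`; it is integrated by parts in time, which puts `-2 ⟨p, v⟩` into the energy and leaves `⟨p', v⟩`.

Limit and uniqueness. One level below, the energy `‖i z‖² + ⟨B⁻¹ y, y⟩`, with `y` the momentum,
obeys a Gronwall inequality that does not require testing with the velocity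
(`WaveForm.exists_low_energy_estimate`). Applied to the difference of two approximations it gives an
error of order `√ε + √δ`, so that convergence at one time yields convergence at all times: strong in
the weaker norms and, by the uniform bounds, weak in `V × H`. Applied to the difference of two
solutions it gives uniqueness.

Strong continuity. The limit is a priori only weakly continuous. Restarting the approximation at
`t₀` from the limit itself, with strongly converging data, and using lower semicontinuity at `t`
gives `E(t) ≤ E(t₀) + K |t - t₀|`, where `E` includes the source term. Since `t₀` and `t` may be
exchanged, `E` is Lipschitz; weak continuity together with continuity of the energy is strong
continuity. This is done for sources continuous in time, and the linear estimate extends it by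
density (`WaveForm.exists_isSolution`).

Return to the theorem. The lemma of du Bois-Reymond identifies weak solutions with solutions of the
integrated equation and writes elements of `W` as primitives. For the norm of `L²(Ω_t) + W`, each
decomposition on `(0, t)` is extended to `(0, T)`; by uniqueness on `[0, t]` the new solution agrees
there with the given one, so one constant serves all `t` and all decompositions. -/

theorem sub_le_integral_of_slope_le {q R : ℝ → ℝ} {a b : ℝ} (hab : a ≤ b)
    (hq : ContinuousOn q (Icc a b)) (hR : ContinuousOn R (Icc a b))
    (h : ∀ t ∈ Ico a b, ∀ δ > 0, ∀ᶠ s in 𝓝[>] t, q s - q t ≤ (R t + δ) * (s - t)) :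
    q b - q a ≤ ∫ t in a..b, R t := by
  -- Clamping the argument extends `R` continuously to the whole line, so that its primitive is
  -- differentiable everywhere. The same device serves below for Gronwall's inequality and for the
  -- linear ODE.
  set R' : ℝ → ℝ := fun t => R (projIcc a b hab t) with hR'
  have hRc : Continuous R' := by
    have := (continuousOn_iff_continuous_domRestrict.1 hR).comp (continuous_projIcc (h := hab))
    exact this
  have key := image_le_of_liminf_slope_right_le_deriv_boundary (f := q) (a := a) (b := b) hq
    (B := fun t => q a + ∫ s in a..t, R' s) (B' := R') (by simp)
    (by
      refine continuousOn_const.add (Continuous.continuousOn ?_)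
      exact intervalIntegral.continuous_primitive (fun _ _ => hRc.intervalIntegrable _ _) a)
    (fun x _ => ((hRc.integral_hasStrictDerivAt a x).hasDerivAt.const_add _).hasDerivWithinAt)
    (by
      intro x hx r hr
      have hx' : R' x = R x := by
        simp [hR', projIcc_of_mem hab ⟨hx.1, hx.2.le⟩]
      have hδ : 0 < (r - R x) / 2 := by rw [← hx']; linarith
      refine Eventually.frequently ?_
      filter_upwards [h x hx _ hδ, self_mem_nhdsWithin] with s hs hs'
      have hs' : x < s := hs'
      rw [slope_def_field, div_lt_iff₀ (by linarith)]
      have : (R x + (r - R x) / 2) * (s - x) < r * (s - x) := by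
        apply mul_lt_mul_of_pos_right _ (by linarith)
        rw [← hx']; linarith
      linarith)
    (right_mem_Icc.2 hab)
  have e : ∫ s in a..b, R' s = ∫ s in a..b, R s := by
    refine intervalIntegral.integral_congr fun s hs => ?_
    rw [uIcc_of_le hab] at hs
    simp [hR', projIcc_of_mem hab hs]
  linarith [e]

theorem abs_sub_le_integral_of_slope_le {q R : ℝ → ℝ} {a b : ℝ} (hab : a ≤ b)
    (hq : ContinuousOn q (Icc a b)) (hR : ContinuousOn R (Icc a b))
    (h : ∀ t ∈ Ico a b, ∀ δ > 0, ∀ᶠ s in 𝓝[>] t, |q s - q t| ≤ (R t + δ) * (s - t)) :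
    |q b - q a| ≤ ∫ t in a..b, R t := by
  have h1 := sub_le_integral_of_slope_le hab hq hR
    (fun t ht δ hδ => (h t ht δ hδ).mono fun s hs => (le_abs_self _).trans hs)
  have h2 := sub_le_integral_of_slope_le (q := fun t => - q t) hab hq.neg hR
    (fun t ht δ hδ => (h t ht δ hδ).mono fun s hs => by
      have := neg_abs_le (q s - q t); linarith)
  rw [abs_le]; constructor <;> linarith

/-- Unlike `N`, the function `A + C ∫ N` is differentiable, and its derivative `C N` is at most `C`
times the function itself; the differential form of Gronwall's inequality applies to it. -/
theorem le_exp_of_le_add_integral {N : ℝ → ℝ} {a b A C : ℝ} (hC : 0 ≤ C) (hab : a ≤ b)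
    (hN : ContinuousOn N (Icc a b)) (h : ∀ t ∈ Icc a b, N t ≤ A + C * ∫ s in a..t, N s) :
    ∀ t ∈ Icc a b, N t ≤ A * Real.exp (C * (t - a)) := by
  set N' : ℝ → ℝ := fun t => N (projIcc a b hab t) with hN'
  have hc : Continuous N' :=
    (continuousOn_iff_continuous_domRestrict.1 hN).comp (continuous_projIcc (h := hab))
  have e : ∀ t ∈ Icc a b, N' t = N t := fun t ht => by simp [hN', projIcc_of_mem hab ht]
  have ei : ∀ t ∈ Icc a b, ∫ s in a..t, N' s = ∫ s in a..t, N s := fun t ht => by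
    refine intervalIntegral.integral_congr fun s hs => e s ?_
    rw [uIcc_of_le ht.1] at hs
    exact ⟨hs.1, hs.2.trans ht.2⟩
  have hd : ∀ t, HasDerivAt (fun t => A + C * ∫ s in a..t, N' s) (C * N' t) t := fun t =>
    ((hc.integral_hasStrictDerivAt a t).hasDerivAt.const_mul C).const_add A
  have hbd : ∀ x ∈ Ico a b, C * N' x ≤ C * (A + C * ∫ s in a..x, N' s) + 0 := fun x hx => by
    have hx' : x ∈ Icc a b := ⟨hx.1, hx.2.le⟩
    rw [add_zero, e x hx', ei x hx']
    exact mul_le_mul_of_nonneg_left (h x hx') hC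
  have hsl : ∀ x ∈ Ico a b, ∀ r, C * N' x < r → ∃ᶠ z in 𝓝[>] x,
      (z - x)⁻¹ * ((A + C * ∫ s in a..z, N' s) - (A + C * ∫ s in a..x, N' s)) < r :=
    fun x hx r hr => by
      have := ((hd x).hasDerivWithinAt (s := Ici x)).liminf_right_slope_le hr
      simpa only [slope_def_field, div_eq_inv_mul] using this
  have h0 : A + C * ∫ s in a..a, N' s ≤ A := by simp
  have key := le_gronwallBound_of_liminf_deriv_right_le
    (fun t _ => (hd t).continuousAt.continuousWithinAt) hsl h0 hbd
  intro t ht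
  have := key t ht
  rw [gronwallBound_ε0, ei t ht] at this
  exact (h t ht).trans this

/-- Gronwall's inequality in integral form, with an interior base point. -/
theorem le_exp_of_le_add_abs_integral {N : ℝ → ℝ} {a b t₀ A C : ℝ} (hA : 0 ≤ A) (hC : 0 ≤ C)
    (ht₀ : t₀ ∈ Icc a b) (hN : ContinuousOn N (Icc a b)) (hN0 : ∀ t ∈ Icc a b, 0 ≤ N t)
    (h : ∀ t ∈ Icc a b, N t ≤ A + C * |∫ s in t₀..t, N s|) :
    ∀ t ∈ Icc a b, N t ≤ A * Real.exp (C * (b - a)) := by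
  intro t ht
  rcases le_total t₀ t with h1 | h1
  · have := le_exp_of_le_add_integral (a := t₀) (b := b) (A := A) hC ht₀.2
      (hN.mono (Icc_subset_Icc_left ht₀.1)) (fun s hs => by
        have hs' : s ∈ Icc a b := ⟨ht₀.1.trans hs.1, hs.2⟩
        have := h s hs'
        rwa [abs_of_nonneg (intervalIntegral.integral_nonneg hs.1 fun r hr =>
          hN0 r ⟨ht₀.1.trans hr.1, hr.2.trans hs.2⟩)] at this) t ⟨h1, ht.2⟩
    refine this.trans (mul_le_mul_of_nonneg_left (Real.exp_le_exp.2 ?_) hA)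
    exact mul_le_mul_of_nonneg_left (by linarith [ht₀.1, ht.2]) hC
  -- To the left of the base point, time is reversed.
  · have := le_exp_of_le_add_integral (N := fun s => N (-s)) (a := -t₀) (b := -a) (A := A) hC
      (by linarith [ht₀.1])
      (hN.comp continuous_neg.continuousOn fun s hs => by
        exact ⟨by linarith [hs.2], by linarith [hs.1, ht₀.2]⟩) (fun s hs => by
        have hs' : -s ∈ Icc a b := ⟨by linarith [hs.2], by linarith [hs.1, ht₀.2]⟩
        have := h (-s) hs'
        rw [intervalIntegral.integral_symm, abs_neg, abs_of_nonneg
          (intervalIntegral.integral_nonneg (by linarith [hs.1]) fun r hr =>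
          hN0 r ⟨by linarith [hr.1, hs.2], by linarith [hr.2, ht₀.2]⟩)] at this
        rwa [intervalIntegral.integral_comp_neg, neg_neg]) (-t) ⟨by linarith, by linarith [ht.1]⟩
    simp only [neg_neg] at this
    refine this.trans (mul_le_mul_of_nonneg_left (Real.exp_le_exp.2 ?_) hA)
    exact mul_le_mul_of_nonneg_left (by linarith [ht₀.2, ht.1]) hC

end Scalar

/-! ### Quadratic forms, weak limits and coercive operators in Hilbert space -/

section Hilbert

variable {E : Type*} [NormedAddCommGroup E] [InnerProductSpace ℝ E]

/-- Mean value estimate for `a(t) + ⟨G(t) x(t), x(t)⟩` when `G` is only Lipschitz in time. -/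
theorem abs_sub_le_integral_quadratic {a a' : ℝ → ℝ} {x x' : ℝ → E} {G : ℝ → E →L[ℝ] E}
    {R : ℝ → ℝ} {L T s t : ℝ} (hL : 0 ≤ L)
    (ha : ∀ r ∈ Icc 0 T, HasDerivWithinAt a (a' r) (Icc 0 T) r)
    (hx : ∀ r ∈ Icc 0 T, HasDerivWithinAt x (x' r) (Icc 0 T) r)
    (hsymm : ∀ r ∈ Icc 0 T, ∀ u w, inner ℝ (G r u) w = inner ℝ u (G r w))
    (hG : ∀ r ∈ Icc 0 T, ∀ r' ∈ Icc 0 T, ‖G r - G r'‖ ≤ L * |r - r'|)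
    (hR : ContinuousOn R (Icc 0 T))
    (hbound : ∀ r ∈ Icc 0 T, |a' r + 2 * inner ℝ (G r (x r)) (x' r)| + L * ‖x r‖ ^ 2 ≤ R r)
    (hs : s ∈ Icc 0 T) (ht : t ∈ Icc 0 T) :
    |(a t + inner ℝ (G t (x t)) (x t)) - (a s + inner ℝ (G s (x s)) (x s))| ≤
      |∫ r in s..t, R r| := by
  have hR0 : ∀ r ∈ Icc 0 T, 0 ≤ R r := fun r hr => le_trans (by positivity) (hbound r hr)
  wlog hst : s ≤ t generalizing s t
  · rw [abs_sub_comm, intervalIntegral.integral_symm, abs_neg]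
    exact this ht hs (le_of_not_ge hst)
  have hsub : Icc s t ⊆ Icc 0 T := Icc_subset_Icc hs.1 ht.2
  rw [abs_of_nonneg (intervalIntegral.integral_nonneg hst fun r hr => hR0 r (hsub hr))]
  have hxc : ContinuousOn x (Icc 0 T) := fun r hr => (hx r hr).continuousWithinAt
  have hGc : ContinuousOn G (Icc 0 T) := by
    refine (LipschitzOnWith.of_dist_le_mul (K := L.toNNReal) fun r hr r' hr' => ?_).continuousOn
    rw [dist_eq_norm, Real.dist_eq, Real.coe_toNNReal _ hL]
    exact hG r hr r' hr'
  refine abs_sub_le_integral_of_slope_le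
    (q := fun r => a r + inner ℝ (G r (x r)) (x r)) hst ?_ (hR.mono hsub) ?_
  · refine ContinuousOn.mono ?_ hsub
    exact ContinuousOn.add (fun r hr => (ha r hr).continuousWithinAt)
      ((hGc.clm_apply hxc).inner hxc)
  · intro r hr δ hδ
    have hrT : r ∈ Icc 0 T := hsub ⟨hr.1, hr.2.le⟩
    have hmem : Icc 0 T ∈ 𝓝[>] r := by
      refine mem_of_superset (Ioc_mem_nhdsGT hr.2) fun y hy => hsub ⟨hr.1.trans hy.1.le, hy.2⟩
    have hle : 𝓝[>] r ≤ 𝓝[Icc 0 T] r := nhdsWithin_le_of_mem hmem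
    -- With `G` frozen at time `r` the expression is differentiable, symmetry merging the two cross
    -- terms. Letting `G` vary costs at most `L ‖x y‖² (y - r)`, so `G` itself need not be
    -- differentiable.
    have hder : HasDerivWithinAt (fun y => a y + inner ℝ (G r (x y)) (x y))
        (a' r + 2 * inner ℝ (G r (x r)) (x' r)) (Icc 0 T) r := by
      have h1 := ((G r).hasFDerivAt.comp_hasDerivWithinAt r (hx r hrT)).inner ℝ (hx r hrT)
      refine ((ha r hrT).add h1).congr_deriv ?_
      rw [hsymm r hrT (x' r) (x r), real_inner_comm (G r (x r)) (x' r), Function.comp_apply]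
      ring
    have hn : Tendsto (fun y => L * ‖x y‖ ^ 2) (𝓝[Icc 0 T] r) (𝓝 (L * ‖x r‖ ^ 2)) :=
      ((hxc r hrT).norm.pow 2).const_mul L
    have e1 := ((hasDerivWithinAt_iff_isLittleO.1 hder).def (half_pos hδ)).filter_mono hle
    have e2 := (hn.eventually (eventually_le_nhds (show L * ‖x r‖ ^ 2 < L * ‖x r‖ ^ 2 + δ / 2 by
      linarith))).filter_mono hle
    filter_upwards [e1, e2, hmem, self_mem_nhdsWithin] with y h1 h2 hyT hy
    have hy : r < y := hy
    have h3 : |inner ℝ ((G y - G r) (x y)) (x y)| ≤ (L * ‖x y‖ ^ 2) * (y - r) := by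
      calc |inner ℝ ((G y - G r) (x y)) (x y)| ≤ ‖(G y - G r) (x y)‖ * ‖x y‖ :=
            abs_real_inner_le_norm _ _
        _ ≤ (‖G y - G r‖ * ‖x y‖) * ‖x y‖ := by
            gcongr; exact (G y - G r).le_opNorm _
        _ ≤ (L * |y - r| * ‖x y‖) * ‖x y‖ := by gcongr; exact hG y hyT r hrT
        _ = _ := by rw [abs_of_pos (sub_pos.2 hy)]; ring
    rw [Real.norm_eq_abs, Real.norm_eq_abs, abs_of_pos (sub_pos.2 hy), smul_eq_mul] at h1
    have h4 : (a y + inner ℝ (G y (x y)) (x y)) - (a r + inner ℝ (G r (x r)) (x r)) =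
        ((a y + inner ℝ (G r (x y)) (x y)) - (a r + inner ℝ (G r (x r)) (x r)) -
          (y - r) * (a' r + 2 * inner ℝ (G r (x r)) (x' r))) +
        (y - r) * (a' r + 2 * inner ℝ (G r (x r)) (x' r)) +
        inner ℝ ((G y - G r) (x y)) (x y) := by
      simp only [_root_.sub_apply, inner_sub_left]; ring
    rw [h4]
    have h5 : |(y - r) * (a' r + 2 * inner ℝ (G r (x r)) (x' r))| =
        |a' r + 2 * inner ℝ (G r (x r)) (x' r)| * (y - r) := by
      rw [abs_mul, abs_of_pos (sub_pos.2 hy), mul_comm]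
    have h6 : (L * ‖x y‖ ^ 2) * (y - r) ≤ (L * ‖x r‖ ^ 2 + δ / 2) * (y - r) :=
      mul_le_mul_of_nonneg_right h2 (sub_pos.2 hy).le
    have h7 := mul_le_mul_of_nonneg_right (hbound r hrT) (sub_pos.2 hy).le
    refine (abs_add_three _ _ _).trans ?_
    rw [h5]
    nlinarith

/-- The bound on `x` makes the error of replacing `φ` by a nearby element of `D` uniform along the
filter. -/
theorem tendsto_inner_of_dense {α : Type*} {l : Filter α} {x : α → E} {y : E} {C : ℝ}
    (hx : ∀ᶠ k in l, ‖x k‖ ≤ C) {D : Set E} (hD : Dense D)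
    (h : ∀ g ∈ D, Tendsto (fun k => inner ℝ (x k) g) l (𝓝 (inner ℝ y g))) (φ : E) :
    Tendsto (fun k => inner ℝ (x k) φ) l (𝓝 (inner ℝ y φ)) := by
  rw [Metric.tendsto_nhds]
  intro δ hδ
  set K := |C| + ‖y‖ + 1
  have hK : 0 < K := by positivity
  obtain ⟨g, hg, hgD⟩ := hD.exists_dist_lt φ (show 0 < δ / (2 * K) by positivity)
  filter_upwards [hx, (Metric.tendsto_nhds.1 (h g hg)) (δ / 2) (by positivity)] with k hk hk'
  rw [Real.dist_eq] at hk' ⊢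
  have e : inner ℝ (x k) φ - inner ℝ y φ =
      (inner ℝ (x k) g - inner ℝ y g) + inner ℝ (x k - y) (φ - g) := by
    simp only [inner_sub_left, inner_sub_right]; ring
  have e2 : |inner ℝ (x k - y) (φ - g)| ≤ δ / 2 := by
    calc |inner ℝ (x k - y) (φ - g)| ≤ ‖x k - y‖ * ‖φ - g‖ := abs_real_inner_le_norm _ _
      _ ≤ K * (δ / (2 * K)) := by
          gcongr
          · refine (norm_sub_le _ _).trans ?_
            have := le_abs_self C
            simp only [K]; linarith
          · rw [dist_eq_norm] at hgD; exact hgD.le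
      _ = δ / 2 := by field_simp
  rw [e]
  refine (abs_add_le _ _).trans_lt ?_
  linarith

/-- Convergence of `S† x k` means that the pairings with the range of `S` converge. The range is
dense and the sequence bounded, so all pairings converge, and the limit functional is continuous by
the uniform boundedness principle. The whole sequence converges weakly; no subsequence is extracted.
-/
theorem exists_weak_limit [CompleteSpace E] {F : Type*} [NormedAddCommGroup F]
    [InnerProductSpace ℝ F] [CompleteSpace F] {S : F →L[ℝ] E} (hS : DenseRange S) {x : ℕ → E}
    {C : ℝ} (hx : ∀ k, ‖x k‖ ≤ C) {η : F}
    (h : Tendsto (fun k => S.adjoint (x k)) atTop (𝓝 η)) :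
    ∃ y : E, ‖y‖ ≤ C ∧ S.adjoint y = η ∧
      ∀ φ, Tendsto (fun k => inner ℝ (x k) φ) atTop (𝓝 (inner ℝ y φ)) := by
  have hC : 0 ≤ C := (norm_nonneg _).trans (hx 0)
  have hcau : ∀ φ, ∃ c, Tendsto (fun k => innerSL ℝ (x k) φ) atTop (𝓝 c) := by
    intro φ
    refine cauchySeq_tendsto_of_complete (Metric.cauchySeq_iff.2 fun δ hδ => ?_)
    obtain ⟨g, hg⟩ := hS.exists_dist_lt φ (show 0 < δ / (4 * (C + 1)) by positivity)
    have h1 : CauchySeq fun k => inner ℝ (S.adjoint (x k)) g :=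
      (h.inner tendsto_const_nhds).cauchySeq
    obtain ⟨N, hN⟩ := Metric.cauchySeq_iff.1 h1 (δ / 2) (by positivity)
    refine ⟨N, fun m hm k hk => ?_⟩
    have h2 := hN m hm k hk
    rw [Real.dist_eq] at h2 ⊢
    simp only [innerSL_apply_apply]
    rw [S.adjoint_inner_left, S.adjoint_inner_left] at h2
    have e : inner ℝ (x m) φ - inner ℝ (x k) φ =
        (inner ℝ (x m) (S g) - inner ℝ (x k) (S g)) + inner ℝ (x m - x k) (φ - S g) := by
      simp only [inner_sub_left, inner_sub_right]; ring
    have e2 : |inner ℝ (x m - x k) (φ - S g)| ≤ δ / 2 := by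
      calc |inner ℝ (x m - x k) (φ - S g)| ≤ ‖x m - x k‖ * ‖φ - S g‖ :=
            abs_real_inner_le_norm _ _
        _ ≤ (2 * (C + 1)) * (δ / (4 * (C + 1))) := by
            gcongr
            · refine (norm_sub_le _ _).trans ?_
              linarith [hx m, hx k]
            · rw [dist_eq_norm] at hg; exact hg.le
        _ = δ / 2 := by field_simp; norm_num
    rw [e]
    refine (abs_add_le _ _).trans_lt ?_
    linarith
  choose c hc using hcau
  have hlin : Tendsto (fun k => (innerSL ℝ (x k) : E → ℝ)) atTop (𝓝 c) := tendsto_pi_nhds.2 hc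
  set ℓ : E →L[ℝ] ℝ := continuousLinearMapOfTendsto (fun k => innerSL ℝ (x k)) hlin with hℓ
  have hℓc : ∀ φ, ℓ φ = c φ := fun φ => rfl
  set y := (InnerProductSpace.toDual ℝ E).symm ℓ with hy
  have hyφ : ∀ φ, inner ℝ y φ = c φ := fun φ => by
    rw [hy, InnerProductSpace.toDual_symm_apply, hℓc]
  have hlim : ∀ φ, Tendsto (fun k => inner ℝ (x k) φ) atTop (𝓝 (inner ℝ y φ)) := fun φ => by
    rw [hyφ]; exact hc φ
  refine ⟨y, ?_, ?_, hlim⟩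
  · have h1 : inner ℝ y y ≤ C * ‖y‖ := le_of_tendsto (hlim y) (Eventually.of_forall fun k =>
      (real_inner_le_norm _ _).trans (by gcongr; exact hx k))
    rw [real_inner_self_eq_norm_sq] at h1
    by_contra hcon
    push Not at hcon
    nlinarith [norm_nonneg y]
  · refine ext_inner_right ℝ fun g => ?_
    rw [S.adjoint_inner_left]
    have h1 := hlim (S g)
    have h2 : Tendsto (fun k => inner ℝ (S.adjoint (x k)) g) atTop (𝓝 (inner ℝ η g)) :=
      h.inner tendsto_const_nhds
    simp only [S.adjoint_inner_left] at h2
    exact tendsto_nhds_unique h1 h2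

/-- A coercive bounded operator has a bounded inverse. -/
theorem exists_inverse_of_coercive [CompleteSpace E] {G : E →L[ℝ] E} {c : ℝ} (hc : 0 < c)
    (h : ∀ u, c * ‖u‖ ^ 2 ≤ inner ℝ (G u) u) :
    ∃ K : E →L[ℝ] E, (∀ u, G (K u) = u) ∧ (∀ u, K (G u) = u) ∧ ‖K‖ ≤ c⁻¹ := by
  have hlow : ∀ u, c * ‖u‖ ≤ ‖G u‖ := fun u => by
    rcases (norm_nonneg u).eq_or_lt with h0 | h0
    · rw [← h0]; simp
    · have := (h u).trans (real_inner_le_norm _ _)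
      nlinarith
  -- Lax–Milgram gives the inverse; its bound is `hlow` read backwards.
  have hco : IsCoercive (innerSL ℝ ∘L G : E →L[ℝ] E →L[ℝ] ℝ) := by
    refine ⟨c, hc, fun u => ?_⟩
    have := h u
    have e : (innerSL ℝ ∘L G : E →L[ℝ] E →L[ℝ] ℝ) u u = inner ℝ (G u) u := rfl
    rw [e]
    linarith [sq ‖u‖]
  set e := hco.continuousLinearEquivOfBilin
  have he : ∀ u, e u = G u := fun u => ext_inner_right ℝ fun w => by
    rw [IsCoercive.continuousLinearEquivOfBilin_apply]; rfl
  refine ⟨e.symm, fun u => ?_, fun u => ?_, ?_⟩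
  · rw [← he]; simp
  · rw [← he]; simp
  · refine ContinuousLinearMap.opNorm_le_bound _ (by positivity) fun u => ?_
    have h1 := hlow (e.symm u)
    rw [← he] at h1
    simp only [ContinuousLinearEquiv.apply_symm_apply] at h1
    simp only [ContinuousLinearEquiv.coe_coe]
    rw [inv_mul_eq_div, le_div_iff₀ hc]
    linarith

end Hilbert

/-! ### Linear differential equations in a Banach space -/

section LinearODE

/-- Integrating the weight gains a factor `l⁻¹`, which makes the Picard map a contraction in a
weighted norm on the whole interval at once. -/
theorem abs_integral_exp_abs_le {l : ℝ} (hl : 0 < l) (t₀ t : ℝ) :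
    |∫ s in t₀..t, Real.exp (l * |s - t₀|)| ≤ l⁻¹ * Real.exp (l * |t - t₀|) := by
  rcases le_total t₀ t with h | h
  · have e : ∫ s in t₀..t, Real.exp (l * |s - t₀|) = ∫ s in t₀..t, Real.exp (l * (s - t₀)) := by
      refine intervalIntegral.integral_congr fun s hs => ?_
      rw [uIcc_of_le h] at hs
      simp only [abs_of_nonneg (sub_nonneg.2 hs.1)]
    have e2 : ∫ s in t₀..t, Real.exp (l * (s - t₀)) =
        l⁻¹ * Real.exp (l * (t - t₀)) - l⁻¹ * Real.exp (l * (t₀ - t₀)) := by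
      refine intervalIntegral.integral_eq_sub_of_hasDerivAt
        (f := fun s => l⁻¹ * Real.exp (l * (s - t₀))) (fun s _ => ?_)
        (Continuous.intervalIntegrable (by fun_prop) _ _)
      have := (((hasDerivAt_id s).sub_const t₀).const_mul l).exp.const_mul l⁻¹
      refine this.congr_deriv ?_
      simp only [id]; field_simp
    rw [e, abs_of_nonneg (intervalIntegral.integral_nonneg h fun s _ => (Real.exp_pos _).le), e2,
      abs_of_nonneg (sub_nonneg.2 h)]
    have : 0 < l⁻¹ * Real.exp (l * (t₀ - t₀)) := by positivity
    linarith
  · have e : ∫ s in t..t₀, Real.exp (l * |s - t₀|) = ∫ s in t..t₀, Real.exp (l * (t₀ - s)) := by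
      refine intervalIntegral.integral_congr fun s hs => ?_
      rw [uIcc_of_le h] at hs
      simp only [abs_of_nonpos (sub_nonpos.2 hs.2), neg_sub]
    have e2 : ∫ s in t..t₀, Real.exp (l * (t₀ - s)) =
        -(l⁻¹ * Real.exp (l * (t₀ - t₀))) - -(l⁻¹ * Real.exp (l * (t₀ - t))) := by
      refine intervalIntegral.integral_eq_sub_of_hasDerivAt
        (f := fun s => -(l⁻¹ * Real.exp (l * (t₀ - s)))) (fun s _ => ?_)
        (Continuous.intervalIntegrable (by fun_prop) _ _)
      have := ((((hasDerivAt_id s).const_sub t₀).const_mul l).exp.const_mul l⁻¹).neg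
      refine this.congr_deriv ?_
      simp only [id]; field_simp
    rw [intervalIntegral.integral_symm, abs_neg, e,
      abs_of_nonneg (intervalIntegral.integral_nonneg h fun s _ => (Real.exp_pos _).le), e2,
      abs_of_nonpos (sub_nonpos.2 h), neg_sub]
    have : 0 < l⁻¹ * Real.exp (l * (t₀ - t₀)) := by positivity
    linarith

variable {E : Type*} [NormedAddCommGroup E] [NormedSpace ℝ E] [CompleteSpace E]

/-- Primitives on `[0, T]` of continuous functions. -/
theorem hasDerivWithinAt_of_eq_integral {T t₀ : ℝ} (hT : 0 ≤ T) (ht₀ : t₀ ∈ Icc 0 T)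
    {x g : ℝ → E} (hg : ContinuousOn g (Icc 0 T))
    (h : ∀ t ∈ Icc 0 T, x t = x t₀ + ∫ s in t₀..t, g s) :
    ∀ t ∈ Icc 0 T, HasDerivWithinAt x (g t) (Icc 0 T) t := by
  set g' : ℝ → E := fun t => g (projIcc 0 T hT t)
  have hc : Continuous g' :=
    (continuousOn_iff_continuous_domRestrict.1 hg).comp (continuous_projIcc (h := hT))
  have e : ∀ t ∈ Icc 0 T, g' t = g t := fun t ht => by simp [g', projIcc_of_mem hT ht]
  intro t ht
  rw [← e t ht]
  refine (((hc.integral_hasStrictDerivAt t₀ t).hasDerivAt.const_add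
    (x t₀)).hasDerivWithinAt).congr_of_mem (fun s hs => ?_) ht
  rw [h s hs]
  congr 1
  refine intervalIntegral.integral_congr fun r hr => (e r ?_).symm
  exact uIcc_subset_Icc ht₀ hs hr

theorem eq_integral_of_hasDerivWithinAt {T s t : ℝ} (hs : s ∈ Icc 0 T) (ht : t ∈ Icc 0 T)
    {x g : ℝ → E} (hg : ContinuousOn g (Icc 0 T))
    (h : ∀ t ∈ Icc 0 T, HasDerivWithinAt x (g t) (Icc 0 T) t) :
    x t - x s = ∫ r in s..t, g r := by
  have hsub := uIcc_subset_Icc hs ht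
  symm
  refine intervalIntegral.integral_eq_sub_of_hasDeriv_right
    (fun r hr => ((h r (hsub hr)).continuousWithinAt.mono hsub)) (fun r hr => ?_)
    ((hg.mono hsub).intervalIntegrable)
  have hr' : r ∈ uIcc s t := ⟨hr.1.le, hr.2.le⟩
  refine (h r (hsub hr')).mono_of_mem_nhdsWithin ?_
  exact mem_of_superset (Ioc_mem_nhdsGT hr.2)
    fun y hy => hsub ⟨hr.1.le.trans hy.1.le, hy.2⟩

/-- Global solvability of linear initial value problems, the initial time being arbitrary. -/
theorem exists_hasDerivWithinAt_linear {T t₀ : ℝ} (hT : 0 ≤ T) (ht₀ : t₀ ∈ Icc 0 T)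
    {A : ℝ → E →L[ℝ] E} (hA : ContinuousOn A (Icc 0 T)) {g : ℝ → E}
    (hg : ContinuousOn g (Icc 0 T)) (x₀ : E) :
    ∃ x : ℝ → E, x t₀ = x₀ ∧
      ∀ t ∈ Icc 0 T, HasDerivWithinAt x (A t (x t) + g t) (Icc 0 T) t := by
  obtain ⟨K₀, hK₀⟩ := isCompact_Icc.exists_bound_of_continuousOn hA
  set K := max K₀ 1
  have hK1 : 0 < K := lt_of_lt_of_le one_pos (le_max_right _ _)
  have hK : ∀ t ∈ Icc 0 T, ‖A t‖ ≤ K := fun t ht => (hK₀ t ht).trans (le_max_left _ _)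
  set A' : ℝ → E →L[ℝ] E := fun t => A (projIcc 0 T hT t)
  set g' : ℝ → E := fun t => g (projIcc 0 T hT t)
  have hA' : Continuous A' :=
    (continuousOn_iff_continuous_domRestrict.1 hA).comp (continuous_projIcc (h := hT))
  have hg' : Continuous g' :=
    (continuousOn_iff_continuous_domRestrict.1 hg).comp (continuous_projIcc (h := hT))
  have hA'K : ∀ t, ‖A' t‖ ≤ K := fun t => hK _ (projIcc 0 T hT t).2
  -- With this exponent the contraction factor `K * l⁻¹` is `1 / 2`.
  set l := 2 * K
  have hl : 0 < l := by positivity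
  -- The unknown `w` is the solution divided by the weight, so that the supremum norm of `w` is the
  -- weighted norm of `W w`. The absolute value in the weight allows an interior initial time.
  set W : C(Icc (0 : ℝ) T, E) → ℝ → E :=
    fun w s => Real.exp (l * |s - t₀|) • w (projIcc 0 T hT s)
  have hW : ∀ w, Continuous (W w) := fun w => by
    refine Continuous.smul (by fun_prop) (w.continuous.comp continuous_projIcc)
  have hint : ∀ w, Continuous fun s => A' s (W w s) + g' s :=
    fun w => (hA'.clm_apply (hW w)).add hg'
  set Φ : C(Icc (0 : ℝ) T, E) → C(Icc (0 : ℝ) T, E) := fun w =>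
    ⟨fun t => Real.exp (-(l * |(t : ℝ) - t₀|)) • (x₀ + ∫ s in t₀..t, (A' s (W w s) + g' s)), by
      refine Continuous.smul (by fun_prop) (continuous_const.add ?_)
      exact (intervalIntegral.continuous_primitive
        (fun _ _ => (hint w).intervalIntegrable _ _) t₀).comp continuous_subtype_val⟩
  have hΦ : ContractingWith (1 / 2) Φ := by
    refine ⟨by norm_num [← NNReal.coe_lt_coe], LipschitzWith.of_dist_le_mul fun w w' => ?_⟩
    refine (ContinuousMap.dist_le (by positivity)).2 fun t => ?_
    have e : Φ w t - Φ w' t = Real.exp (-(l * |(t : ℝ) - t₀|)) •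
        ∫ s in t₀..t, A' s (W w s - W w' s) := by
      change Real.exp (-(l * |(t : ℝ) - t₀|)) • (x₀ + ∫ s in t₀..t, (A' s (W w s) + g' s)) -
        Real.exp (-(l * |(t : ℝ) - t₀|)) • (x₀ + ∫ s in t₀..t, (A' s (W w' s) + g' s)) = _
      rw [← smul_sub, add_sub_add_left_eq_sub, ← intervalIntegral.integral_sub
        ((hint w).intervalIntegrable _ _) ((hint w').intervalIntegrable _ _)]
      simp only [add_sub_add_right_eq_sub, map_sub]
    have h1 : ‖∫ s in t₀..t, A' s (W w s - W w' s)‖ ≤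
        |∫ s in t₀..t, K * dist w w' * Real.exp (l * |s - t₀|)| := by
      refine intervalIntegral.norm_integral_le_abs_of_norm_le (Eventually.of_forall fun s => ?_)
        (Continuous.intervalIntegrable (by fun_prop) _ _)
      refine ((A' s).le_opNorm _).trans ?_
      rw [mul_assoc]
      gcongr
      · exact hA'K s
      · simp only [W]
        rw [← smul_sub, norm_smul, Real.norm_eq_abs, abs_of_pos (Real.exp_pos _), mul_comm]
        gcongr
        rw [← dist_eq_norm]
        exact ContinuousMap.dist_apply_le_dist _
    rw [intervalIntegral.integral_const_mul, abs_mul, abs_of_nonneg (by positivity)] at h1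
    have h2 := abs_integral_exp_abs_le hl t₀ t
    rw [dist_eq_norm, e, norm_smul, Real.norm_eq_abs, abs_of_pos (Real.exp_pos _)]
    calc Real.exp (-(l * |(t : ℝ) - t₀|)) * ‖∫ s in t₀..t, A' s (W w s - W w' s)‖
        ≤ Real.exp (-(l * |(t : ℝ) - t₀|)) *
          (K * dist w w' * (l⁻¹ * Real.exp (l * |(t : ℝ) - t₀|))) := by
          refine mul_le_mul_of_nonneg_left (h1.trans ?_) (Real.exp_pos _).le
          exact mul_le_mul_of_nonneg_left h2 (by positivity)
      _ = ((1 / 2 : NNReal) : ℝ) * dist w w' := by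
          rw [Real.exp_neg]
          simp only [l]
          push_cast
          field_simp
  obtain ⟨w, hw⟩ : ∃ w, Φ w = w := ⟨_, hΦ.fixedPoint_isFixedPt⟩
  have hwt : ∀ t ∈ Icc 0 T, W w t = x₀ + ∫ s in t₀..t, (A' s (W w s) + g' s) := fun t ht => by
    have h1 : w ⟨t, ht⟩ = Real.exp (-(l * |t - t₀|)) •
        (x₀ + ∫ s in t₀..t, (A' s (W w s) + g' s)) := by
      conv_lhs => rw [← hw]
      rfl
    conv_lhs => simp only [W]
    rw [projIcc_of_mem hT ht, h1, smul_smul, ← Real.exp_add]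
    simp
  have h0 : W w t₀ = x₀ := by rw [hwt t₀ ht₀]; simp
  refine ⟨W w, h0, fun t ht => ?_⟩
  have := hasDerivWithinAt_of_eq_integral hT ht₀ (x := W w) (hint w).continuousOn
    (fun s hs => by rw [hwt s hs, h0]) t ht
  simpa [A', g', projIcc_of_mem hT ht] using this

end LinearODE

/-! ### The abstract wave equation and its low-order energy estimate -/

/-- The data of an abstract wave equation `(i†u)' = S v - B v + F`, `(i v)' = u` on `[0, T]`, with
`V` densely embedded into `H` by `i`, `S = i†i` and `B(t)` symmetric, coercive and Lipschitz in
time. -/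
structure WaveForm (V H : Type*) [NormedAddCommGroup V] [InnerProductSpace ℝ V]
    [NormedAddCommGroup H] [InnerProductSpace ℝ H] (T : ℝ) where
  incl : V →L[ℝ] H
  dense : DenseRange incl
  inj : Function.Injective incl
  op : ℝ → V →L[ℝ] V
  symm : ∀ t ∈ Icc 0 T, ∀ u w, inner ℝ (op t u) w = inner ℝ u (op t w)
  c : ℝ
  c_pos : 0 < c
  coercive : ∀ t ∈ Icc 0 T, ∀ u, c * ‖u‖ ^ 2 ≤ inner ℝ (op t u) u
  M : ℝ
  M_pos : 0 < M
  bound : ∀ t ∈ Icc 0 T, ‖op t‖ ≤ M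
  L : ℝ
  L_nonneg : 0 ≤ L
  lip : ∀ s ∈ Icc 0 T, ∀ t ∈ Icc 0 T, ‖op s - op t‖ ≤ L * |s - t|

namespace WaveForm

variable {V H : Type*} [NormedAddCommGroup V] [InnerProductSpace ℝ V] [CompleteSpace V]
  [NormedAddCommGroup H] [InnerProductSpace ℝ H] [CompleteSpace H] {T : ℝ} (D : WaveForm V H T)

/-- `i†`. -/
def coincl : H →L[ℝ] V := D.incl.adjoint

/-- `S = i†i`. -/
def gram : V →L[ℝ] V := D.coincl ∘L D.incl

theorem inner_coincl_left (h : H) (φ : V) :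
    inner ℝ (D.coincl h) φ = inner ℝ h (D.incl φ) := D.incl.adjoint_inner_left φ h

theorem inner_coincl_right (h : H) (φ : V) :
    inner ℝ φ (D.coincl h) = inner ℝ (D.incl φ) h := D.incl.adjoint_inner_right φ h

theorem gram_apply (u : V) : D.gram u = D.coincl (D.incl u) := rfl

theorem inner_gram_left (u φ : V) :
    inner ℝ (D.gram u) φ = inner ℝ (D.incl u) (D.incl φ) := D.inner_coincl_left _ _

/-- A vector orthogonal to the range of `i†` is annihilated by `i`, which is injective. -/
theorem denseRange_coincl : DenseRange D.coincl := by
  have h : (LinearMap.range (D.coincl : H →ₗ[ℝ] V)).topologicalClosure = ⊤ := by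
    rw [Submodule.topologicalClosure_eq_top_iff, Submodule.eq_bot_iff]
    intro x hx
    refine D.inj ?_
    rw [map_zero]
    refine ext_inner_left ℝ fun h => ?_
    rw [inner_zero_right, ← D.inner_coincl_left]
    exact (Submodule.mem_orthogonal _ _).1 hx _ ⟨h, rfl⟩
  have := Submodule.dense_iff_topologicalClosure_eq_top.2 h
  rwa [LinearMap.coe_range] at this

theorem coincl_injective : Function.Injective D.coincl := by
  refine (injective_iff_map_eq_zero D.coincl).2 fun u hu => ?_
  refine D.dense.eq_zero_of_inner_left ℝ fun φ => ?_
  rw [← D.inner_coincl_left, hu, inner_zero_left]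

omit [CompleteSpace V] [CompleteSpace H] in
theorem continuousOn_op : ContinuousOn D.op (Icc 0 T) := by
  refine (LipschitzOnWith.of_dist_le_mul (K := D.L.toNNReal) fun r hr r' hr' => ?_).continuousOn
  rw [dist_eq_norm, Real.dist_eq, Real.coe_toNNReal _ D.L_nonneg]
  exact D.lip r hr r' hr'

/-- The energy estimate one level below: control of `v` in `H` and of the momentum in `V`. -/
theorem exists_low_energy_estimate (hT : 0 ≤ T) : ∃ C, 0 ≤ C ∧ ∀ (z y : ℝ → V) (u : ℝ → H) (ρ : ℝ),
    0 ≤ ρ → (∀ t ∈ Icc 0 T, HasDerivWithinAt (fun t => D.incl (z t)) (u t) (Icc 0 T) t) →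
    (∀ t ∈ Icc 0 T, HasDerivWithinAt y (D.gram (z t) - D.op t (z t)) (Icc 0 T) t) →
    (∀ t ∈ Icc 0 T, |inner ℝ (y t - D.coincl (u t)) (z t)| ≤ ρ) →
    ∀ t₀ ∈ Icc 0 T, ∀ t ∈ Icc 0 T, ‖D.incl (z t)‖ ^ 2 + ‖y t‖ ^ 2 ≤
      C * (‖D.incl (z t₀)‖ ^ 2 + ‖y t₀‖ ^ 2 + ρ) := by
  have hK : ∀ t, ∃ K : V →L[ℝ] V, t ∈ Icc 0 T → (∀ u, D.op t (K u) = u) ∧ ‖K‖ ≤ D.c⁻¹ := by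
    intro t
    by_cases ht : t ∈ Icc 0 T
    · obtain ⟨K, h1, -, h3⟩ := exists_inverse_of_coercive D.c_pos (D.coercive t ht)
      exact ⟨K, fun _ => ⟨h1, h3⟩⟩
    · exact ⟨0, fun h => absurd h ht⟩
  choose K hK using hK
  have hc := D.c_pos
  have hM := D.M_pos
  have hL := D.L_nonneg
  have hKB : ∀ t ∈ Icc 0 T, ∀ x w, inner ℝ (K t x) (D.op t w) = inner ℝ x w := fun t ht x w => by
    rw [← D.symm t ht, (hK t ht).1]
  have hKsymm : ∀ t ∈ Icc 0 T, ∀ x w, inner ℝ (K t x) w = inner ℝ x (K t w) := fun t ht x w => by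
    conv_lhs => rw [← (hK t ht).1 w]
    rw [hKB t ht]
  have hKlow : ∀ t ∈ Icc 0 T, ∀ x, ‖x‖ ^ 2 ≤ D.M ^ 2 / D.c * inner ℝ (K t x) x := fun t ht x => by
    have h1 : ‖x‖ ≤ D.M * ‖K t x‖ := by
      conv_lhs => rw [← (hK t ht).1 x]
      exact (D.op t).le_of_opNorm_le (D.bound t ht) _
    have h2 := D.coercive t ht (K t x)
    rw [(hK t ht).1, real_inner_comm] at h2
    calc ‖x‖ ^ 2 ≤ (D.M * ‖K t x‖) ^ 2 := by gcongr
      _ = D.M ^ 2 / D.c * (D.c * ‖K t x‖ ^ 2) := by field_simp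
      _ ≤ _ := by gcongr
  have hKup : ∀ t ∈ Icc 0 T, ∀ x, inner ℝ (K t x) x ≤ D.c⁻¹ * ‖x‖ ^ 2 := fun t ht x => by
    calc inner ℝ (K t x) x ≤ ‖K t x‖ * ‖x‖ := real_inner_le_norm _ _
      _ ≤ (D.c⁻¹ * ‖x‖) * ‖x‖ := by
          gcongr; exact (K t).le_of_opNorm_le (hK t ht).2 _
      _ = _ := by ring
  have hKlip : ∀ s ∈ Icc 0 T, ∀ t ∈ Icc 0 T, ‖K s - K t‖ ≤ (D.L * D.c⁻¹ ^ 2) * |s - t| := by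
    intro s hs t ht
    refine ContinuousLinearMap.opNorm_le_bound _ (by positivity) fun x => ?_
    -- The resolvent identity transfers the Lipschitz bound from `B` to its inverse.
    have e : (K s - K t) x = K s ((D.op t - D.op s) (K t x)) := by
      have h1 : K s (D.op s (K t x)) = K t x := by
        refine ext_inner_right ℝ fun w => ?_
        rw [hKsymm s hs, D.symm s hs, (hK s hs).1]
      simp only [_root_.sub_apply, map_sub, (hK t ht).1, h1]
    rw [e]
    calc ‖K s ((D.op t - D.op s) (K t x))‖ ≤ D.c⁻¹ * ((D.L * |s - t|) * (D.c⁻¹ * ‖x‖)) := by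
          refine ((K s).le_of_opNorm_le (hK s hs).2 _).trans ?_
          gcongr
          refine ((D.op t - D.op s).le_of_opNorm_le (D.lip t ht s hs) _).trans ?_
          rw [abs_sub_comm]
          gcongr
          exact (K t).le_of_opNorm_le (hK t ht).2 _
      _ = _ := by ring
  set C₂ := ‖D.incl‖ * D.c⁻¹ with hC₂d
  set C₁ := C₂ + (C₂ + D.L * D.c⁻¹ ^ 2) * (D.M ^ 2 / D.c) with hC₁d
  have hC₂ : 0 ≤ C₂ := by positivity
  have hC₁ : 0 ≤ C₁ := by positivity
  refine ⟨(1 + D.M ^ 2 / D.c) * (1 + D.c⁻¹ + 2 * T) * Real.exp (C₁ * (T - 0)), by positivity,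
    fun z y u ρ hρ hz hy hyu t₀ ht₀ t ht => ?_⟩
  -- In the derivative, `⟨K y, B z⟩ = ⟨y, z⟩` cancels `⟨i z, u⟩ = ⟨z, i†u⟩` up to `ρ`, because `y`
  -- is nearly `i†u`. What remains is `⟨i K y, i z⟩` and the time variation of `K`, both controlled
  -- by `e`. The vector `z` enters the bounds only through `i z`.
  set e : ℝ → ℝ := fun t => ‖D.incl (z t)‖ ^ 2 + inner ℝ (K t (y t)) (y t) with he
  have hyc : ContinuousOn y (Icc 0 T) := fun r hr => (hy r hr).continuousWithinAt
  have hKc : ContinuousOn K (Icc 0 T) := by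
    refine (LipschitzOnWith.of_dist_le_mul (K := (D.L * D.c⁻¹ ^ 2).toNNReal)
      fun r hr r' hr' => ?_).continuousOn
    rw [dist_eq_norm, Real.dist_eq, Real.coe_toNNReal _ (by positivity)]
    exact hKlip r hr r' hr'
  have hec : ContinuousOn e (Icc 0 T) := by
    have h1 : ContinuousOn (fun t => D.incl (z t)) (Icc 0 T) :=
      fun r hr => (hz r hr).continuousWithinAt
    exact (h1.norm.pow 2).add ((hKc.clm_apply hyc).inner hyc)
  have hK0 : ∀ r ∈ Icc 0 T, 0 ≤ inner ℝ (K r (y r)) (y r) := fun r hr => by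
    by_contra hneg
    push Not at hneg
    have h1 := hKlow r hr (y r)
    have h2 : D.M ^ 2 / D.c * inner ℝ (K r (y r)) (y r) < 0 :=
      mul_neg_of_pos_of_neg (by positivity) hneg
    nlinarith [sq_nonneg ‖y r‖]
  have he0 : ∀ r ∈ Icc 0 T, 0 ≤ e r := fun r hr => add_nonneg (by positivity) (hK0 r hr)
  have hye : ∀ r ∈ Icc 0 T, ‖y r‖ ^ 2 ≤ D.M ^ 2 / D.c * e r := fun r hr =>
    (hKlow r hr (y r)).trans (by gcongr; simp only [he]; nlinarith [sq_nonneg ‖D.incl (z r)‖])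
  have hstep : ∀ r ∈ Icc 0 T, e r ≤ (e t₀ + 2 * ρ * T) + C₁ * |∫ s in t₀..r, e s| := by
    intro r hr
    have h1 := abs_sub_le_integral_quadratic (a := fun t => ‖D.incl (z t)‖ ^ 2)
      (a' := fun t => 2 * inner ℝ (D.incl (z t)) (u t)) (x := y) (G := K)
      (R := fun t => C₁ * e t + 2 * ρ) (L := D.L * D.c⁻¹ ^ 2) (by positivity)
      (fun t ht => (hz t ht).norm_sq) hy hKsymm hKlip
      ((continuousOn_const.mul hec).add continuousOn_const) (fun s hs => ?_) ht₀ hr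
    · have hie : IntervalIntegrable e volume t₀ r :=
        (hec.mono (uIcc_subset_Icc ht₀ hr)).intervalIntegrable
      have h2 : |∫ s in t₀..r, (C₁ * e s + 2 * ρ)| ≤ C₁ * |∫ s in t₀..r, e s| + 2 * ρ * T := by
        rw [intervalIntegral.integral_add (hie.const_mul _) intervalIntegrable_const,
          intervalIntegral.integral_const_mul, intervalIntegral.integral_const, smul_eq_mul]
        refine (abs_add_le _ _).trans ?_
        rw [abs_mul, abs_of_nonneg hC₁, abs_mul, abs_of_nonneg (show 0 ≤ 2 * ρ by positivity)]
        have : |r - t₀| ≤ T := abs_le.2 ⟨by linarith [hr.1, ht₀.2], by linarith [hr.2, ht₀.1]⟩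
        nlinarith
      have h3 := (le_abs_self _).trans (h1.trans h2)
      simp only [he] at h3 ⊢
      linarith
    · have e1 : 2 * inner ℝ (D.incl (z s)) (u s) +
          2 * inner ℝ (K s (y s)) (D.gram (z s) - D.op s (z s)) =
          -2 * inner ℝ (y s - D.coincl (u s)) (z s) +
            2 * inner ℝ (D.incl (K s (y s))) (D.incl (z s)) := by
        rw [inner_sub_right, hKB s hs, gram_apply, D.inner_coincl_right, inner_sub_left,
          D.inner_coincl_left, real_inner_comm (u s)]
        ring
      have e2 : |inner ℝ (D.incl (K s (y s))) (D.incl (z s))| ≤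
          ‖D.incl‖ * (D.c⁻¹ * ‖y s‖) * ‖D.incl (z s)‖ := by
        refine (abs_real_inner_le_norm _ _).trans ?_
        gcongr
        refine (D.incl.le_opNorm _).trans ?_
        gcongr
        exact (K s).le_of_opNorm_le (hK s hs).2 _
      rw [e1]
      have e3 : |-2 * inner ℝ (y s - D.coincl (u s)) (z s) +
          2 * inner ℝ (D.incl (K s (y s))) (D.incl (z s))| ≤
          2 * ρ + 2 * (‖D.incl‖ * (D.c⁻¹ * ‖y s‖) * ‖D.incl (z s)‖) := by
        refine (abs_add_le _ _).trans ?_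
        rw [abs_mul, abs_mul, abs_neg, abs_two]
        linarith [hyu s hs]
      have e4 : ‖D.incl (z s)‖ ^ 2 ≤ e s := by simp only [he]; linarith [hK0 s hs]
      have e5 : C₂ * ‖D.incl (z s)‖ ^ 2 ≤ C₂ * e s := by gcongr
      have e6 : (C₂ + D.L * D.c⁻¹ ^ 2) * ‖y s‖ ^ 2 ≤
          (C₂ + D.L * D.c⁻¹ ^ 2) * (D.M ^ 2 / D.c * e s) := by
        gcongr; exact hye s hs
      have e7 : 0 ≤ C₂ * (‖y s‖ - ‖D.incl (z s)‖) ^ 2 := by positivity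
      have e8 : 2 * (‖D.incl‖ * (D.c⁻¹ * ‖y s‖) * ‖D.incl (z s)‖) =
          C₂ * (2 * ‖y s‖ * ‖D.incl (z s)‖) := by rw [hC₂d]; ring
      have e9 : C₁ * e s = C₂ * e s + (C₂ + D.L * D.c⁻¹ ^ 2) * (D.M ^ 2 / D.c * e s) := by
        rw [hC₁d]; ring
      rw [e9]
      nlinarith
  have key := le_exp_of_le_add_abs_integral (by have := he0 t₀ ht₀; positivity) hC₁ ht₀ hec he0 hstep t ht
  have h0 : e t₀ ≤ ‖D.incl (z t₀)‖ ^ 2 + D.c⁻¹ * ‖y t₀‖ ^ 2 := by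
    simp only [he]; linarith [hKup t₀ ht₀ (y t₀)]
  have h1 : ‖D.incl (z t)‖ ^ 2 + ‖y t‖ ^ 2 ≤ (1 + D.M ^ 2 / D.c) * e t := by
    have := hye t ht
    have h2 : ‖D.incl (z t)‖ ^ 2 ≤ e t := by simp only [he]; linarith [hK0 t ht]
    linarith
  refine h1.trans ?_
  rw [mul_assoc, mul_assoc]
  refine mul_le_mul_of_nonneg_left (key.trans ?_) (by positivity)
  rw [mul_left_comm, mul_comm]
  refine mul_le_mul_of_nonneg_left ?_ (Real.exp_pos _).le
  have p1 : 0 ≤ D.c⁻¹ := by positivity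
  have p2 : 0 ≤ ‖D.incl (z t₀)‖ ^ 2 := by positivity
  have p3 : 0 ≤ ‖y t₀‖ ^ 2 := by positivity
  have p4 := mul_nonneg p1 p2
  have p5 := mul_nonneg p1 hρ
  have p6 := mul_nonneg hT (add_nonneg p2 p3)
  nlinarith

/-! ### The regularised equation and its uniform energy estimate -/

/-- Solutions of the regularised equation `((S + ε) v')' = S v - B v + i†f + p`. -/
structure IsApprox (f : ℝ → H) (p : ℝ → V) (ε : ℝ) (v w : ℝ → V) : Prop where
  deriv_fst : ∀ t ∈ Icc 0 T, HasDerivWithinAt v (w t) (Icc 0 T) t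
  deriv_snd : ∀ t ∈ Icc 0 T, ∃ b, HasDerivWithinAt w b (Icc 0 T) t ∧
    D.gram b + ε • b = D.gram (v t) - D.op t (v t) + (D.coincl (f t) + p t)

/-- For `ε > 0` the operator `S + ε` is coercive on `V`, hence invertible, and the equation is a
linear first-order system in `V × V` with bounded coefficients. -/
theorem exists_isApprox (hT : 0 ≤ T) {f : ℝ → H} {p : ℝ → V} (hf : ContinuousOn f (Icc 0 T))
    (hp : ContinuousOn p (Icc 0 T)) {ε : ℝ} (hε : 0 < ε) {t₀ : ℝ} (ht₀ : t₀ ∈ Icc 0 T)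
    (v₀ w₀ : V) : ∃ v w, D.IsApprox f p ε v w ∧ v t₀ = v₀ ∧ w t₀ = w₀ := by
  obtain ⟨K, hK, -, -⟩ := exists_inverse_of_coercive
    (G := D.gram + ε • ContinuousLinearMap.id ℝ V) hε (fun u => by
      simp only [_root_.add_apply, inner_add_left, D.inner_gram_left,
        _root_.smul_apply, ContinuousLinearMap.id_apply, inner_smul_left,
        real_inner_self_eq_norm_sq]
      simp)
  obtain ⟨x, hx0, hx⟩ := exists_hasDerivWithinAt_linear hT ht₀
    (A := fun t => ContinuousLinearMap.inl ℝ V V ∘L ContinuousLinearMap.snd ℝ V V +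
      ContinuousLinearMap.inr ℝ V V ∘L K ∘L (D.gram - D.op t) ∘L ContinuousLinearMap.fst ℝ V V)
    (continuousOn_const.add (continuousOn_const.clm_comp (continuousOn_const.clm_comp
      ((continuousOn_const.sub D.continuousOn_op).clm_comp continuousOn_const))))
    (g := fun t => ((0 : V), K (D.coincl (f t) + p t)))
    (continuousOn_const.prodMk (K.continuous.comp_continuousOn
      ((D.coincl.continuous.comp_continuousOn hf).add hp))) (v₀, w₀)
  refine ⟨fun t => (x t).1, fun t => (x t).2, ⟨fun t ht => ?_, fun t ht =>
    ⟨K (D.gram (x t).1 - D.op t (x t).1 + (D.coincl (f t) + p t)), ?_, ?_⟩⟩, by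
    simp [hx0], by simp [hx0]⟩
  · have := (ContinuousLinearMap.fst ℝ V V).hasFDerivAt.comp_hasDerivWithinAt t (hx t ht)
    simpa [Function.comp_def] using this
  · have := (ContinuousLinearMap.snd ℝ V V).hasFDerivAt.comp_hasDerivWithinAt t (hx t ht)
    simpa [Function.comp_def] using this
  · exact hK _

variable {D}

namespace IsApprox

variable {f : ℝ → H} {p : ℝ → V} {ε : ℝ} {v w : ℝ → V}

theorem hasDerivWithinAt_momentum (h : D.IsApprox f p ε v w) {t : ℝ} (ht : t ∈ Icc 0 T) :
    HasDerivWithinAt (fun t => D.gram (w t) + ε • w t)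
      (D.gram (v t) - D.op t (v t) + (D.coincl (f t) + p t)) (Icc 0 T) t := by
  obtain ⟨b, hb, e⟩ := h.deriv_snd t ht
  rw [← e]
  exact (D.gram.hasFDerivAt.comp_hasDerivWithinAt t hb).add (hb.const_smul ε)

theorem continuousOn_fst (h : D.IsApprox f p ε v w) : ContinuousOn v (Icc 0 T) :=
  fun t ht => (h.deriv_fst t ht).continuousWithinAt

theorem continuousOn_snd (h : D.IsApprox f p ε v w) : ContinuousOn w (Icc 0 T) := fun t ht => by
  obtain ⟨b, hb, -⟩ := h.deriv_snd t ht
  exact hb.continuousWithinAt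

/-- The equation is tested with the velocity `w`. The term `⟨p, w⟩` is not controlled uniformly in
`ε`, since only `‖i w‖` is; including `-2 ⟨p, v⟩` in the energy replaces it by `⟨p', v⟩`. -/
theorem energy_sub_le (h : D.IsApprox f p ε v w) {p' : ℝ → V}
    (hf : ContinuousOn f (Icc 0 T)) (hp' : ContinuousOn p' (Icc 0 T))
    (hp : ∀ t ∈ Icc 0 T, HasDerivWithinAt p (p' t) (Icc 0 T) t) {s t : ℝ}
    (hs : s ∈ Icc 0 T) (ht : t ∈ Icc 0 T) :
    |(‖D.incl (w t)‖ ^ 2 + ε * ‖w t‖ ^ 2 - 2 * inner ℝ (p t) (v t) +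
        inner ℝ (D.op t (v t)) (v t)) -
      (‖D.incl (w s)‖ ^ 2 + ε * ‖w s‖ ^ 2 - 2 * inner ℝ (p s) (v s) +
        inner ℝ (D.op s (v s)) (v s))| ≤
      |∫ r in s..t, (2 * (‖D.incl (v r)‖ + ‖f r‖) * ‖D.incl (w r)‖ + 2 * ‖p' r‖ * ‖v r‖ +
        D.L * ‖v r‖ ^ 2)| := by
  have hvc := h.continuousOn_fst
  have hwc := h.continuousOn_snd
  have hivc := D.incl.continuous.comp_continuousOn hvc
  have hiwc := D.incl.continuous.comp_continuousOn hwc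
  choose! b hb he using h.deriv_snd
  refine abs_sub_le_integral_quadratic (L := D.L) (G := D.op) (x := v) (x' := w)
    (a := fun t => ‖D.incl (w t)‖ ^ 2 + ε * ‖w t‖ ^ 2 - 2 * inner ℝ (p t) (v t))
    (a' := fun t => 2 * inner ℝ (D.incl (w t)) (D.incl (b t)) + ε * (2 * inner ℝ (w t) (b t)) -
      2 * (inner ℝ (p t) (w t) + inner ℝ (p' t) (v t))) D.L_nonneg
    (fun r hr => ?_) h.deriv_fst D.symm D.lip ?_ (fun r hr => ?_) hs ht
  · exact (((D.incl.hasFDerivAt.comp_hasDerivWithinAt r (hb r hr)).norm_sq).add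
      ((hb r hr).norm_sq.const_mul ε)).sub
      (((hp r hr).inner ℝ (h.deriv_fst r hr)).const_mul 2)
  · exact (((continuousOn_const.mul (hivc.norm.add hf.norm)).mul hiwc.norm).add
      ((continuousOn_const.mul hp'.norm).mul hvc.norm)).add
      (continuousOn_const.mul (hvc.norm.pow 2))
  · gcongr
    have e1 : 2 * inner ℝ (D.incl (w r)) (D.incl (b r)) + ε * (2 * inner ℝ (w r) (b r)) -
        2 * (inner ℝ (p r) (w r) + inner ℝ (p' r) (v r)) + 2 * inner ℝ (D.op r (v r)) (w r) =
        2 * inner ℝ (D.incl (v r) + f r) (D.incl (w r)) - 2 * inner ℝ (p' r) (v r) := by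
      have := congrArg (fun x => inner ℝ x (w r)) (he r hr)
      simp only [inner_add_left, inner_sub_left, D.inner_gram_left, D.inner_coincl_left,
        real_inner_smul_left] at this
      rw [inner_add_left, real_inner_comm (D.incl (b r)), real_inner_comm (b r)]
      linarith
    rw [e1]
    refine (abs_sub _ _).trans ?_
    rw [abs_mul, abs_mul, abs_two]
    have e2 := (abs_real_inner_le_norm (D.incl (v r) + f r) (D.incl (w r))).trans
      (mul_le_mul_of_nonneg_right (norm_add_le _ _) (norm_nonneg _))
    have e3 := abs_real_inner_le_norm (p' r) (v r)
    linarith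

end IsApprox

variable (D) in
/-- The energy estimate, uniform in the regularisation parameter. -/
theorem exists_energy_estimate (hT : 0 ≤ T) : ∃ C, 0 ≤ C ∧ ∀ (f : ℝ → H) (p p' : ℝ → V) (ε P : ℝ)
    (v w : ℝ → V), 0 ≤ ε → D.IsApprox f p ε v w → ContinuousOn f (Icc 0 T) →
    ContinuousOn p' (Icc 0 T) → (∀ t ∈ Icc 0 T, HasDerivWithinAt p (p' t) (Icc 0 T) t) →
    (∀ t ∈ Icc 0 T, ‖p t‖ ≤ P) → ∀ t₀ ∈ Icc 0 T, ∀ t ∈ Icc 0 T,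
    ‖D.incl (w t)‖ ^ 2 + ε * ‖w t‖ ^ 2 + D.c * ‖v t‖ ^ 2 ≤
      C * (‖D.incl (w t₀)‖ ^ 2 + ε * ‖w t₀‖ ^ 2 + ‖v t₀‖ ^ 2 + P ^ 2 +
        ∫ r in 0..T, (‖f r‖ ^ 2 + ‖p' r‖ ^ 2)) := by
  have hc := D.c_pos
  have hM := D.M_pos
  have hL := D.L_nonneg
  set C₁ := 2 * (2 + (‖D.incl‖ ^ 2 + 1 + D.L) * D.c⁻¹) with hC₁
  have hC₁0 : 0 ≤ C₁ := by positivity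
  refine ⟨(3 + 3 * D.M + 8 * D.c⁻¹) * Real.exp (C₁ * (T - 0)), by positivity,
    fun f p p' ε P v w hε h hf hp' hp hP t₀ ht₀ t ht => ?_⟩
  set N : ℝ → ℝ := fun t => ‖D.incl (w t)‖ ^ 2 + ε * ‖w t‖ ^ 2 + inner ℝ (D.op t (v t)) (v t)
    with hN
  have hvc := h.continuousOn_fst
  have hwc := h.continuousOn_snd
  have hivc := D.incl.continuous.comp_continuousOn hvc
  have hiwc := D.incl.continuous.comp_continuousOn hwc
  have hNc : ContinuousOn N (Icc 0 T) :=
    ((hiwc.norm.pow 2).add (continuousOn_const.mul (hwc.norm.pow 2))).add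
      ((D.continuousOn_op.clm_apply hvc).inner hvc)
  have hNlow : ∀ r ∈ Icc 0 T, ‖D.incl (w r)‖ ^ 2 + ε * ‖w r‖ ^ 2 + D.c * ‖v r‖ ^ 2 ≤ N r :=
    fun r hr => by simp only [hN]; linarith [D.coercive r hr (v r)]
  have hN0 : ∀ r ∈ Icc 0 T, 0 ≤ N r := fun r hr => le_trans (by positivity) (hNlow r hr)
  have hvN : ∀ r ∈ Icc 0 T, D.c * ‖v r‖ ^ 2 ≤ N r := fun r hr =>
    le_trans (by have : 0 ≤ ε * ‖w r‖ ^ 2 := by positivity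
                 nlinarith [sq_nonneg ‖D.incl (w r)‖]) (hNlow r hr)
  have hwN : ∀ r ∈ Icc 0 T, ‖D.incl (w r)‖ ^ 2 ≤ N r := fun r hr =>
    le_trans (by have : 0 ≤ ε * ‖w r‖ ^ 2 := by positivity
                 have : 0 ≤ D.c * ‖v r‖ ^ 2 := by positivity
                 linarith) (hNlow r hr)
  -- Half of the energy absorbs the source term. Multiplying the resulting inequality by two
  -- produces the coefficients `3`, `8 c⁻¹` and `2` in `hstep` and the factor two in `C₁`.
  have hpv : ∀ r ∈ Icc 0 T, |2 * inner ℝ (p r) (v r)| ≤ 2 * D.c⁻¹ * P ^ 2 + N r / 2 :=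
    fun r hr => by
      have h1 : |inner ℝ (p r) (v r)| ≤ P * ‖v r‖ := (abs_real_inner_le_norm _ _).trans
        (by gcongr; exact hP r hr)
      have h2 := hvN r hr
      have h3 : 0 ≤ D.c⁻¹ / 2 * (2 * P - D.c * ‖v r‖) ^ 2 := by positivity
      have h4 : D.c⁻¹ / 2 * (2 * P - D.c * ‖v r‖) ^ 2 =
          2 * D.c⁻¹ * P ^ 2 - 2 * (P * ‖v r‖) + D.c * ‖v r‖ ^ 2 / 2 := by
        field_simp; ring
      rw [abs_mul, abs_two]
      linarith
  set J := ∫ r in 0..T, (‖f r‖ ^ 2 + ‖p' r‖ ^ 2) with hJ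
  have hJc : ContinuousOn (fun r => ‖f r‖ ^ 2 + ‖p' r‖ ^ 2) (Icc 0 T) :=
    (hf.norm.pow 2).add (hp'.norm.pow 2)
  have hJ0 : 0 ≤ J := intervalIntegral.integral_nonneg hT fun r _ => by positivity
  have hstep : ∀ r ∈ Icc 0 T, N r ≤ (3 * N t₀ + 8 * D.c⁻¹ * P ^ 2 + 2 * J) +
      C₁ * |∫ s in t₀..r, N s| := by
    intro r hr
    have h1 := (le_abs_self _).trans (h.energy_sub_le hf hp' hp ht₀ hr)
    have hsub := uIcc_subset_Icc ht₀ hr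
    have hNi : IntervalIntegrable N volume t₀ r := (hNc.mono hsub).intervalIntegrable
    have hJi : IntervalIntegrable (fun r => ‖f r‖ ^ 2 + ‖p' r‖ ^ 2) volume t₀ r :=
      (hJc.mono hsub).intervalIntegrable
    have h2 : |∫ r in t₀..r, (2 * (‖D.incl (v r)‖ + ‖f r‖) * ‖D.incl (w r)‖ +
        2 * ‖p' r‖ * ‖v r‖ + D.L * ‖v r‖ ^ 2)| ≤
        |∫ s in t₀..r, (C₁ / 2 * N s + (‖f s‖ ^ 2 + ‖p' s‖ ^ 2))| := by
      rw [← Real.norm_eq_abs]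
      refine intervalIntegral.norm_integral_le_abs_of_norm_le ?_
        ((hNi.const_mul _).add hJi)
      refine (ae_restrict_iff' measurableSet_uIoc).2 (Eventually.of_forall fun s hs => ?_)
      have hs' : s ∈ Icc 0 T := hsub (uIoc_subset_uIcc hs)
      rw [Real.norm_eq_abs, abs_of_nonneg (by positivity)]
      have k1 : ‖D.incl (v s)‖ ≤ ‖D.incl‖ * ‖v s‖ := D.incl.le_opNorm _
      have k2 : 2 * ‖D.incl (v s)‖ * ‖D.incl (w s)‖ ≤
          ‖D.incl‖ ^ 2 * ‖v s‖ ^ 2 + ‖D.incl (w s)‖ ^ 2 := by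
        nlinarith [sq_nonneg (‖D.incl‖ * ‖v s‖ - ‖D.incl (w s)‖), norm_nonneg (D.incl (w s))]
      have k3 : 2 * ‖f s‖ * ‖D.incl (w s)‖ ≤ ‖f s‖ ^ 2 + ‖D.incl (w s)‖ ^ 2 := by
        nlinarith [sq_nonneg (‖f s‖ - ‖D.incl (w s)‖)]
      have k4 : 2 * ‖p' s‖ * ‖v s‖ ≤ ‖p' s‖ ^ 2 + ‖v s‖ ^ 2 := by
        nlinarith [sq_nonneg (‖p' s‖ - ‖v s‖)]
      have k5 : (‖D.incl‖ ^ 2 + 1 + D.L) * ‖v s‖ ^ 2 ≤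
          (‖D.incl‖ ^ 2 + 1 + D.L) * D.c⁻¹ * N s := by
        have := hvN s hs'
        calc (‖D.incl‖ ^ 2 + 1 + D.L) * ‖v s‖ ^ 2 =
            (‖D.incl‖ ^ 2 + 1 + D.L) * D.c⁻¹ * (D.c * ‖v s‖ ^ 2) := by field_simp
          _ ≤ _ := by gcongr
      have k6 := hwN s hs'
      rw [hC₁]
      linarith
    have h3 : |∫ s in t₀..r, (C₁ / 2 * N s + (‖f s‖ ^ 2 + ‖p' s‖ ^ 2))| ≤
        C₁ / 2 * |∫ s in t₀..r, N s| + J := by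
      rw [intervalIntegral.integral_add (hNi.const_mul _) hJi,
        intervalIntegral.integral_const_mul]
      refine (abs_add_le _ _).trans ?_
      rw [abs_mul, abs_of_nonneg (show 0 ≤ C₁ / 2 by positivity)]
      gcongr
      refine le_trans ?_ (abs_of_nonneg hJ0).le
      refine intervalIntegral.abs_integral_mono_interval ?_
        (Eventually.of_forall fun s => by positivity)
        ((hJc.mono (by rw [uIcc_of_le hT])).intervalIntegrable)
      rw [uIoc_of_le hT]
      intro s hs
      rcases le_total t₀ r with hle | hle
      · rw [uIoc_of_le hle] at hs; exact ⟨ht₀.1.trans_lt hs.1, hs.2.trans hr.2⟩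
      · rw [uIoc_of_ge hle] at hs; exact ⟨hr.1.trans_lt hs.1, hs.2.trans ht₀.2⟩
    have h4 := (abs_le.1 (hpv r hr)).2
    have h5 := (abs_le.1 (hpv t₀ ht₀)).1
    simp only [hN] at h1 h2 h3 h4 h5 ⊢
    linarith
  have p1 : 0 ≤ D.c⁻¹ := by positivity
  have key := le_exp_of_le_add_abs_integral (by have := hN0 t₀ ht₀; positivity) hC₁0 ht₀ hNc hN0
    hstep t ht
  have hup : N t₀ ≤ ‖D.incl (w t₀)‖ ^ 2 + ε * ‖w t₀‖ ^ 2 + D.M * ‖v t₀‖ ^ 2 := by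
    simp only [hN]
    have : inner ℝ (D.op t₀ (v t₀)) (v t₀) ≤ D.M * ‖v t₀‖ * ‖v t₀‖ :=
      (real_inner_le_norm _ _).trans
        (by gcongr; exact (D.op t₀).le_of_opNorm_le (D.bound t₀ ht₀) _)
    nlinarith
  refine (hNlow t ht).trans (key.trans ?_)
  rw [mul_right_comm _ (Real.exp _)]
  refine mul_le_mul_of_nonneg_right ?_ (Real.exp_pos _).le
  have q1 : 0 ≤ ‖D.incl (w t₀)‖ ^ 2 := by positivity
  have q2 : 0 ≤ ε * ‖w t₀‖ ^ 2 := by positivity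
  have q3 : 0 ≤ ‖v t₀‖ ^ 2 := by positivity
  have q4 : 0 ≤ P ^ 2 := by positivity
  set q := ‖D.incl (w t₀)‖ ^ 2 + ε * ‖w t₀‖ ^ 2 + ‖v t₀‖ ^ 2 + P ^ 2 + J
  have r1 : 3 * (‖D.incl (w t₀)‖ ^ 2 + ε * ‖w t₀‖ ^ 2 + P ^ 2 + J) ≤ 3 * q := by
    simp only [q]; linarith
  have r2 : D.M * ‖v t₀‖ ^ 2 ≤ D.M * q := by
    gcongr; simp only [q]; linarith
  have r3 : D.c⁻¹ * P ^ 2 ≤ D.c⁻¹ * q := by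
    gcongr; simp only [q]; linarith
  nlinarith

end WaveForm

/-! ### Limits of regularised solutions -/

namespace WaveForm

variable {V H : Type*} [NormedAddCommGroup V] [InnerProductSpace ℝ V] [CompleteSpace V]
  [NormedAddCommGroup H] [InnerProductSpace ℝ H] [CompleteSpace H] {T : ℝ} (D : WaveForm V H T)

omit [CompleteSpace V] in
-- The energy bounds `√ε ‖w‖` only; the remaining factor `√ε` makes the artificial momentum `ε w`
-- vanish in the limit.
theorem norm_smul_le_sqrt_mul {ε R : ℝ} (hε : 0 ≤ ε) (hR : 0 ≤ R) {w : V}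
    (h : ε * ‖w‖ ^ 2 ≤ R ^ 2) : ‖ε • w‖ ≤ √ε * R := by
  rw [norm_smul, Real.norm_eq_abs, abs_of_nonneg hε]
  nth_rewrite 1 [← Real.mul_self_sqrt hε]
  rw [mul_assoc]
  refine mul_le_mul_of_nonneg_left ?_ (Real.sqrt_nonneg _)
  refine abs_le_of_sq_le_sq' ?_ hR |>.2
  rw [mul_pow, Real.sq_sqrt hε]
  exact h

/-- The common source cancels in the difference of two approximations. Its momentum differs from
`i†` of its velocity by `ε w - δ w'`, which is of size `(√ε + √δ) R`, and this is the defect `ρ`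
allowed by the low-order estimate. -/
theorem exists_approx_sub_estimate (hT : 0 ≤ T) : ∃ C, 0 ≤ C ∧ ∀ (f : ℝ → H) (p : ℝ → V)
    (ε δ R : ℝ) (v w v' w' : ℝ → V), 0 ≤ ε → 0 ≤ δ → 0 ≤ R →
    D.IsApprox f p ε v w → D.IsApprox f p δ v' w' →
    (∀ t ∈ Icc 0 T, ‖v t‖ ≤ R) → (∀ t ∈ Icc 0 T, ‖v' t‖ ≤ R) →
    (∀ t ∈ Icc 0 T, ε * ‖w t‖ ^ 2 ≤ R ^ 2) → (∀ t ∈ Icc 0 T, δ * ‖w' t‖ ^ 2 ≤ R ^ 2) →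
    ∀ t₀ ∈ Icc 0 T, ∀ t ∈ Icc 0 T,
    ‖D.incl (v t) - D.incl (v' t)‖ ^ 2 +
        ‖(D.gram (w t) + ε • w t) - (D.gram (w' t) + δ • w' t)‖ ^ 2 ≤
      C * (‖D.incl (v t₀) - D.incl (v' t₀)‖ ^ 2 +
        ‖(D.gram (w t₀) + ε • w t₀) - (D.gram (w' t₀) + δ • w' t₀)‖ ^ 2 +
        2 * R ^ 2 * (√ε + √δ)) := by
  obtain ⟨C, hC, h⟩ := D.exists_low_energy_estimate hT
  refine ⟨C, hC, fun f p ε δ R v w v' w' hε hδ hR h1 h2 b1 b2 b3 b4 t₀ ht₀ t ht => ?_⟩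
  have key := h (fun t => v t - v' t)
    (fun t => (D.gram (w t) + ε • w t) - (D.gram (w' t) + δ • w' t))
    (fun t => D.incl (w t - w' t)) (2 * R ^ 2 * (√ε + √δ)) (by positivity)
    (fun r hr => D.incl.hasFDerivAt.comp_hasDerivWithinAt r
      ((h1.deriv_fst r hr).sub (h2.deriv_fst r hr)))
    (fun r hr => by
      refine ((h1.hasDerivWithinAt_momentum hr).sub
        (h2.hasDerivWithinAt_momentum hr)).congr_deriv ?_
      simp only [map_sub]; abel)
    (fun r hr => by
      have e : (D.gram (w r) + ε • w r) - (D.gram (w' r) + δ • w' r) -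
          D.coincl (D.incl (w r - w' r)) = ε • w r - δ • w' r := by
        simp only [map_sub, gram_apply]; abel
      rw [e]
      refine (abs_real_inner_le_norm _ _).trans ?_
      calc ‖ε • w r - δ • w' r‖ * ‖v r - v' r‖
          ≤ (√ε * R + √δ * R) * (R + R) := by
            gcongr
            · exact (norm_sub_le _ _).trans (add_le_add (norm_smul_le_sqrt_mul hε hR (b3 r hr))
                (norm_smul_le_sqrt_mul hδ hR (b4 r hr)))
            · exact (norm_sub_le _ _).trans (add_le_add (b1 r hr) (b2 r hr))
        _ = _ := by ring)
    t₀ ht₀ t ht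
  simpa only [map_sub] using key

/-- A bounded sequence of solutions of the regularised equation with `ε → 0`. -/
structure IsApproxSeq (f : ℝ → H) (p : ℝ → V) (R : ℝ) (ε : ℕ → ℝ) (v w : ℕ → ℝ → V) : Prop where
  pos : ∀ k, 0 < ε k
  tendsto : Tendsto ε atTop (𝓝 0)
  approx : ∀ k, D.IsApprox f p (ε k) (v k) (w k)
  nonneg : 0 ≤ R
  norm_fst : ∀ k, ∀ t ∈ Icc 0 T, ‖v k t‖ ≤ R
  norm_snd : ∀ k, ∀ t ∈ Icc 0 T, ‖D.incl (w k t)‖ ≤ R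
  norm_sq_snd : ∀ k, ∀ t ∈ Icc 0 T, ε k * ‖w k t‖ ^ 2 ≤ R ^ 2

/-- Convergence of `(x k, y k)` to `(v, u)`, weakly in `V × H` and strongly one level below. -/
structure Converges (ε : ℕ → ℝ) (x y : ℕ → V) (v : V) (u : H) : Prop where
  weak_fst : ∀ φ, Tendsto (fun k => inner ℝ (x k) φ) atTop (𝓝 (inner ℝ v φ))
  weak_snd : ∀ φ, Tendsto (fun k => inner ℝ (D.incl (y k)) φ) atTop (𝓝 (inner ℝ u φ))
  incl_fst : Tendsto (fun k => D.incl (x k)) atTop (𝓝 (D.incl v))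
  momentum : Tendsto (fun k => D.gram (y k) + ε k • y k) atTop (𝓝 (D.coincl u))

variable {D}

namespace IsApproxSeq

variable {f : ℝ → H} {p : ℝ → V} {R : ℝ} {ε : ℕ → ℝ} {v w : ℕ → ℝ → V}

theorem mono (h : D.IsApproxSeq f p R ε v w) {R' : ℝ} (hR : R ≤ R') :
    D.IsApproxSeq f p R' ε v w where
  pos := h.pos
  tendsto := h.tendsto
  approx := h.approx
  nonneg := h.nonneg.trans hR
  norm_fst k t ht := (h.norm_fst k t ht).trans hR
  norm_snd k t ht := (h.norm_snd k t ht).trans hR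
  norm_sq_snd k t ht := (h.norm_sq_snd k t ht).trans (pow_le_pow_left₀ h.nonneg hR 2)

theorem tendsto_sqrt (h : D.IsApproxSeq f p R ε v w) :
    Tendsto (fun k => √(ε k)) atTop (𝓝 0) := by
  simpa [Function.comp_def] using (Real.continuous_sqrt.tendsto 0).comp h.tendsto

theorem tendsto_smul (h : D.IsApproxSeq f p R ε v w) {t : ℝ} (ht : t ∈ Icc 0 T) :
    Tendsto (fun k => ε k • w k t) atTop (𝓝 0) := by
  refine squeeze_zero_norm (a := fun k => √(ε k) * R)
    (fun k => norm_smul_le_sqrt_mul (h.pos k).le h.nonneg (h.norm_sq_snd k t ht)) ?_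
  simpa using h.tendsto_sqrt.mul_const R

/-- Convergence at one time propagates to all others, earlier or later: the difference estimate
makes `i v` and the momenta Cauchy, and the uniform bounds turn this into weak convergence in `V`
and `H` by `exists_weak_limit`, used with `i†` and with `i`. -/
theorem exists_converges (hT : 0 ≤ T) (h : D.IsApproxSeq f p R ε v w) {t₀ : ℝ}
    (ht₀ : t₀ ∈ Icc 0 T) {v₀ : V} {u₀ : H} (h₀ : D.Converges ε (v · t₀) (w · t₀) v₀ u₀) {t : ℝ}
    (ht : t ∈ Icc 0 T) : ∃ v' u', ‖v'‖ ≤ R ∧ ‖u'‖ ≤ R ∧ D.Converges ε (v · t) (w · t) v' u' := by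
  obtain ⟨C, hC, hest⟩ := D.exists_approx_sub_estimate hT
  set y : ℕ → ℝ → V := fun k t => D.gram (w k t) + ε k • w k t with hy
  have c1 := cauchySeq_iff_tendsto_dist_atTop_0.1 h₀.incl_fst.cauchySeq
  have c2 := cauchySeq_iff_tendsto_dist_atTop_0.1 h₀.momentum.cauchySeq
  have s1 : Tendsto (fun n : ℕ × ℕ => √(ε n.1)) atTop (𝓝 0) :=
    h.tendsto_sqrt.comp (by rw [← prod_atTop_atTop_eq]; exact tendsto_fst)
  have s2 : Tendsto (fun n : ℕ × ℕ => √(ε n.2)) atTop (𝓝 0) :=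
    h.tendsto_sqrt.comp (by rw [← prod_atTop_atTop_eq]; exact tendsto_snd)
  have hlim : Tendsto (fun n : ℕ × ℕ => √(C * (dist (D.incl (v n.1 t₀)) (D.incl (v n.2 t₀)) ^ 2 +
      dist (y n.1 t₀) (y n.2 t₀) ^ 2 + 2 * R ^ 2 * (√(ε n.1) + √(ε n.2))))) atTop (𝓝 0) := by
    have := (((c1.pow 2).add (c2.pow 2)).add ((s1.add s2).const_mul (2 * R ^ 2))).const_mul C
    simpa [Function.comp_def] using (Real.continuous_sqrt.tendsto _).comp this
  have hb : ∀ n : ℕ × ℕ, ‖D.incl (v n.1 t) - D.incl (v n.2 t)‖ ^ 2 +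
      ‖y n.1 t - y n.2 t‖ ^ 2 ≤ C * (dist (D.incl (v n.1 t₀)) (D.incl (v n.2 t₀)) ^ 2 +
      dist (y n.1 t₀) (y n.2 t₀) ^ 2 + 2 * R ^ 2 * (√(ε n.1) + √(ε n.2))) := fun n => by
    rw [dist_eq_norm, dist_eq_norm]
    exact hest f p _ _ R _ _ _ _ (h.pos n.1).le (h.pos n.2).le h.nonneg (h.approx _) (h.approx _)
      (h.norm_fst _) (h.norm_fst _) (h.norm_sq_snd _) (h.norm_sq_snd _) t₀ ht₀ t ht
  have d1 : CauchySeq fun k => D.incl (v k t) := by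
    refine cauchySeq_iff_tendsto_dist_atTop_0.2
      (squeeze_zero (fun _ => dist_nonneg) (fun n => ?_) hlim)
    refine Real.le_sqrt_of_sq_le (le_trans ?_ (hb n))
    rw [dist_eq_norm]
    exact le_add_of_nonneg_right (by positivity)
  have d2 : CauchySeq fun k => y k t := by
    refine cauchySeq_iff_tendsto_dist_atTop_0.2
      (squeeze_zero (fun _ => dist_nonneg) (fun n => ?_) hlim)
    refine Real.le_sqrt_of_sq_le (le_trans ?_ (hb n))
    rw [dist_eq_norm]
    exact le_add_of_nonneg_left (by positivity)
  obtain ⟨a, ha⟩ := cauchySeq_tendsto_of_complete d1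
  obtain ⟨η, hη⟩ := cauchySeq_tendsto_of_complete d2
  have hadj : (D.coincl).adjoint = D.incl := ContinuousLinearMap.adjoint_adjoint _
  obtain ⟨v', hv1, hv2, hv3⟩ := exists_weak_limit D.denseRange_coincl (x := (v · t))
    (fun k => h.norm_fst k t ht) (η := a) (by rw [hadj]; exact ha)
  have hη' : Tendsto (fun k => D.coincl (D.incl (w k t))) atTop (𝓝 η) := by
    have := hη.sub (h.tendsto_smul ht)
    simpa [hy, gram_apply] using this
  obtain ⟨u', hu1, hu2, hu3⟩ := exists_weak_limit D.dense (x := fun k => D.incl (w k t))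
    (fun k => h.norm_snd k t ht) (η := η) hη'
  refine ⟨v', u', hv1, hu1, hv3, hu3, ?_, ?_⟩
  · rw [← hadj, hv2, hadj]; exact ha
  · rw [coincl, hu2]; exact hη

/-- The difference estimate is passed to the limit between two approximating sequences. This
identifies a sequence restarted at `t₀` with the original one. -/
theorem converges_unique (hT : 0 ≤ T) (h : D.IsApproxSeq f p R ε v w) {ε' : ℕ → ℝ}
    {x y : ℕ → ℝ → V} (h' : D.IsApproxSeq f p R ε' x y) {t₀ : ℝ} (ht₀ : t₀ ∈ Icc 0 T) {v₀ : V}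
    {u₀ : H} (h₀ : D.Converges ε (v · t₀) (w · t₀) v₀ u₀)
    (h₀' : D.Converges ε' (x · t₀) (y · t₀) v₀ u₀) {t : ℝ} (ht : t ∈ Icc 0 T) {v₁ v₂ : V}
    {u₁ u₂ : H} (h₁ : D.Converges ε (v · t) (w · t) v₁ u₁)
    (h₂ : D.Converges ε' (x · t) (y · t) v₂ u₂) : v₁ = v₂ ∧ u₁ = u₂ := by
  obtain ⟨C, hC, hest⟩ := D.exists_approx_sub_estimate hT
  have hb := fun k => hest f p _ _ R _ _ _ _ (h.pos k).le (h'.pos k).le h.nonneg (h.approx k)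
    (h'.approx k) (h.norm_fst k) (h'.norm_fst k) (h.norm_sq_snd k) (h'.norm_sq_snd k) t₀ ht₀ t ht
  have l1 := ((((h₀.incl_fst.sub h₀'.incl_fst).norm.pow 2).add
    ((h₀.momentum.sub h₀'.momentum).norm.pow 2)).add
    ((h.tendsto_sqrt.add h'.tendsto_sqrt).const_mul (2 * R ^ 2))).const_mul C
  have l2 := ((h₁.incl_fst.sub h₂.incl_fst).norm.pow 2).add
    ((h₁.momentum.sub h₂.momentum).norm.pow 2)
  have l3 := le_of_tendsto_of_tendsto' l2 l1 hb
  simp only [sub_self, norm_zero, add_zero, mul_zero, ne_eq, OfNat.ofNat_ne_zero,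
    not_false_eq_true, zero_pow] at l3
  have e1 : ‖D.incl v₁ - D.incl v₂‖ = 0 := by
    nlinarith [sq_nonneg ‖D.incl v₁ - D.incl v₂‖, sq_nonneg ‖D.coincl u₁ - D.coincl u₂‖]
  have e2 : ‖D.coincl u₁ - D.coincl u₂‖ = 0 := by
    nlinarith [sq_nonneg ‖D.incl v₁ - D.incl v₂‖, sq_nonneg ‖D.coincl u₁ - D.coincl u₂‖]
  exact ⟨D.inj (sub_eq_zero.1 (norm_eq_zero.1 e1)),
    D.coincl_injective (sub_eq_zero.1 (norm_eq_zero.1 e2))⟩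

end IsApproxSeq

/-- Weak lower semicontinuity: nonnegativity of `‖i y - u‖²` and of `⟨G (x - v), x - v⟩` bounds the
energy below by an expression affine in `(x, i y)`, which passes to the weak limit. -/
theorem Converges.energy_le {ε : ℕ → ℝ} {x y : ℕ → V} {v : V} {u : H}
    (h : D.Converges ε x y v u) {G : V →L[ℝ] V}
    (hsymm : ∀ u w, inner ℝ (G u) w = inner ℝ u (G w)) (hpos : ∀ u, 0 ≤ inner ℝ (G u) u)
    {c : ℕ → ℝ} {d : ℝ} (hc : Tendsto c atTop (𝓝 d))
    (hle : ∀ k, ‖D.incl (y k)‖ ^ 2 + inner ℝ (G (x k)) (x k) ≤ c k) :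
    ‖u‖ ^ 2 + inner ℝ (G v) v ≤ d := by
  have l1 := (((h.weak_snd u).const_mul 2).sub_const (‖u‖ ^ 2)).add
    (((h.weak_fst (G v)).const_mul 2).sub_const (inner ℝ (G v) v))
  have l2 := le_of_tendsto_of_tendsto' l1 hc fun k => ?_
  · rw [real_inner_self_eq_norm_sq, real_inner_comm (G v) v] at l2
    linarith
  · refine le_trans ?_ (hle k)
    have h1 := hpos (x k - v)
    rw [map_sub, inner_sub_left, inner_sub_right, inner_sub_right, hsymm (x k) v,
      real_inner_comm (x k) (G v)] at h1
    have h3 : inner ℝ (G v) (x k) = inner ℝ (x k) (G v) := real_inner_comm _ _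
    have h2 := norm_sub_sq_real (D.incl (y k)) u
    nlinarith [sq_nonneg ‖D.incl (y k) - u‖]

variable (D) in
/-- Regularised solutions with prescribed data at `t₀`, bounded uniformly in `t₀`. -/
theorem exists_isApproxSeq (hT : 0 ≤ T) {f : ℝ → H} {p p' : ℝ → V}
    (hf : ContinuousOn f (Icc 0 T)) (hp' : ContinuousOn p' (Icc 0 T))
    (hp : ∀ t ∈ Icc 0 T, HasDerivWithinAt p (p' t) (Icc 0 T) t) (Q : ℝ) :
    ∃ R, ∀ t₀ ∈ Icc 0 T, ∀ (v₀ : V) (u₀ : H), ‖v₀‖ ≤ Q → ‖u₀‖ ≤ Q → ∃ ε v w,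
      D.IsApproxSeq f p R ε v w ∧ D.Converges ε (v · t₀) (w · t₀) v₀ u₀ ∧ (∀ k, v k t₀ = v₀) ∧
      Tendsto (fun k => D.incl (w k t₀)) atTop (𝓝 u₀) ∧
      Tendsto (fun k => ε k * ‖w k t₀‖ ^ 2) atTop (𝓝 0) := by
  obtain ⟨C, hC, hest⟩ := D.exists_energy_estimate hT
  have hpc : ContinuousOn p (Icc 0 T) := fun t ht => (hp t ht).continuousWithinAt
  obtain ⟨P, hP⟩ := isCompact_Icc.exists_bound_of_continuousOn hpc
  have hc := D.c_pos
  set J := ∫ r in 0..T, (‖f r‖ ^ 2 + ‖p' r‖ ^ 2)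
  have hJ0 : 0 ≤ J := intervalIntegral.integral_nonneg hT fun r _ => by positivity
  set B := C * ((Q + 1) ^ 2 + 1 + Q ^ 2 + P ^ 2 + J)
  have hB : 0 ≤ B := by positivity
  refine ⟨√((1 + D.c⁻¹) * B), fun t₀ ht₀ v₀ u₀ hv₀ hu₀ => ?_⟩
  have hQ : 0 ≤ Q := (norm_nonneg _).trans hv₀
  have hw : ∀ k : ℕ, ∃ w₀ : V, dist u₀ (D.incl w₀) < 1 / ((k : ℝ) + 1) :=
    fun k => D.dense.exists_dist_lt u₀ (by positivity)
  choose w₀ hw₀ using hw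
  -- As `u₀` need not lie in the range of `i`, the norms `‖w₀ k‖` may be unbounded; `ε k` is chosen
  -- so small that `ε k * ‖w₀ k‖²` still tends to zero and no spurious initial energy is left.
  set ε : ℕ → ℝ := fun k => 1 / ((k : ℝ) + 1) * (1 + ‖w₀ k‖ ^ 2)⁻¹ with hεd
  have hlim := tendsto_one_div_add_atTop_nhds_zero_nat (𝕜 := ℝ)
  have hε : ∀ k, 0 < ε k := fun k => by positivity
  have hε1 : ∀ k, ε k ≤ 1 / ((k : ℝ) + 1) := fun k => by
    refine mul_le_of_le_one_right (by positivity) (inv_le_one_of_one_le₀ ?_)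
    nlinarith [sq_nonneg ‖w₀ k‖]
  have hε2 : ∀ k, ε k * ‖w₀ k‖ ^ 2 ≤ 1 / ((k : ℝ) + 1) := fun k => by
    simp only [hεd]
    rw [mul_assoc]
    refine mul_le_of_le_one_right (by positivity) ?_
    rw [inv_mul_le_iff₀ (by positivity)]
    linarith
  have hk1 : ∀ k : ℕ, 1 / ((k : ℝ) + 1) ≤ 1 := fun k => by
    rw [div_le_one (by positivity)]; linarith [(Nat.cast_nonneg k : (0 : ℝ) ≤ k)]
  choose v w hvw hv hw using fun k => D.exists_isApprox hT hf hpc (hε k) ht₀ v₀ (w₀ k)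
  have hiw : Tendsto (fun k => D.incl (w k t₀)) atTop (𝓝 u₀) := by
    refine tendsto_iff_dist_tendsto_zero.2 (squeeze_zero (fun _ => dist_nonneg) (fun k => ?_) hlim)
    rw [dist_comm, hw]
    exact (hw₀ k).le
  have hew : Tendsto (fun k => ε k * ‖w k t₀‖ ^ 2) atTop (𝓝 0) :=
    squeeze_zero (fun k => by have := (hε k).le; positivity) (fun k => by rw [hw]; exact hε2 k) hlim
  have hbd : ∀ k, ∀ t ∈ Icc 0 T,
      ‖D.incl (w k t)‖ ^ 2 + ε k * ‖w k t‖ ^ 2 + D.c * ‖v k t‖ ^ 2 ≤ B := by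
    intro k t ht
    refine (hest f p p' (ε k) P (v k) (w k) (hε k).le (hvw k) hf hp' hp hP t₀ ht₀ t ht).trans ?_
    refine mul_le_mul_of_nonneg_left ?_ hC
    rw [hv, hw]
    have h1 : ‖D.incl (w₀ k)‖ ≤ Q + 1 := by
      have := (hw₀ k).le.trans (hk1 k)
      rw [dist_comm, dist_eq_norm] at this
      linarith [norm_le_norm_add_norm_sub u₀ (D.incl (w₀ k)), norm_sub_rev u₀ (D.incl (w₀ k))]
    have h2 := (hε2 k).trans (hk1 k)
    gcongr
  have hci : 0 ≤ D.c⁻¹ * B := by positivity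
  have hseq : D.IsApproxSeq f p √((1 + D.c⁻¹) * B) ε v w := by
    refine ⟨hε, squeeze_zero (fun k => (hε k).le) hε1 hlim, hvw, Real.sqrt_nonneg _,
      fun k t ht => Real.le_sqrt_of_sq_le ?_, fun k t ht => Real.le_sqrt_of_sq_le ?_,
      fun k t ht => ?_⟩
    · have h1 := hbd k t ht
      have h2 : 0 ≤ ε k * ‖w k t‖ ^ 2 := by have := (hε k).le; positivity
      have h3 : D.c * ‖v k t‖ ^ 2 ≤ B := by nlinarith [sq_nonneg ‖D.incl (w k t)‖]
      have h4 : ‖v k t‖ ^ 2 ≤ D.c⁻¹ * B := by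
        rw [inv_mul_eq_div, le_div_iff₀ hc]; linarith
      linarith
    · have h1 := hbd k t ht
      have h2 : 0 ≤ ε k * ‖w k t‖ ^ 2 := by have := (hε k).le; positivity
      have h3 : 0 ≤ D.c * ‖v k t‖ ^ 2 := by positivity
      linarith
    · have h1 := hbd k t ht
      have h3 : 0 ≤ D.c * ‖v k t‖ ^ 2 := by positivity
      rw [Real.sq_sqrt (by positivity)]
      nlinarith [sq_nonneg ‖D.incl (w k t)‖]
  refine ⟨ε, v, w, hseq, ⟨fun φ => ?_, fun φ => hiw.inner tendsto_const_nhds, ?_, ?_⟩, hv, hiw, hew⟩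
  · simp only [hv]; exact tendsto_const_nhds
  · simp only [hv]; exact tendsto_const_nhds
  · have := (D.coincl.continuous.tendsto u₀).comp hiw |>.add (hseq.tendsto_smul ht₀)
    simpa [gram_apply, Function.comp_def] using this

end WaveForm

/-! ### Solutions for sources continuous in time, and their strong continuity -/

theorem intervalIntegral_inner {E : Type*} [NormedAddCommGroup E] [InnerProductSpace ℝ E]
    [CompleteSpace E] {g : ℝ → E} {a b : ℝ} (hg : IntervalIntegrable g volume a b) (φ : E) :
    ∫ r in a..b, inner ℝ φ (g r) = inner ℝ φ (∫ r in a..b, g r) :=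
  (innerSL ℝ φ).intervalIntegral_comp_comm hg

theorem continuousOn_of_norm_sub_le {E : Type*} [NormedAddCommGroup E] {g : ℝ → E} {K : ℝ}
    {I : Set ℝ} (hg : ∀ s ∈ I, ∀ t ∈ I, ‖g t - g s‖ ≤ K * |t - s|) : ContinuousOn g I := by
  intro t ht
  have hlin : Tendsto (fun s => K * |s - t|) (𝓝[I] t) (𝓝 0) := by
    have : Continuous fun s => K * |s - t| := by fun_prop
    have h2 := (this.tendsto t).mono_left (nhdsWithin_le_nhds (s := I))
    simpa using h2
  refine tendsto_iff_norm_sub_tendsto_zero.2 (squeeze_zero' (Eventually.of_forall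
    fun _ => norm_nonneg _) ?_ hlin)
  filter_upwards [self_mem_nhdsWithin] with s hs using hg t ht s hs

namespace WaveForm

variable {V H : Type*} [NormedAddCommGroup V] [InnerProductSpace ℝ V] [CompleteSpace V]
  [NormedAddCommGroup H] [InnerProductSpace ℝ H] [CompleteSpace H] {T : ℝ} (D : WaveForm V H T)

/-- Solutions of `(i v)' = u`, `(i†u)' = S v - B v + F` on `[0, T]`, in integrated form. -/
structure IsSolution (F : ℝ → V) (v : ℝ → V) (u : ℝ → H) : Prop where
  continuousOn_fst : ContinuousOn v (Icc 0 T)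
  continuousOn_snd : ContinuousOn u (Icc 0 T)
  eq_fst : ∀ t ∈ Icc 0 T, D.incl (v t) = D.incl (v 0) + ∫ r in 0..t, u r
  eq_snd : ∀ t ∈ Icc 0 T, D.coincl (u t) = D.coincl (u 0) +
    ∫ r in 0..t, (D.gram (v r) - D.op r (v r) + F r)

variable {D}

/-- Along the approximations the energy changes by at most a constant times `|t - t₀|`. At `t₀` the
energies converge because the data converge strongly; at `t` only lower semicontinuity is available,
which gives an inequality in one direction. -/
theorem IsApproxSeq.energy_le_of_converges {f : ℝ → H} {p p' : ℝ → V} {R : ℝ}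
    {ε : ℕ → ℝ} {v w : ℕ → ℝ → V} (h : D.IsApproxSeq f p R ε v w) (hf : ContinuousOn f (Icc 0 T))
    (hp' : ContinuousOn p' (Icc 0 T))
    (hp : ∀ t ∈ Icc 0 T, HasDerivWithinAt p (p' t) (Icc 0 T) t) {F P' : ℝ}
    (hF : ∀ t ∈ Icc 0 T, ‖f t‖ ≤ F) (hP' : ∀ t ∈ Icc 0 T, ‖p' t‖ ≤ P') {t₀ t : ℝ}
    (ht₀ : t₀ ∈ Icc 0 T) (ht : t ∈ Icc 0 T) {v₀ v₁ : V} {u₀ u₁ : H} (hv₀ : ∀ k, v k t₀ = v₀)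
    (hu₀ : Tendsto (fun k => D.incl (w k t₀)) atTop (𝓝 u₀))
    (hw₀ : Tendsto (fun k => ε k * ‖w k t₀‖ ^ 2) atTop (𝓝 0))
    (h₁ : D.Converges ε (v · t) (w · t) v₁ u₁) :
    ‖u₁‖ ^ 2 + inner ℝ (D.op t v₁) v₁ - 2 * inner ℝ (p t) v₁ ≤
      ‖u₀‖ ^ 2 + inner ℝ (D.op t₀ v₀) v₀ - 2 * inner ℝ (p t₀) v₀ +
        (2 * (‖D.incl‖ * R + F) * R + 2 * P' * R + D.L * R ^ 2) * |t - t₀| := by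
  have hR := h.nonneg
  have hF0 : 0 ≤ F := (norm_nonneg _).trans (hF t ht)
  have hP0 : 0 ≤ P' := (norm_nonneg _).trans (hP' t ht)
  have hL := D.L_nonneg
  set K := 2 * (‖D.incl‖ * R + F) * R + 2 * P' * R + D.L * R ^ 2
  have hk : ∀ k, ‖D.incl (w k t)‖ ^ 2 + inner ℝ (D.op t (v k t)) (v k t) ≤
      (‖D.incl (w k t₀)‖ ^ 2 + ε k * ‖w k t₀‖ ^ 2 - 2 * inner ℝ (p t₀) v₀ +
        inner ℝ (D.op t₀ v₀) v₀) + K * |t - t₀| + 2 * inner ℝ (v k t) (p t) := by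
    intro k
    have h1 := (le_abs_self _).trans ((h.approx k).energy_sub_le hf hp' hp ht₀ ht)
    have h2 := intervalIntegral.norm_integral_le_of_norm_le_const (a := t₀) (b := t) (C := K)
      (f := fun r => 2 * (‖D.incl (v k r)‖ + ‖f r‖) * ‖D.incl (w k r)‖ + 2 * ‖p' r‖ * ‖v k r‖ +
        D.L * ‖v k r‖ ^ 2) (fun r hr => by
        have hr' : r ∈ Icc 0 T := uIcc_subset_Icc ht₀ ht (uIoc_subset_uIcc hr)
        rw [Real.norm_eq_abs, abs_of_nonneg (by positivity)]
        have k1 := h.norm_fst k r hr'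
        have k2 := h.norm_snd k r hr'
        have k3 : ‖D.incl (v k r)‖ ≤ ‖D.incl‖ * R := (D.incl.le_opNorm _).trans (by gcongr)
        have k4 := hF r hr'
        have k5 := hP' r hr'
        simp only [K]
        gcongr)
    rw [Real.norm_eq_abs] at h2
    have h3 : 0 ≤ ε k * ‖w k t‖ ^ 2 := by have := (h.pos k).le; positivity
    rw [hv₀] at h1
    rw [real_inner_comm (p t) (v k t)]
    linarith
  have hlim : Tendsto (fun k => (‖D.incl (w k t₀)‖ ^ 2 + ε k * ‖w k t₀‖ ^ 2 -
      2 * inner ℝ (p t₀) v₀ + inner ℝ (D.op t₀ v₀) v₀) + K * |t - t₀| +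
      2 * inner ℝ (v k t) (p t)) atTop (𝓝 ((‖u₀‖ ^ 2 + 0 - 2 * inner ℝ (p t₀) v₀ +
        inner ℝ (D.op t₀ v₀) v₀) + K * |t - t₀| + 2 * inner ℝ v₁ (p t))) :=
    (((((hu₀.norm.pow 2).add hw₀).sub_const _).add_const _).add_const _).add
      ((h₁.weak_fst (p t)).const_mul 2)
  have := h₁.energy_le (D.symm t ht) (fun u => le_trans
    (by have := D.c_pos.le; positivity) (D.coercive t ht u)) hlim hk
  rw [real_inner_comm (p t) v₁] at this
  linarith

omit [CompleteSpace V] [CompleteSpace H] in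
/-- Strong continuity from weak continuity and continuity of the energy. -/
theorem continuousOn_of_energy {v : ℝ → V} {u : ℝ → H} {R : ℝ}
    (hv : ∀ t ∈ Icc 0 T, ‖v t‖ ≤ R)
    (hwv : ∀ φ, ContinuousOn (fun t => inner ℝ (v t) φ) (Icc 0 T))
    (hwu : ∀ φ, ContinuousOn (fun t => inner ℝ (u t) φ) (Icc 0 T))
    (he : ContinuousOn (fun t => ‖u t‖ ^ 2 + inner ℝ (D.op t (v t)) (v t)) (Icc 0 T)) :
    ContinuousOn v (Icc 0 T) ∧ ContinuousOn u (Icc 0 T) := by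
  have hc := D.c_pos
  have hL := D.L_nonneg
  -- By coercivity of `B(t)` the squared distance is dominated by the energies at `s` and `t` minus
  -- twice the cross terms. The energies converge by `he`, the cross terms by weak continuity, and
  -- replacing `B(t)` by `B(s)` costs `L |s - t| R²`.
  have key : ∀ t ∈ Icc 0 T, Tendsto (fun s => ‖u s - u t‖ ^ 2 + D.c * ‖v s - v t‖ ^ 2)
      (𝓝[Icc 0 T] t) (𝓝 0) := by
    intro t ht
    have habs : Tendsto (fun s => D.L * |s - t| * R ^ 2) (𝓝[Icc 0 T] t) (𝓝 0) := by
      have : Continuous fun s => D.L * |s - t| * R ^ 2 := by fun_prop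
      have h2 := (this.tendsto t).mono_left (nhdsWithin_le_nhds (s := Icc 0 T))
      simpa using h2
    have he' : Tendsto (fun s => ‖u s‖ ^ 2 + inner ℝ (D.op s (v s)) (v s)) (𝓝[Icc 0 T] t)
      (𝓝 (‖u t‖ ^ 2 + inner ℝ (D.op t (v t)) (v t))) := he t ht
    have hu' : Tendsto (fun s => inner ℝ (u s) (u t)) (𝓝[Icc 0 T] t) (𝓝 (inner ℝ (u t) (u t))) :=
      hwu (u t) t ht
    have hv' : Tendsto (fun s => inner ℝ (v s) (D.op t (v t))) (𝓝[Icc 0 T] t)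
      (𝓝 (inner ℝ (v t) (D.op t (v t)))) := hwv (D.op t (v t)) t ht
    have l1 := ((he'.add habs).add_const (‖u t‖ ^ 2 + inner ℝ (D.op t (v t)) (v t))).sub
      ((hu'.const_mul 2).add (hv'.const_mul 2))
    refine squeeze_zero' (Eventually.of_forall fun s => by positivity) ?_
      (l1.trans_eq (congrArg 𝓝 ?_))
    · filter_upwards [self_mem_nhdsWithin] with s hs
      have h1 := D.coercive t ht (v s - v t)
      rw [map_sub, inner_sub_left, inner_sub_right, inner_sub_right, D.symm t ht (v s) (v t),
        real_inner_comm (v s) (D.op t (v t))] at h1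
      have h2 := norm_sub_sq_real (u s) (u t)
      have h3 : inner ℝ ((D.op t - D.op s) (v s)) (v s) ≤ D.L * |s - t| * R ^ 2 := by
        calc inner ℝ ((D.op t - D.op s) (v s)) (v s)
            ≤ (D.L * |t - s| * ‖v s‖) * ‖v s‖ := by
              refine (real_inner_le_norm _ _).trans ?_
              gcongr
              exact (D.op t - D.op s).le_of_opNorm_le (D.lip t ht s hs) _
          _ ≤ (D.L * |t - s| * R) * R := by
              have := hv s hs
              have hR : 0 ≤ R := (norm_nonneg _).trans this
              gcongr
          _ = _ := by rw [abs_sub_comm]; ring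
      rw [_root_.sub_apply, inner_sub_left] at h3
      linarith
    · rw [real_inner_self_eq_norm_sq, real_inner_comm (D.op t (v t)) (v t)]
      ring
  have hroot : ∀ t ∈ Icc 0 T, Tendsto (fun s => √((1 + D.c⁻¹) *
      (‖u s - u t‖ ^ 2 + D.c * ‖v s - v t‖ ^ 2))) (𝓝[Icc 0 T] t) (𝓝 0) := fun t ht => by
    have := (Real.continuous_sqrt.tendsto _).comp ((key t ht).const_mul (1 + D.c⁻¹))
    simpa [Function.comp_def] using this
  have hci : 0 ≤ D.c⁻¹ := by positivity
  constructor
  · intro t ht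
    refine tendsto_iff_norm_sub_tendsto_zero.2 (squeeze_zero (fun _ => norm_nonneg _)
      (fun s => Real.le_sqrt_of_sq_le ?_) (hroot t ht))
    have e : D.c⁻¹ * (D.c * ‖v s - v t‖ ^ 2) = ‖v s - v t‖ ^ 2 := by field_simp
    have q1 : 0 ≤ D.c * ‖v s - v t‖ ^ 2 := by positivity
    have q2 : 0 ≤ D.c⁻¹ * ‖u s - u t‖ ^ 2 := by positivity
    nlinarith [sq_nonneg ‖u s - u t‖]
  · intro t ht
    refine tendsto_iff_norm_sub_tendsto_zero.2 (squeeze_zero (fun _ => norm_nonneg _)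
      (fun s => Real.le_sqrt_of_sq_le ?_) (hroot t ht))
    have q1 : 0 ≤ D.c * ‖v s - v t‖ ^ 2 := by positivity
    have q2 := mul_nonneg hci (add_nonneg (sq_nonneg ‖u s - u t‖) q1)
    linarith

variable (D) in
/-- Existence of strongly continuous solutions, with the energy estimate, for regular sources. -/
theorem exists_isSolution_of_continuousOn (hT : 0 ≤ T) : ∃ C, 0 ≤ C ∧ ∀ (f : ℝ → H)
    (p p' : ℝ → V) (P : ℝ) (v₀ : V) (u₀ : H), ContinuousOn f (Icc 0 T) →
    ContinuousOn p' (Icc 0 T) → (∀ t ∈ Icc 0 T, HasDerivWithinAt p (p' t) (Icc 0 T) t) →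
    (∀ t ∈ Icc 0 T, ‖p t‖ ≤ P) → ∃ v u, D.IsSolution (fun t => D.coincl (f t) + p t) v u ∧
      v 0 = v₀ ∧ u 0 = u₀ ∧ ∀ t ∈ Icc 0 T, ‖u t‖ ^ 2 + D.c * ‖v t‖ ^ 2 ≤
        C * (‖u₀‖ ^ 2 + ‖v₀‖ ^ 2 + P ^ 2 + ∫ r in 0..T, (‖f r‖ ^ 2 + ‖p' r‖ ^ 2)) := by
  obtain ⟨C, hC, hest⟩ := D.exists_energy_estimate hT
  refine ⟨C, hC, fun f p p' P v₀ u₀ hf hp' hp hP => ?_⟩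
  have hc := D.c_pos
  have hpc : ContinuousOn p (Icc 0 T) := fun t ht => (hp t ht).continuousWithinAt
  have h0 : (0 : ℝ) ∈ Icc 0 T := left_mem_Icc.2 hT
  obtain ⟨R₁, hR₁⟩ := D.exists_isApproxSeq hT hf hp' hp (max ‖v₀‖ ‖u₀‖)
  obtain ⟨ε, x, w, hs, hs0, hx0, hw0, hew⟩ := hR₁ 0 h0 v₀ u₀ (le_max_left _ _) (le_max_right _ _)
  have hlim : ∀ t, ∃ v' u', t ∈ Icc 0 T → ‖v'‖ ≤ R₁ ∧ ‖u'‖ ≤ R₁ ∧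
      D.Converges ε (x · t) (w · t) v' u' := fun t => by
    by_cases ht : t ∈ Icc 0 T
    · obtain ⟨v', u', h1, h2, h3⟩ := hs.exists_converges hT h0 hs0 ht
      exact ⟨v', u', fun _ => ⟨h1, h2, h3⟩⟩
    · exact ⟨0, 0, fun h => absurd h ht⟩
  choose v u hvu using hlim
  have hv0 : v 0 = v₀ ∧ u 0 = u₀ :=
    hs.converges_unique hT hs h0 hs0 hs0 h0 (hvu 0 h0).2.2 hs0
  -- The limits at all times have norm at most `R₁`, so one radius `R₂` covers every restart.
  obtain ⟨R₂, hR₂⟩ := D.exists_isApproxSeq hT hf hp' hp R₁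
  obtain ⟨F, hF⟩ := isCompact_Icc.exists_bound_of_continuousOn hf
  obtain ⟨P', hP'⟩ := isCompact_Icc.exists_bound_of_continuousOn hp'
  -- the energy is Lipschitz in time
  obtain ⟨K, hK⟩ : ∃ K, ∀ t₀ ∈ Icc 0 T, ∀ t ∈ Icc 0 T,
      ‖u t‖ ^ 2 + inner ℝ (D.op t (v t)) (v t) - 2 * inner ℝ (p t) (v t) ≤
      ‖u t₀‖ ^ 2 + inner ℝ (D.op t₀ (v t₀)) (v t₀) - 2 * inner ℝ (p t₀) (v t₀) +
        K * |t - t₀| := by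
    refine ⟨2 * (‖D.incl‖ * R₂ + F) * R₂ + 2 * P' * R₂ + D.L * R₂ ^ 2, fun t₀ ht₀ t ht => ?_⟩
    -- The original sequence converges only weakly at `t₀`, so its energies there need not converge
    -- to that of the limit. The restarted sequence has strongly converging data at `t₀`, and by
    -- uniqueness the same limit at `t`.
    obtain ⟨ε', x', w', hs', hs0', hx0', hw0', hew'⟩ :=
      hR₂ t₀ ht₀ (v t₀) (u t₀) (hvu t₀ ht₀).1 (hvu t₀ ht₀).2.1
    obtain ⟨v', u', -, -, hconv⟩ := hs'.exists_converges hT ht₀ hs0' ht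
    obtain ⟨rfl, rfl⟩ := (hs.mono (le_max_left R₁ R₂)).converges_unique hT
      (hs'.mono (le_max_right R₁ R₂)) ht₀ (hvu t₀ ht₀).2.2 hs0' ht (hvu t ht).2.2 hconv
    exact hs'.energy_le_of_converges hf hp' hp hF hP' ht₀ ht hx0' hw0' hew' hconv
  -- weak continuity
  have hLip1 : ∀ s ∈ Icc 0 T, ∀ t ∈ Icc 0 T, ‖D.incl (v t) - D.incl (v s)‖ ≤ R₁ * |t - s| := by
    intro s hs' t ht
    refine le_of_tendsto (((hvu t ht).2.2.incl_fst.sub (hvu s hs').2.2.incl_fst).norm)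
      (Eventually.of_forall fun k => ?_)
    exact (convex_Icc 0 T).norm_image_sub_le_of_norm_hasDerivWithin_le
      (fun r hr => D.incl.hasFDerivAt.comp_hasDerivWithinAt r ((hs.approx k).deriv_fst r hr))
      (fun r hr => hs.norm_snd k r hr) hs' ht
  obtain ⟨K₂, hK₂⟩ : ∃ K₂, ∀ k, ∀ r ∈ Icc 0 T,
      ‖D.gram (x k r) - D.op r (x k r) + (D.coincl (f r) + p r)‖ ≤ K₂ := by
    refine ⟨‖D.gram‖ * R₁ + D.M * R₁ + (‖D.coincl‖ * F + P), fun k r hr => ?_⟩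
    have h1 := hs.norm_fst k r hr
    have hR0 := hs.nonneg
    have hM := D.M_pos.le
    refine (norm_add_le _ _).trans (add_le_add ((norm_sub_le _ _).trans (add_le_add ?_ ?_))
      ((norm_add_le _ _).trans (add_le_add ?_ (hP r hr))))
    · exact (D.gram.le_opNorm _).trans (by gcongr)
    · exact ((D.op r).le_of_opNorm_le (D.bound r hr) _).trans (by gcongr)
    · exact (D.coincl.le_opNorm _).trans (by have := hF r hr; gcongr)
  have hLip2 : ∀ s ∈ Icc 0 T, ∀ t ∈ Icc 0 T,
      ‖D.coincl (u t) - D.coincl (u s)‖ ≤ K₂ * |t - s| := by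
    intro s hs' t ht
    refine le_of_tendsto (((hvu t ht).2.2.momentum.sub (hvu s hs').2.2.momentum).norm)
      (Eventually.of_forall fun k => ?_)
    exact (convex_Icc 0 T).norm_image_sub_le_of_norm_hasDerivWithin_le
      (fun r hr => (hs.approx k).hasDerivWithinAt_momentum hr)
      (fun r hr => hK₂ k r hr) hs' ht
  have hwv : ∀ φ, ContinuousOn (fun t => inner ℝ (v t) φ) (Icc 0 T) := fun φ t ht =>
    tendsto_inner_of_dense (C := R₁) (by
      filter_upwards [self_mem_nhdsWithin] with s hs using (hvu s hs).1) D.denseRange_coincl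
      (by
        rintro _ ⟨h, rfl⟩
        simp only [D.inner_coincl_right]
        exact (continuousOn_of_norm_sub_le hLip1 t ht).inner tendsto_const_nhds) φ
  have hwu : ∀ φ, ContinuousOn (fun t => inner ℝ (u t) φ) (Icc 0 T) := fun φ t ht =>
    tendsto_inner_of_dense (C := R₁) (by
      filter_upwards [self_mem_nhdsWithin] with s hs using (hvu s hs).2.1) D.dense
      (by
        rintro _ ⟨h, rfl⟩
        simp only [← D.inner_coincl_left]
        exact (continuousOn_of_norm_sub_le hLip2 t ht).inner tendsto_const_nhds) φ
  have hpv : ContinuousOn (fun t => inner ℝ (p t) (v t)) (Icc 0 T) := fun t ht => by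
    have h1 : Tendsto (fun s => inner ℝ (v s) (p t)) (𝓝[Icc 0 T] t) (𝓝 (inner ℝ (v t) (p t))) :=
      hwv (p t) t ht
    have h2 : Tendsto (fun s => inner ℝ (p s - p t) (v s)) (𝓝[Icc 0 T] t) (𝓝 0) := by
      have h3 : Tendsto (fun s => ‖p s - p t‖ * R₁) (𝓝[Icc 0 T] t) (𝓝 0) := by
        have := (tendsto_iff_norm_sub_tendsto_zero.1 (hpc t ht)).mul_const R₁
        simpa using this
      refine squeeze_zero_norm' ?_ h3
      filter_upwards [self_mem_nhdsWithin] with s hs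
      exact (abs_real_inner_le_norm _ _).trans
        (mul_le_mul_of_nonneg_left (hvu s hs).1 (norm_nonneg _))
    have h4 := h1.add h2
    rw [add_zero, real_inner_comm (p t) (v t)] at h4
    refine h4.congr fun s => ?_
    rw [inner_sub_left, real_inner_comm (p t) (v s)]
    ring
  have hen : ContinuousOn (fun t => ‖u t‖ ^ 2 + inner ℝ (D.op t (v t)) (v t)) (Icc 0 T) := by
    have h1 : ContinuousOn (fun t => ‖u t‖ ^ 2 + inner ℝ (D.op t (v t)) (v t) -
        2 * inner ℝ (p t) (v t)) (Icc 0 T) := by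
      refine continuousOn_of_norm_sub_le (K := K) fun s hs' t ht => ?_
      rw [Real.norm_eq_abs, abs_le]
      have e1 := hK s hs' t ht
      have e2 := hK t ht s hs'
      rw [abs_sub_comm s t] at e2
      constructor <;> linarith
    have h2 : ContinuousOn (fun t => 2 * inner ℝ (p t) (v t)) (Icc 0 T) :=
      continuousOn_const.mul hpv
    refine (h1.add h2).congr fun t _ => ?_
    simp only [Pi.add_apply, sub_add_cancel]
  obtain ⟨hvc, huc⟩ := continuousOn_of_energy (fun t ht => (hvu t ht).1) hwv hwu hen
  have hsub : ∀ {t}, t ∈ Icc 0 T → uIcc 0 t ⊆ Icc 0 T := fun ht => uIcc_subset_Icc h0 ht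
  refine ⟨v, u, ⟨hvc, huc, fun t ht => ?_, fun t ht => ?_⟩, hv0.1, hv0.2, fun t ht => ?_⟩
  · refine ext_inner_right ℝ fun φ => ?_
    have hui : IntervalIntegrable u volume 0 t := (huc.mono (hsub ht)).intervalIntegrable
    have l1 : Tendsto (fun k => ∫ r in 0..t, inner ℝ φ (D.incl (w k r))) atTop
        (𝓝 (∫ r in 0..t, inner ℝ φ (u r))) := by
      refine intervalIntegral.tendsto_integral_filter_of_dominated_convergence
        (fun _ => ‖φ‖ * R₁) (Eventually.of_forall fun k => ?_) (Eventually.of_forall fun k => ?_)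
        intervalIntegrable_const ?_
      · refine ContinuousOn.aestronglyMeasurable (ContinuousOn.mono ?_
          ((uIoc_subset_uIcc).trans (hsub ht))) measurableSet_uIoc
        exact continuousOn_const.inner
          (D.incl.continuous.comp_continuousOn (hs.approx k).continuousOn_snd)
      · refine Eventually.of_forall fun r hr => ?_
        refine (norm_inner_le_norm _ _).trans ?_
        gcongr
        exact hs.norm_snd k r (hsub ht (uIoc_subset_uIcc hr))
      · refine Eventually.of_forall fun r hr => ?_
        have := (hvu r (hsub ht (uIoc_subset_uIcc hr))).2.2.weak_snd φ
        simpa only [real_inner_comm φ] using this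
    have l2 : Tendsto (fun k => inner ℝ (D.incl (x k t)) φ - inner ℝ (D.incl (x k 0)) φ) atTop
        (𝓝 (inner ℝ (D.incl (v t)) φ - inner ℝ (D.incl (v 0)) φ)) :=
      ((hvu t ht).2.2.incl_fst.inner tendsto_const_nhds).sub
        ((hvu 0 h0).2.2.incl_fst.inner tendsto_const_nhds)
    have l3 : ∀ k, inner ℝ (D.incl (x k t)) φ - inner ℝ (D.incl (x k 0)) φ =
        ∫ r in 0..t, inner ℝ φ (D.incl (w k r)) := fun k => by
      have hc := D.incl.continuous.comp_continuousOn (hs.approx k).continuousOn_snd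
      have := eq_integral_of_hasDerivWithinAt h0 ht hc (x := fun t => D.incl (x k t))
        (fun r hr => D.incl.hasFDerivAt.comp_hasDerivWithinAt r ((hs.approx k).deriv_fst r hr))
      rw [← inner_sub_left, this, real_inner_comm]
      exact (intervalIntegral_inner ((hc.mono (hsub ht)).intervalIntegrable) φ).symm
    simp only [l3] at l2
    have l4 := tendsto_nhds_unique l1 l2
    rw [inner_add_left, real_inner_comm φ (∫ r in 0..t, u r),
      ← intervalIntegral_inner hui, l4]
    ring
  · refine ext_inner_right ℝ fun φ => ?_
    have hgc : ∀ {y : ℝ → V}, ContinuousOn y (Icc 0 T) → ContinuousOn (fun r =>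
        D.gram (y r) - D.op r (y r) + (D.coincl (f r) + p r)) (Icc 0 T) := fun hy =>
      ((D.gram.continuous.comp_continuousOn hy).sub (D.continuousOn_op.clm_apply hy)).add
        ((D.coincl.continuous.comp_continuousOn hf).add hpc)
    have l1 : Tendsto (fun k => ∫ r in 0..t, inner ℝ φ
        (D.gram (x k r) - D.op r (x k r) + (D.coincl (f r) + p r))) atTop
        (𝓝 (∫ r in 0..t, inner ℝ φ (D.gram (v r) - D.op r (v r) + (D.coincl (f r) + p r)))) := by
      refine intervalIntegral.tendsto_integral_filter_of_dominated_convergence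
        (fun _ => ‖φ‖ * K₂) (Eventually.of_forall fun k => ?_) (Eventually.of_forall fun k => ?_)
        intervalIntegrable_const ?_
      · refine ContinuousOn.aestronglyMeasurable (ContinuousOn.mono ?_
          ((uIoc_subset_uIcc).trans (hsub ht))) measurableSet_uIoc
        exact continuousOn_const.inner (hgc (hs.approx k).continuousOn_fst)
      · refine Eventually.of_forall fun r hr => ?_
        refine (norm_inner_le_norm _ _).trans ?_
        gcongr
        exact hK₂ k r (hsub ht (uIoc_subset_uIcc hr))
      · refine Eventually.of_forall fun r hr => ?_
        have hr' := hsub ht (uIoc_subset_uIcc hr)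
        have hw := (hvu r hr').2.2.weak_fst
        -- Moving `S` and `B` onto `φ` makes weak convergence of `x k r` sufficient.
        have e : ∀ y, inner ℝ φ (D.gram y - D.op r y + (D.coincl (f r) + p r)) =
            inner ℝ y (D.gram φ) - inner ℝ y (D.op r φ) +
              inner ℝ φ (D.coincl (f r) + p r) := fun y => by
          rw [inner_add_right, inner_sub_right, ← D.symm r hr', real_inner_comm y (D.op r φ),
            gram_apply, gram_apply, D.inner_coincl_right, D.inner_coincl_right,
            real_inner_comm (D.incl φ)]
        simp only [e]
        exact ((hw _).sub (hw _)).add_const _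
    have l2 : Tendsto (fun k => inner ℝ (D.gram (w k t) + ε k • w k t) φ -
        inner ℝ (D.gram (w k 0) + ε k • w k 0) φ) atTop
        (𝓝 (inner ℝ (D.coincl (u t)) φ - inner ℝ (D.coincl (u 0)) φ)) :=
      ((hvu t ht).2.2.momentum.inner tendsto_const_nhds).sub
        ((hvu 0 h0).2.2.momentum.inner tendsto_const_nhds)
    have l3 : ∀ k, inner ℝ (D.gram (w k t) + ε k • w k t) φ -
        inner ℝ (D.gram (w k 0) + ε k • w k 0) φ = ∫ r in 0..t, inner ℝ φ
        (D.gram (x k r) - D.op r (x k r) + (D.coincl (f r) + p r)) := fun k => by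
      have hc := hgc (hs.approx k).continuousOn_fst
      have := eq_integral_of_hasDerivWithinAt h0 ht hc
        (fun r hr => (hs.approx k).hasDerivWithinAt_momentum hr)
      rw [← inner_sub_left, this, real_inner_comm]
      exact (intervalIntegral_inner ((hc.mono (hsub ht)).intervalIntegrable) φ).symm
    simp only [l3] at l2
    have l4 := tendsto_nhds_unique l1 l2
    rw [inner_add_left, real_inner_comm φ (∫ r in 0..t, _),
      ← intervalIntegral_inner ((hgc hvc).mono (hsub ht)).intervalIntegrable, l4]
    ring
  · have hlim : Tendsto (fun k => C * (‖D.incl (w k 0)‖ ^ 2 + ε k * ‖w k 0‖ ^ 2 + ‖v₀‖ ^ 2 +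
        P ^ 2 + ∫ r in 0..T, (‖f r‖ ^ 2 + ‖p' r‖ ^ 2))) atTop
        (𝓝 (C * (‖u₀‖ ^ 2 + 0 + ‖v₀‖ ^ 2 + P ^ 2 +
          ∫ r in 0..T, (‖f r‖ ^ 2 + ‖p' r‖ ^ 2)))) :=
      (((((hw0.norm.pow 2).add hew).add_const _).add_const _).add_const _).const_mul C
    -- Lower semicontinuity is applied with the form `c ‖y‖²`, since this is the quantity bounded by
    -- the uniform estimate.
    have hG : ∀ y : V, inner ℝ ((D.c • ContinuousLinearMap.id ℝ V) y) y = D.c * ‖y‖ ^ 2 :=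
      fun y => by
        simp only [_root_.smul_apply, ContinuousLinearMap.id_apply, real_inner_smul_left,
          real_inner_self_eq_norm_sq]
    have := (hvu t ht).2.2.energy_le (G := D.c • ContinuousLinearMap.id ℝ V)
      (fun a b => by simp [real_inner_smul_left, real_inner_smul_right])
      (fun a => by rw [hG]; positivity) hlim (fun k => by
        rw [hG]
        have h1 := hest f p p' (ε k) P (x k) (w k) (hs.pos k).le (hs.approx k) hf hp' hp hP 0 h0 t ht
        rw [hx0] at h1
        have h2 : 0 ≤ ε k * ‖w k t‖ ^ 2 := by have := (hs.pos k).le; positivity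
        linarith)
    rw [hG, add_zero] at this
    exact this

end WaveForm

/-! ### Square-integrable functions of time and their primitives -/

section L2

variable {E : Type*} [NormedAddCommGroup E] {T : ℝ}

theorem Lp_integrableOn (Q : Lp E 2 (volume.restrict (Ioo 0 T))) : IntegrableOn Q (Ioo 0 T) :=
  (Lp.memLp Q).integrable (by norm_num)

theorem Lp_integral_norm_le (hT : 0 ≤ T) (Q : Lp E 2 (volume.restrict (Ioo 0 T))) :
    ∫ t in Ioo 0 T, ‖Q t‖ ≤ √T * ‖Q‖ := by
  have h := eLpNorm_le_eLpNorm_mul_rpow_measure_univ (μ := volume.restrict (Ioo 0 T))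
    (p := 1) (q := 2) (by norm_num) (Lp.aestronglyMeasurable Q)
  rw [integral_norm_eq_lintegral_enorm (Lp.aestronglyMeasurable Q), ← eLpNorm_one_eq_lintegral_enorm,
    Lp.norm_def]
  refine (ENNReal.toReal_mono (ENNReal.mul_ne_top (Lp.eLpNorm_ne_top Q) ?_) h).trans ?_
  · exact ENNReal.rpow_ne_top_of_nonneg (by norm_num) (measure_ne_top _ _)
  · rw [ENNReal.toReal_mul, mul_comm, ← ENNReal.toReal_rpow]
    simp only [Measure.restrict_apply_univ, Real.volume_Ioo, sub_zero, ENNReal.toReal_ofReal hT,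
      ENNReal.toReal_one, ENNReal.toReal_ofNat]
    rw [Real.sqrt_eq_rpow]
    norm_num

theorem restrict_Ioc_le {t : ℝ} (ht : t ≤ T) :
    volume.restrict (Ioc 0 t) ≤ volume.restrict (Ioo 0 T) := by
  rw [← restrict_Ioo_eq_restrict_Ioc]
  exact Measure.restrict_mono (Ioo_subset_Ioo_right ht) le_rfl

theorem ae_uIoc_of_ae_Ioo {P : ℝ → Prop} (h : ∀ᵐ s ∂volume.restrict (Ioo 0 T), P s) {t : ℝ}
    (ht : t ∈ Icc 0 T) : ∀ᵐ s ∂volume.restrict (uIoc 0 t), P s := by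
  rw [uIoc_of_le ht.1]
  exact Measure.absolutelyContinuous_of_le (restrict_Ioc_le ht.2) h

theorem Lp_intervalIntegrable (Q : Lp E 2 (volume.restrict (Ioo 0 T))) {t : ℝ}
    (ht : t ∈ Icc 0 T) : IntervalIntegrable Q volume 0 t := by
  rw [intervalIntegrable_iff_integrableOn_Ioc_of_le ht.1]
  exact Integrable.mono_measure (Lp_integrableOn Q) (restrict_Ioc_le ht.2)

variable [NormedSpace ℝ E]

theorem norm_primitive_le (hT : 0 ≤ T) (Q : Lp E 2 (volume.restrict (Ioo 0 T))) {t : ℝ}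
    (ht : t ∈ Icc 0 T) : ‖∫ s in 0..t, Q s‖ ≤ √T * ‖Q‖ := by
  refine le_trans ?_ (Lp_integral_norm_le hT Q)
  rw [intervalIntegral.integral_of_le ht.1]
  refine (norm_integral_le_integral_norm _).trans ?_
  exact integral_mono_measure (restrict_Ioc_le ht.2)
    (Eventually.of_forall fun _ => norm_nonneg _) (Lp_integrableOn Q).norm

theorem primitive_congr_ae {g g' : ℝ → E} (h : g =ᵐ[volume.restrict (Ioo 0 T)] g') {t : ℝ}
    (ht : t ∈ Icc 0 T) : ∫ s in 0..t, g s = ∫ s in 0..t, g' s :=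
  intervalIntegral.integral_congr_ae_restrict (ae_uIoc_of_ae_Ioo h ht)

theorem continuousOn_primitive_Lp (hT : 0 ≤ T) (Q : Lp E 2 (volume.restrict (Ioo 0 T))) :
    ContinuousOn (fun t => ∫ s in 0..t, Q s) (Icc 0 T) := by
  have h := Lp_intervalIntegrable Q (right_mem_Icc.2 hT)
  have := intervalIntegral.continuousOn_primitive_interval' h (a := 0) left_mem_uIcc
  rwa [uIcc_of_le hT] at this

end L2

/-! ### Uniqueness, and sources of the form `i†f + p₀ + ∫ Q` -/

namespace WaveForm

variable {V H : Type*} [NormedAddCommGroup V] [InnerProductSpace ℝ V] [CompleteSpace V]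
  [NormedAddCommGroup H] [InnerProductSpace ℝ H] [CompleteSpace H] {T : ℝ} {D : WaveForm V H T}

theorem continuousOn_gram_sub_op {y : ℝ → V} (hy : ContinuousOn y (Icc 0 T)) :
    ContinuousOn (fun r => D.gram (y r) - D.op r (y r)) (Icc 0 T) :=
  (D.gram.continuous.comp_continuousOn hy).sub (D.continuousOn_op.clm_apply hy)

namespace IsSolution

variable {F F' : ℝ → V} {v v' : ℝ → V} {u u' : ℝ → H}

theorem congr_ae (h : D.IsSolution F v u) (hF : F =ᵐ[volume.restrict (Ioo 0 T)] F') :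
    D.IsSolution F' v u where
  continuousOn_fst := h.continuousOn_fst
  continuousOn_snd := h.continuousOn_snd
  eq_fst := h.eq_fst
  eq_snd t ht := by
    rw [h.eq_snd t ht]
    congr 1
    refine primitive_congr_ae ?_ ht
    filter_upwards [hF] with s hs
    rw [hs]

theorem sub (h : D.IsSolution F v u) (h' : D.IsSolution F' v' u')
    (hF : IntervalIntegrable F volume 0 T) (hF' : IntervalIntegrable F' volume 0 T) :
    D.IsSolution (fun t => F t - F' t) (fun t => v t - v' t) (fun t => u t - u' t) where
  continuousOn_fst := h.continuousOn_fst.sub h'.continuousOn_fst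
  continuousOn_snd := h.continuousOn_snd.sub h'.continuousOn_snd
  eq_fst t ht := by
    have hsub : uIcc 0 t ⊆ Icc 0 T := uIcc_subset_Icc (left_mem_Icc.2 (ht.1.trans ht.2)) ht
    rw [intervalIntegral.integral_sub ((h.continuousOn_snd.mono hsub).intervalIntegrable)
      ((h'.continuousOn_snd.mono hsub).intervalIntegrable), map_sub, map_sub, h.eq_fst t ht,
      h'.eq_fst t ht]
    abel
  eq_snd t ht := by
    have hsub : uIcc 0 t ⊆ Icc 0 T := uIcc_subset_Icc (left_mem_Icc.2 (ht.1.trans ht.2)) ht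
    have hsub' : uIcc 0 t ⊆ uIcc 0 T := by rwa [uIcc_of_le (ht.1.trans ht.2)]
    have i1 := (((continuousOn_gram_sub_op (D := D) h.continuousOn_fst).mono
      hsub).intervalIntegrable (μ := volume)).add (hF.mono_set hsub')
    have i2 := (((continuousOn_gram_sub_op (D := D) h'.continuousOn_fst).mono
      hsub).intervalIntegrable (μ := volume)).add (hF'.mono_set hsub')
    have e : ∀ r, D.gram (v r - v' r) - D.op r (v r - v' r) + (F r - F' r) =
        (D.gram (v r) - D.op r (v r) + F r) - (D.gram (v' r) - D.op r (v' r) + F' r) := fun r => by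
      simp only [map_sub]; abel
    simp only [e]
    rw [intervalIntegral.integral_sub i1 i2, map_sub, map_sub, h.eq_snd t ht, h'.eq_snd t ht]
    abel

/-- The velocity `u` lies only in `H`, so the equation cannot be tested with it. The low-order
estimate avoids this; with the exact momentum `i†u` its defect is `ρ = 0`. -/
theorem eq_zero (hT : 0 ≤ T) (h : D.IsSolution 0 v u) (hv : v 0 = 0) (hu : u 0 = 0) :
    ∀ t ∈ Icc 0 T, v t = 0 ∧ u t = 0 := by
  obtain ⟨C, hC, hest⟩ := D.exists_low_energy_estimate hT
  intro t ht
  have h0 : (0 : ℝ) ∈ Icc 0 T := left_mem_Icc.2 hT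
  have key := hest v (fun t => D.coincl (u t)) u 0 le_rfl
    (hasDerivWithinAt_of_eq_integral hT h0 h.continuousOn_snd h.eq_fst)
    (hasDerivWithinAt_of_eq_integral hT h0 (continuousOn_gram_sub_op h.continuousOn_fst)
      (fun t ht => by simpa using h.eq_snd t ht))
    (fun t _ => by simp) 0 h0 t ht
  simp only [hv, hu, map_zero, norm_zero, ne_eq, OfNat.ofNat_ne_zero, not_false_eq_true, zero_pow,
    add_zero, mul_zero] at key
  have e1 : ‖D.incl (v t)‖ = 0 := by
    nlinarith [sq_nonneg ‖D.incl (v t)‖, sq_nonneg ‖D.coincl (u t)‖]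
  have e2 : ‖D.coincl (u t)‖ = 0 := by
    nlinarith [sq_nonneg ‖D.incl (v t)‖, sq_nonneg ‖D.coincl (u t)‖]
  exact ⟨D.inj ((norm_eq_zero.1 e1).trans (map_zero _).symm),
    D.coincl_injective ((norm_eq_zero.1 e2).trans (map_zero _).symm)⟩

theorem unique (hT : 0 ≤ T) (h : D.IsSolution F v u) (h' : D.IsSolution F' v' u')
    (hF : IntervalIntegrable F volume 0 T) (hFF' : F =ᵐ[volume.restrict (Ioo 0 T)] F')
    (hv : v 0 = v' 0) (hu : u 0 = u' 0) : ∀ t ∈ Icc 0 T, v t = v' t ∧ u t = u' t := by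
  have h1 := (h.sub (h'.congr_ae hFF'.symm) hF hF).congr_ae (F' := 0)
    (Eventually.of_forall fun t => sub_self _)
  intro t ht
  have := h1.eq_zero hT (sub_eq_zero.2 hv) (sub_eq_zero.2 hu) t ht
  exact ⟨sub_eq_zero.1 this.1, sub_eq_zero.1 this.2⟩

end IsSolution

variable (D) in
/-- The source `i†f + p₀ + ∫₀ᵗ Q`. -/
def source (f : Lp H 2 (volume.restrict (Ioo 0 T))) (p₀ : V)
    (Q : Lp V 2 (volume.restrict (Ioo 0 T))) (t : ℝ) : V :=
  D.coincl (f t) + (p₀ + ∫ r in 0..t, Q r)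

theorem intervalIntegrable_source (hT : 0 ≤ T) (f : Lp H 2 (volume.restrict (Ioo 0 T))) (p₀ : V)
    (Q : Lp V 2 (volume.restrict (Ioo 0 T))) {t : ℝ} (ht : t ∈ Icc 0 T) :
    IntervalIntegrable (D.source f p₀ Q) volume 0 t := by
  have h1 : IntervalIntegrable (fun s => D.coincl (f s)) volume 0 t :=
    ⟨D.coincl.integrable_comp (Lp_intervalIntegrable f ht).1,
      D.coincl.integrable_comp (Lp_intervalIntegrable f ht).2⟩
  refine h1.add (ContinuousOn.intervalIntegrable ?_)
  exact (continuousOn_const.add (continuousOn_primitive_Lp hT Q)).mono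
    (uIcc_subset_Icc (left_mem_Icc.2 hT) ht)

theorem norm_integral_source_le (hT : 0 ≤ T) (f : Lp H 2 (volume.restrict (Ioo 0 T))) (p₀ : V)
    (Q : Lp V 2 (volume.restrict (Ioo 0 T))) {t : ℝ} (ht : t ∈ Icc 0 T) :
    ‖∫ r in 0..t, D.source f p₀ Q r‖ ≤
      ‖D.coincl‖ * (√T * ‖f‖) + T * (‖p₀‖ + √T * ‖Q‖) := by
  have h1 : IntervalIntegrable (fun s => D.coincl (f s)) volume 0 t :=
    ⟨D.coincl.integrable_comp (Lp_intervalIntegrable f ht).1,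
      D.coincl.integrable_comp (Lp_intervalIntegrable f ht).2⟩
  have hsub := uIcc_subset_Icc (left_mem_Icc.2 hT) ht
  have h2 : IntervalIntegrable (fun s => p₀ + ∫ r in 0..s, Q r) volume 0 t :=
    ((continuousOn_const.add (continuousOn_primitive_Lp hT Q)).mono hsub).intervalIntegrable
  have e : ∫ r in 0..t, D.source f p₀ Q r =
      D.coincl (∫ r in 0..t, f r) + ∫ s in 0..t, (p₀ + ∫ r in 0..s, Q r) := by
    unfold source
    rw [intervalIntegral.integral_add h1 h2,
      D.coincl.intervalIntegral_comp_comm (Lp_intervalIntegrable f ht)]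
  rw [e]
  refine (norm_add_le _ _).trans (add_le_add ?_ ?_)
  · refine (D.coincl.le_opNorm _).trans ?_
    gcongr
    exact norm_primitive_le hT f ht
  · have := intervalIntegral.norm_integral_le_of_norm_le_const (a := 0) (b := t)
      (C := ‖p₀‖ + √T * ‖Q‖) (f := fun s => p₀ + ∫ r in 0..s, Q r) (fun s hs =>
        (norm_add_le _ _).trans (add_le_add le_rfl
          (norm_primitive_le hT Q (hsub (uIoc_subset_uIcc hs)))))
    refine this.trans ?_
    rw [sub_zero, abs_of_nonneg ht.1, mul_comm]
    gcongr
    exact ht.2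

theorem source_sub_ae (f f' : Lp H 2 (volume.restrict (Ioo 0 T))) (p₀ p₀' : V)
    (Q Q' : Lp V 2 (volume.restrict (Ioo 0 T))) :
    (fun t => D.source f p₀ Q t - D.source f' p₀' Q' t) =ᵐ[volume.restrict (Ioo 0 T)]
      D.source (f - f') (p₀ - p₀') (Q - Q') := by
  filter_upwards [Lp.coeFn_sub f f', ae_restrict_mem measurableSet_Ioo] with t ht htT
  have ht' : t ∈ Icc 0 T := Ioo_subset_Icc_self htT
  simp only [source]
  rw [ht, primitive_congr_ae (Lp.coeFn_sub Q Q') ht']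
  simp only [Pi.sub_apply]
  rw [intervalIntegral.integral_sub (Lp_intervalIntegrable Q ht') (Lp_intervalIntegrable Q' ht'),
    map_sub]
  abel

end WaveForm

/-! ### General sources, by density -/

section L2

variable {E : Type*} [NormedAddCommGroup E] [InnerProductSpace ℝ E] {T : ℝ}

theorem integral_norm_sq_of_ae_eq (hT : 0 ≤ T) {f : Lp E 2 (volume.restrict (Ioo 0 T))}
    {g : ℝ → E} (h : f =ᵐ[volume.restrict (Ioo 0 T)] g) : ∫ t in 0..T, ‖g t‖ ^ 2 = ‖f‖ ^ 2 := by
  rw [← real_inner_self_eq_norm_sq, L2.inner_def, intervalIntegral.integral_of_le hT,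
    ← restrict_Ioo_eq_restrict_Ioc]
  refine integral_congr_ae ?_
  filter_upwards [h] with t ht
  rw [ht, real_inner_self_eq_norm_sq]

theorem exists_seq_continuous_tendsto (f : Lp E 2 (volume.restrict (Ioo 0 T))) :
    ∃ (F : ℕ → Lp E 2 (volume.restrict (Ioo 0 T))) (g : ℕ → ℝ → E), (∀ k, Continuous (g k)) ∧
      (∀ k, F k =ᵐ[volume.restrict (Ioo 0 T)] g k) ∧ Tendsto F atTop (𝓝 f) := by
  have hd := BoundedContinuousFunction.toLp_denseRange E (volume.restrict (Ioo 0 T)) ℝ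
    (p := 2) (by norm_num)
  obtain ⟨F, hF, hlim⟩ := mem_closure_iff_seq_limit.1 (hd f)
  choose g hg using hF
  refine ⟨F, fun k => g k, fun k => (g k).continuous, fun k => ?_, hlim⟩
  rw [← hg k]
  exact BoundedContinuousFunction.coeFn_toLp 2 (volume.restrict (Ioo 0 T)) ℝ (g k)

omit [InnerProductSpace ℝ E] in
theorem exists_tendstoUniformlyOn [CompleteSpace E] {I : Set ℝ} {x : ℕ → ℝ → E} {b : ℕ × ℕ → ℝ}
    (hb : Tendsto b atTop (𝓝 0)) (hx : ∀ k l, ∀ t ∈ I, ‖x k t - x l t‖ ≤ b (k, l)) :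
    ∃ y, TendstoUniformlyOn x y atTop I := by
  have hU : UniformCauchySeqOn x atTop I := by
    refine Metric.uniformCauchySeqOn_iff.2 fun δ hδ => ?_
    obtain ⟨N, hN⟩ := (hb.eventually (gt_mem_nhds hδ)).exists_forall_of_atTop
    refine ⟨max N.1 N.2, fun m hm n hn t ht => ?_⟩
    rw [dist_eq_norm]
    exact (hx m n t ht).trans_lt (hN (m, n)
      ⟨(le_max_left _ _).trans hm, (le_max_right _ _).trans hn⟩)
  have hl : ∀ t, ∃ y, t ∈ I → Tendsto (x · t) atTop (𝓝 y) := fun t => by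
    by_cases ht : t ∈ I
    · obtain ⟨y, hy⟩ := cauchySeq_tendsto_of_complete (hU.cauchy_map ht)
      exact ⟨y, fun _ => hy⟩
    · exact ⟨0, fun h => absurd h ht⟩
  choose y hy using hl
  exact ⟨y, hU.tendstoUniformlyOn_of_tendsto fun t ht => hy t ht⟩

end L2

namespace WaveForm

variable {V H : Type*} [NormedAddCommGroup V] [InnerProductSpace ℝ V] [CompleteSpace V]
  [NormedAddCommGroup H] [InnerProductSpace ℝ H] [CompleteSpace H] {T : ℝ} (D : WaveForm V H T)

/-- Continuity of the representatives `g` and `q` is needed for existence but does not enter the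
constant, which sees only `L²` norms; this permits the passage to the limit. Here `p' = q`, and `p`
is bounded by `‖p₀‖ + √T ‖Q‖`. -/
theorem exists_isSolution_of_continuous (hT : 0 ≤ T) : ∃ C, 0 ≤ C ∧
    ∀ (f : Lp H 2 (volume.restrict (Ioo 0 T))) (p₀ : V) (Q : Lp V 2 (volume.restrict (Ioo 0 T)))
    (v₀ : V) (u₀ : H) (g : ℝ → H) (q : ℝ → V), Continuous g → Continuous q →
    f =ᵐ[volume.restrict (Ioo 0 T)] g → Q =ᵐ[volume.restrict (Ioo 0 T)] q →
    ∃ v u, D.IsSolution (D.source f p₀ Q) v u ∧ v 0 = v₀ ∧ u 0 = u₀ ∧ ∀ t ∈ Icc 0 T,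
      ‖u t‖ + ‖v t‖ ≤ C * (‖f‖ + ‖p₀‖ + ‖Q‖ + ‖v₀‖ + ‖u₀‖) := by
  obtain ⟨C, hC, h⟩ := D.exists_isSolution_of_continuousOn hT
  have hc := D.c_pos
  refine ⟨√(2 * (1 + D.c⁻¹) * (C * (1 + (1 + √T) ^ 2))), Real.sqrt_nonneg _,
    fun f p₀ Q v₀ u₀ g q hg hq hfg hQq => ?_⟩
  have hprim : ∀ t ∈ Icc 0 T, ∫ s in 0..t, Q s = ∫ s in 0..t, q s := fun t ht =>
    primitive_congr_ae hQq ht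
  obtain ⟨v, u, hsol, hv, hu, hest⟩ := h g (fun t => p₀ + ∫ s in 0..t, q s) q
    (‖p₀‖ + √T * ‖Q‖) v₀ u₀ hg.continuousOn hq.continuousOn
    (fun t _ => ((hq.integral_hasStrictDerivAt 0 t).hasDerivAt.const_add p₀).hasDerivWithinAt)
    (fun t ht => (norm_add_le _ _).trans (add_le_add le_rfl (by
      rw [← hprim t ht]; exact norm_primitive_le hT Q ht)))
  refine ⟨v, u, hsol.congr_ae ?_, hv, hu, fun t ht => ?_⟩
  · filter_upwards [hfg, ae_restrict_mem measurableSet_Ioo] with t h1 h2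
    simp only [source]
    rw [h1, hprim t (Ioo_subset_Icc_self h2)]
  · have h1 := hest t ht
    have i1 : Continuous fun r => ‖g r‖ ^ 2 := hg.norm.pow 2
    have i2 : Continuous fun r => ‖q r‖ ^ 2 := hq.norm.pow 2
    rw [intervalIntegral.integral_add (i1.intervalIntegrable _ _)
      (i2.intervalIntegrable _ _), integral_norm_sq_of_ae_eq hT hfg,
      integral_norm_sq_of_ae_eq hT hQq] at h1
    set s := ‖f‖ + ‖p₀‖ + ‖Q‖ + ‖v₀‖ + ‖u₀‖ with hs
    have n1 := norm_nonneg f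
    have n2 := norm_nonneg p₀
    have n3 := norm_nonneg Q
    have n4 := norm_nonneg v₀
    have n5 := norm_nonneg u₀
    have hs0 : 0 ≤ s := by positivity
    have hT' := Real.sqrt_nonneg T
    have h2 : (‖p₀‖ + √T * ‖Q‖) ^ 2 ≤ (1 + √T) ^ 2 * s ^ 2 := by
      rw [← mul_pow]
      refine pow_le_pow_left₀ (by positivity) ?_ 2
      have q1 : ‖p₀‖ ≤ s := by linarith
      have q2 : √T * ‖Q‖ ≤ √T * s := by gcongr; linarith
      linarith
    have h3 : ‖u₀‖ ^ 2 + ‖v₀‖ ^ 2 + ‖f‖ ^ 2 + ‖Q‖ ^ 2 ≤ s ^ 2 := by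
      have e : s ^ 2 = ‖u₀‖ * s + ‖v₀‖ * s + ‖f‖ * s + ‖Q‖ * s + ‖p₀‖ * s := by rw [hs]; ring
      have m1 : ‖u₀‖ ^ 2 ≤ ‖u₀‖ * s := by rw [sq]; gcongr; linarith
      have m2 : ‖v₀‖ ^ 2 ≤ ‖v₀‖ * s := by rw [sq]; gcongr; linarith
      have m3 : ‖f‖ ^ 2 ≤ ‖f‖ * s := by rw [sq]; gcongr; linarith
      have m4 : ‖Q‖ ^ 2 ≤ ‖Q‖ * s := by rw [sq]; gcongr; linarith
      have m5 : 0 ≤ ‖p₀‖ * s := by positivity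
      linarith
    have h4 : ‖u t‖ ^ 2 + D.c * ‖v t‖ ^ 2 ≤ C * (1 + (1 + √T) ^ 2) * s ^ 2 := by
      refine h1.trans ?_
      rw [mul_assoc]
      refine mul_le_mul_of_nonneg_left ?_ hC
      linarith
    have h5 : ‖u t‖ ^ 2 + ‖v t‖ ^ 2 ≤ (1 + D.c⁻¹) * (‖u t‖ ^ 2 + D.c * ‖v t‖ ^ 2) := by
      have e : D.c⁻¹ * (D.c * ‖v t‖ ^ 2) = ‖v t‖ ^ 2 := by field_simp
      have q1 : 0 ≤ D.c * ‖v t‖ ^ 2 := by positivity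
      have q2 : 0 ≤ D.c⁻¹ * ‖u t‖ ^ 2 := by positivity
      linarith
    have hci : 0 ≤ 1 + D.c⁻¹ := by positivity
    have h6 := mul_le_mul_of_nonneg_left h4 hci
    calc ‖u t‖ + ‖v t‖ ≤ √(2 * (1 + D.c⁻¹) * (C * (1 + (1 + √T) ^ 2)) * s ^ 2) := by
          refine Real.le_sqrt_of_sq_le ?_
          have m1 : (‖u t‖ + ‖v t‖) ^ 2 ≤ 2 * (‖u t‖ ^ 2 + ‖v t‖ ^ 2) := by
            linarith [sq_nonneg (‖u t‖ - ‖v t‖), add_sq ‖u t‖ ‖v t‖, sub_sq ‖u t‖ ‖v t‖]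
          linarith
      _ = _ := by rw [Real.sqrt_mul (by positivity), Real.sqrt_sq hs0]

variable {D} in
theorem IsSolution.of_tendsto (hT : 0 ≤ T) {f : Lp H 2 (volume.restrict (Ioo 0 T))} {p₀ : V}
    {Q : Lp V 2 (volume.restrict (Ioo 0 T))} {f' : ℕ → Lp H 2 (volume.restrict (Ioo 0 T))}
    {Q' : ℕ → Lp V 2 (volume.restrict (Ioo 0 T))} (hf : Tendsto f' atTop (𝓝 f))
    (hQ : Tendsto Q' atTop (𝓝 Q)) {v : ℕ → ℝ → V} {u : ℕ → ℝ → H} {v' : ℝ → V} {u' : ℝ → H}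
    (hsol : ∀ k, D.IsSolution (D.source (f' k) p₀ (Q' k)) (v k) (u k))
    (hv' : TendstoUniformlyOn v v' atTop (Icc 0 T)) (hu' : TendstoUniformlyOn u u' atTop (Icc 0 T))
    {B : ℝ} (hB' : ∀ k, ∀ t ∈ Icc 0 T, ‖u k t‖ + ‖v k t‖ ≤ B) :
    D.IsSolution (D.source f p₀ Q) v' u' := by
  have h0 : (0 : ℝ) ∈ Icc 0 T := left_mem_Icc.2 hT
  have hvt : ∀ t ∈ Icc 0 T, Tendsto (v · t) atTop (𝓝 (v' t)) := fun t ht => hv'.tendsto_at ht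
  have hut : ∀ t ∈ Icc 0 T, Tendsto (u · t) atTop (𝓝 (u' t)) := fun t ht => hu'.tendsto_at ht
  have hvc : ContinuousOn v' (Icc 0 T) :=
    hv'.continuousOn (Frequently.of_forall fun k => (hsol k).continuousOn_fst)
  have huc : ContinuousOn u' (Icc 0 T) :=
    hu'.continuousOn (Frequently.of_forall fun k => (hsol k).continuousOn_snd)
  refine ⟨hvc, huc, fun t ht => ?_, fun t ht => ?_⟩
  · have hsub : uIoc 0 t ⊆ Icc 0 T := uIoc_subset_uIcc.trans (uIcc_subset_Icc h0 ht)
    have l1 : Tendsto (fun k => ∫ r in 0..t, u k r) atTop (𝓝 (∫ r in 0..t, u' r)) := by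
      refine intervalIntegral.tendsto_integral_filter_of_dominated_convergence
        (fun _ => B) (Eventually.of_forall fun k => ?_) (Eventually.of_forall fun k => ?_)
        intervalIntegrable_const (Eventually.of_forall fun r hr => hut r (hsub hr))
      · exact ((hsol k).continuousOn_snd.mono hsub).aestronglyMeasurable measurableSet_uIoc
      · exact Eventually.of_forall fun r hr =>
          (le_add_of_nonneg_right (norm_nonneg _)).trans (hB' k r (hsub hr))
    have l2 : Tendsto (fun k => D.incl (v k t)) atTop (𝓝 (D.incl (v' t))) :=
      (D.incl.continuous.tendsto _).comp (hvt t ht)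
    refine tendsto_nhds_unique l2 ?_
    refine Tendsto.congr (fun k => ((hsol k).eq_fst t ht).symm) ?_
    exact ((D.incl.continuous.tendsto _).comp (hvt 0 h0)).add l1
  · have hsub : uIoc 0 t ⊆ Icc 0 T := uIoc_subset_uIcc.trans (uIcc_subset_Icc h0 ht)
    have hsub' : uIcc 0 t ⊆ Icc 0 T := uIcc_subset_Icc h0 ht
    have l1 : Tendsto (fun k => ∫ r in 0..t, (D.gram (v k r) - D.op r (v k r))) atTop
        (𝓝 (∫ r in 0..t, (D.gram (v' r) - D.op r (v' r)))) := by
      refine intervalIntegral.tendsto_integral_filter_of_dominated_convergence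
        (fun _ => ‖D.gram‖ * B + D.M * B) (Eventually.of_forall fun k => ?_)
        (Eventually.of_forall fun k => ?_)
        intervalIntegrable_const (Eventually.of_forall fun r hr => ?_)
      · exact ((continuousOn_gram_sub_op (hsol k).continuousOn_fst).mono hsub).aestronglyMeasurable
          measurableSet_uIoc
      · refine Eventually.of_forall fun r hr => ?_
        have hb := (le_add_of_nonneg_left (norm_nonneg _)).trans (hB' k r (hsub hr))
        have hM := D.M_pos.le
        refine (norm_sub_le _ _).trans (add_le_add ?_ ?_)
        · exact (D.gram.le_opNorm _).trans (by gcongr)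
        · exact ((D.op r).le_of_opNorm_le (D.bound r (hsub hr)) _).trans (by gcongr)
      · have hr' := hvt r (hsub hr)
        exact ((D.gram.continuous.tendsto _).comp hr').sub (((D.op r).continuous.tendsto _).comp hr')
    have l2 : Tendsto (fun k => ∫ r in 0..t, D.source (f' k) p₀ (Q' k) r) atTop
        (𝓝 (∫ r in 0..t, D.source f p₀ Q r)) := by
      refine tendsto_iff_norm_sub_tendsto_zero.2 ?_
      have hz : Tendsto (fun k => ‖D.coincl‖ * (√T * ‖f' k - f‖) +
          T * (‖(0 : V)‖ + √T * ‖Q' k - Q‖)) atTop (𝓝 0) := by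
        have c1 := tendsto_iff_norm_sub_tendsto_zero.1 hf
        have c2 := tendsto_iff_norm_sub_tendsto_zero.1 hQ
        simpa using ((c1.const_mul √T).const_mul ‖D.coincl‖).add
          (((c2.const_mul √T).const_add ‖(0 : V)‖).const_mul T)
      refine squeeze_zero (fun _ => norm_nonneg _) (fun k => ?_) hz
      rw [← intervalIntegral.integral_sub (intervalIntegrable_source hT _ _ _ ht)
        (intervalIntegrable_source hT _ _ _ ht), primitive_congr_ae (source_sub_ae _ _ _ _ _ _) ht,
        sub_self]
      exact norm_integral_source_le hT _ _ _ ht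
    have l3 : Tendsto (fun k => D.coincl (u k t)) atTop (𝓝 (D.coincl (u' t))) :=
      (D.coincl.continuous.tendsto _).comp (hut t ht)
    have e : ∀ (y : ℝ → V) (a : Lp H 2 (volume.restrict (Ioo 0 T)))
        (b : Lp V 2 (volume.restrict (Ioo 0 T))), ContinuousOn y (Icc 0 T) →
        ∫ r in 0..t, (D.gram (y r) - D.op r (y r) + D.source a p₀ b r) =
        (∫ r in 0..t, (D.gram (y r) - D.op r (y r))) + ∫ r in 0..t, D.source a p₀ b r :=
      fun y a b hy => intervalIntegral.integral_add
        (((continuousOn_gram_sub_op hy).mono hsub').intervalIntegrable)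
        (intervalIntegrable_source hT _ _ _ ht)
    refine tendsto_nhds_unique l3 ?_
    rw [e _ _ _ hvc]
    refine Tendsto.congr (fun k => ?_)
      (((D.coincl.continuous.tendsto _).comp (hut 0 h0)).add (l1.add l2))
    rw [(hsol k).eq_snd t ht, e _ _ _ (hsol k).continuousOn_fst]
    rfl

/-- Existence for sources in `L²(0, T; H) + W`, with the energy estimate. -/
theorem exists_isSolution (hT : 0 ≤ T) : ∃ C, 0 ≤ C ∧
    ∀ (f : Lp H 2 (volume.restrict (Ioo 0 T))) (p₀ : V) (Q : Lp V 2 (volume.restrict (Ioo 0 T)))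
    (v₀ : V) (u₀ : H), ∃ v u, D.IsSolution (D.source f p₀ Q) v u ∧ v 0 = v₀ ∧ u 0 = u₀ ∧
      ∀ t ∈ Icc 0 T, ‖u t‖ + ‖v t‖ ≤ C * (‖f‖ + ‖p₀‖ + ‖Q‖ + ‖v₀‖ + ‖u₀‖) := by
  obtain ⟨C, hC, h⟩ := D.exists_isSolution_of_continuous hT
  refine ⟨C, hC, fun f p₀ Q v₀ u₀ => ?_⟩
  obtain ⟨f', g, hg, hfg, hf⟩ := exists_seq_continuous_tendsto f
  obtain ⟨Q', q, hq, hQq, hQ⟩ := exists_seq_continuous_tendsto Q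
  have h0 : (0 : ℝ) ∈ Icc 0 T := left_mem_Icc.2 hT
  have hTT : T ∈ Icc 0 T := right_mem_Icc.2 hT
  choose v u hsol hv hu hest using fun k =>
    h (f' k) p₀ (Q' k) v₀ u₀ (g k) (q k) (hg k) (hq k) (hfg k) (hQq k)
  -- The estimate is known only for the solution that the existence lemma produces. It is applied to
  -- the difference of the sources, with zero data and zero `p₀`, and uniqueness identifies that
  -- solution with the difference of the two.
  have hdiff : ∀ k l, ∀ t ∈ Icc 0 T, ‖u k t - u l t‖ + ‖v k t - v l t‖ ≤
      C * (‖f' k - f' l‖ + ‖Q' k - Q' l‖) := by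
    intro k l t ht
    obtain ⟨z, y, hzy, hz, hy, hb⟩ := h (f' k - f' l) 0 (Q' k - Q' l) 0 0 (fun t => g k t - g l t)
      (fun t => q k t - q l t) ((hg k).sub (hg l)) ((hq k).sub (hq l))
      ((Lp.coeFn_sub _ _).trans ((hfg k).sub (hfg l)))
      ((Lp.coeFn_sub _ _).trans ((hQq k).sub (hQq l)))
    have hd := ((hsol k).sub (hsol l) (intervalIntegrable_source hT _ _ _ hTT)
      (intervalIntegrable_source hT _ _ _ hTT)).congr_ae (source_sub_ae _ _ _ _ _ _)
    rw [sub_self] at hd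
    obtain ⟨e1, e2⟩ := hd.unique hT hzy (intervalIntegrable_source hT _ _ _ hTT)
      (EventuallyEq.refl _ _) (by simp [hv, hz]) (by simp [hu, hy]) t ht
    have := hb t ht
    rw [← e1, ← e2, norm_zero, norm_zero, add_zero, add_zero, add_zero] at this
    exact this
  have hcau : Tendsto (fun n : ℕ × ℕ => C * (‖f' n.1 - f' n.2‖ + ‖Q' n.1 - Q' n.2‖)) atTop
      (𝓝 0) := by
    have c1 := cauchySeq_iff_tendsto_dist_atTop_0.1 hf.cauchySeq
    have c2 := cauchySeq_iff_tendsto_dist_atTop_0.1 hQ.cauchySeq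
    simpa [dist_eq_norm] using (c1.add c2).const_mul C
  obtain ⟨v', hv'⟩ := exists_tendstoUniformlyOn (x := v) hcau fun k l t ht =>
    (le_add_of_nonneg_left (norm_nonneg _)).trans (hdiff k l t ht)
  obtain ⟨u', hu'⟩ := exists_tendstoUniformlyOn (x := u) hcau fun k l t ht =>
    (le_add_of_nonneg_right (norm_nonneg _)).trans (hdiff k l t ht)
  have hvt : ∀ t ∈ Icc 0 T, Tendsto (v · t) atTop (𝓝 (v' t)) := fun t ht => hv'.tendsto_at ht
  have hut : ∀ t ∈ Icc 0 T, Tendsto (u · t) atTop (𝓝 (u' t)) := fun t ht => hu'.tendsto_at ht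
  have hblim : Tendsto (fun k => C * (‖f' k‖ + ‖p₀‖ + ‖Q' k‖ + ‖v₀‖ + ‖u₀‖)) atTop
      (𝓝 (C * (‖f‖ + ‖p₀‖ + ‖Q‖ + ‖v₀‖ + ‖u₀‖))) :=
    ((((hf.norm.add_const _).add hQ.norm).add_const _).add_const _).const_mul C
  obtain ⟨B, hB⟩ := hblim.bddAbove_range
  have hB' : ∀ k, ∀ t ∈ Icc 0 T, ‖u k t‖ + ‖v k t‖ ≤ B := fun k t ht =>
    (hest k t ht).trans (hB ⟨k, rfl⟩)
  have hv0 : v' 0 = v₀ := tendsto_nhds_unique (hvt 0 h0) (by simp only [hv, tendsto_const_nhds])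
  have hu0 : u' 0 = u₀ := tendsto_nhds_unique (hut 0 h0) (by simp only [hu, tendsto_const_nhds])
  refine ⟨v', u', IsSolution.of_tendsto hT hf hQ hsol hv' hu' hB', hv0, hu0, fun t ht =>
    le_of_tendsto_of_tendsto' ((hut t ht).norm.add (hvt t ht).norm) hblim fun k => hest k t ht⟩

end WaveForm

/-! ### Distributional derivatives on `(0, T)` -/

section TimeDistribution

variable {T : ℝ}

theorem IsTest.eq_zero_of_notMem {E : Type*} [NormedAddCommGroup E] [NormedSpace ℝ E] {U : Set E}
    {φ : E → ℝ} (h : IsTest U φ) {x : E} (hx : x ∉ U) : φ x = 0 :=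
  image_eq_zero_of_notMem_tsupport fun hx' => hx (h.subset hx')

theorem IsTest.exists_Icc {θ : ℝ → ℝ} (hT : 0 < T) (h : IsTest (Ioo 0 T) θ) :
    ∃ a b, 0 < a ∧ a ≤ b ∧ b < T ∧ tsupport θ ⊆ Icc a b := by
  rcases (tsupport θ).eq_empty_or_nonempty with he | hne
  · exact ⟨T / 2, T / 2, by positivity, le_rfl, by linarith, by simp [he]⟩
  · obtain ⟨a, ha⟩ := IsCompact.exists_isLeast h.compact hne
    obtain ⟨b, hb⟩ := IsCompact.exists_isGreatest h.compact hne
    exact ⟨a, b, (h.subset ha.1).1, ha.2 hb.1, (h.subset hb.1).2, fun x hx => ⟨ha.2 hx, hb.2 hx⟩⟩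

/-- A test function on `(0, T)` of vanishing integral is the derivative of a test function. -/
theorem IsTest.exists_deriv_eq {η : ℝ → ℝ} (hT : 0 < T) (h : IsTest (Ioo 0 T) η)
    (h0 : ∫ t, η t = 0) : ∃ θ, IsTest (Ioo 0 T) θ ∧ deriv θ = η := by
  obtain ⟨a, b, ha, hab, hb, hsub⟩ := h.exists_Icc hT
  have hc : Continuous η := h.smooth.continuous
  have hout : ∀ t ∉ Icc a b, η t = 0 := fun t ht =>
    image_eq_zero_of_notMem_tsupport fun hx => ht (hsub hx)
  have hd : deriv (fun t => ∫ s in 0..t, η s) = η := funext fun t =>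
    hc.deriv_integral _ _ _
  have htot : ∫ s in a..b, η s = 0 := by
    rw [intervalIntegral.integral_of_le hab, ← integral_Icc_eq_integral_Ioc, ← h0]
    exact setIntegral_eq_integral_of_forall_compl_eq_zero hout
  have hsupp : Function.support (fun t => ∫ s in 0..t, η s) ⊆ Icc a b := by
    intro t ht
    by_contra hn
    refine ht ?_
    change ∫ s in 0..t, η s = 0
    have key : t < a ∨ b < t := by
      by_contra hcon
      push Not at hcon
      exact hn hcon
    -- To the left of the support there is nothing to integrate; to the right the full integral has
    -- been collected, and it vanishes.
    rcases key with hta | htb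
    · refine intervalIntegral.integral_zero_ae (Eventually.of_forall fun s hs => hout s fun hs' => ?_)
      have : s ≤ max 0 t := hs.2
      exact absurd hs'.1 (not_le.2 (this.trans_lt (max_lt ha hta)))
    · have i : ∀ x y, IntervalIntegrable η volume x y := fun x y => hc.intervalIntegrable x y
      have e1 : ∫ s in 0..a, η s = 0 := by
        refine intervalIntegral.integral_zero_ae ?_
        have : ∀ᵐ s : ℝ, s ≠ a := by simp [ae_iff, measure_singleton]
        filter_upwards [this] with s hs hs'
        rw [uIoc_of_le ha.le] at hs'
        exact hout s fun h => hs (le_antisymm hs'.2 h.1)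
      have e2 : ∫ s in b..t, η s = 0 := by
        refine intervalIntegral.integral_zero_ae (Eventually.of_forall fun s hs => hout s ?_)
        rw [uIoc_of_le htb.le] at hs
        exact fun h => absurd h.2 (not_le.2 hs.1)
      rw [← intervalIntegral.integral_add_adjacent_intervals (i 0 a) (i a t),
        ← intervalIntegral.integral_add_adjacent_intervals (i a b) (i b t), e1, e2, htot]
      simp
  have htsupp : tsupport (fun t => ∫ s in 0..t, η s) ⊆ Icc a b :=
    closure_minimal hsupp isClosed_Icc
  refine ⟨fun t => ∫ s in 0..t, η s, ⟨?_, ?_, ?_⟩, hd⟩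
  · rw [contDiff_infty_iff_deriv, hd]
    exact ⟨fun t => (hc.integral_hasStrictDerivAt 0 t).hasDerivAt.differentiableAt, h.smooth⟩
  · exact isCompact_Icc.of_isClosed_subset (isClosed_tsupport _) htsupp
  · exact htsupp.trans fun x hx => ⟨ha.trans_le hx.1, hx.2.trans_lt hb⟩

variable {E : Type*} [NormedAddCommGroup E] [NormedSpace ℝ E]

theorem IsTest.integrable_smul {θ : ℝ → ℝ} {U : Set ℝ} (h : IsTest U θ) {F : ℝ → E}
    (hF : IntegrableOn F (Ioo 0 T)) : IntegrableOn (fun t => θ t • F t) (Ioo 0 T) := by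
  obtain ⟨C, hC⟩ := h.compact.exists_bound_of_continuous h.smooth.continuous
  exact Integrable.bdd_smul hF C h.smooth.continuous.aestronglyMeasurable
    (Eventually.of_forall hC)

theorem IsTest.deriv {θ : ℝ → ℝ} {U : Set ℝ} (h : IsTest U θ) : IsTest U (deriv θ) where
  smooth := (contDiff_infty_iff_deriv.1 h.smooth).2
  compact := h.compact.deriv
  subset := (closure_minimal support_deriv_subset (isClosed_tsupport _)).trans h.subset

/-- A primitive of an integrable function is absolutely continuous, which suffices for integration
by parts; the boundary terms vanish with `θ`. The vector-valued version follows by testing with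
functionals. -/
theorem integral_deriv_mul_of_eq_primitive (hT : 0 ≤ T) {x G : ℝ → ℝ} {c : ℝ}
    (hG : IntegrableOn G (Ioo 0 T)) (hx : ∀ t ∈ Ioo 0 T, x t = c + ∫ s in 0..t, G s)
    {θ : ℝ → ℝ} (hθ : IsTest (Ioo 0 T) θ) :
    ∫ t in Ioo 0 T, _root_.deriv θ t * x t = -∫ t in Ioo 0 T, θ t * G t := by
  have hG' : IntervalIntegrable G volume 0 T := by
    rwa [intervalIntegrable_iff_integrableOn_Ioo_of_le hT]
  have h1 : AbsolutelyContinuousOnInterval θ 0 T :=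
    (hθ.smooth.contDiffOn.of_le (by simp)).absolutelyContinuousOnInterval
  have h2 : AbsolutelyContinuousOnInterval (fun t => c + ∫ s in 0..t, G s) 0 T := by
    refine AbsolutelyContinuousOnInterval.add ?_
      (hG'.absolutelyContinuousOnInterval_intervalIntegral left_mem_uIcc)
    exact (contDiff_const (c := c) (n := 1)).contDiffOn.absolutelyContinuousOnInterval
  have key := h1.integral_mul_deriv_eq_deriv_mul h2
  rw [hθ.eq_zero_of_notMem (x := T) (by simp), hθ.eq_zero_of_notMem (x := 0) (by simp)] at key
  have e1 : ∫ t in 0..T, θ t * _root_.deriv (fun t => c + ∫ s in 0..t, G s) t =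
      ∫ t in Ioo 0 T, θ t * G t := by
    rw [intervalIntegral.integral_of_le hT, integral_Ioc_eq_integral_Ioo]
    refine integral_congr_ae ?_
    filter_upwards [ae_restrict_of_ae (hG'.ae_hasDerivAt_integral),
      ae_restrict_mem measurableSet_Ioo] with t ht htT
    rw [((ht (by rw [uIcc_of_le hT]; exact Ioo_subset_Icc_self htT) 0
      left_mem_uIcc).const_add c).deriv]
  have e2 : ∫ t in 0..T, _root_.deriv θ t * (c + ∫ s in 0..t, G s) =
      ∫ t in Ioo 0 T, _root_.deriv θ t * x t := by
    rw [intervalIntegral.integral_of_le hT, integral_Ioc_eq_integral_Ioo]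
    refine setIntegral_congr_fun measurableSet_Ioo fun t ht => ?_
    simp only [hx t ht]
  rw [e1, e2] at key
  linarith

variable [CompleteSpace E]

theorem integral_deriv_smul_of_eq_primitive (hT : 0 ≤ T) {x G : ℝ → E} {c : E}
    (hG : IntegrableOn G (Ioo 0 T)) (hx : ∀ t ∈ Ioo 0 T, x t = c + ∫ s in 0..t, G s)
    {θ : ℝ → ℝ} (hθ : IsTest (Ioo 0 T) θ) :
    ∫ t in Ioo 0 T, _root_.deriv θ t • x t = -∫ t in Ioo 0 T, θ t • G t := by
  have hG' : IntervalIntegrable G volume 0 T := by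
    rwa [intervalIntegrable_iff_integrableOn_Ioo_of_le hT]
  have hxi : IntegrableOn x (Ioo 0 T) := by
    have hc : ContinuousOn (fun t => c + ∫ s in 0..t, G s) (Icc 0 T) := by
      have := intervalIntegral.continuousOn_primitive_interval' hG' left_mem_uIcc
      rw [uIcc_of_le hT] at this
      exact continuousOn_const.add this
    refine (hc.integrableOn_Icc.mono_set Ioo_subset_Icc_self).congr_fun (fun t ht => (hx t ht).symm)
      measurableSet_Ioo
  refine (SeparatingDual.eq_iff_forall_dual_eq (R := ℝ)).2 fun g => ?_
  rw [map_neg, ← g.integral_comp_comm (hθ.integrable_smul hG),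
    ← g.integral_comp_comm (hθ.deriv.integrable_smul hxi)]
  simp only [map_smul, smul_eq_mul]
  refine integral_deriv_mul_of_eq_primitive hT (x := fun t => g (x t)) (G := fun t => g (G t))
    (c := g c) (g.integrable_comp hG) (fun t ht => ?_) hθ
  have hsub : uIcc 0 t ⊆ uIcc 0 T := by
    rw [uIcc_of_le hT, uIcc_of_le ht.1.le]; exact Icc_subset_Icc_right ht.2.le
  rw [hx t ht, map_add, g.intervalIntegral_comp_comm (hG'.mono_set hsub)]

/-- The lemma of du Bois-Reymond. -/
theorem exists_eq_primitive_of_integral_deriv (hT : 0 < T) {F G : ℝ → E}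
    (hF : IntegrableOn F (Ioo 0 T)) (hG : IntegrableOn G (Ioo 0 T))
    (h : ∀ θ : ℝ → ℝ, IsTest (Ioo 0 T) θ →
      ∫ t in Ioo 0 T, _root_.deriv θ t • F t = -∫ t in Ioo 0 T, θ t • G t) :
    ∃ c, ∀ᵐ t ∂volume.restrict (Ioo 0 T), F t = c + ∫ s in 0..t, G s := by
  have hG' : IntervalIntegrable G volume 0 T := by
    rwa [intervalIntegrable_iff_integrableOn_Ioo_of_le hT.le]
  have hP : IntegrableOn (fun t => ∫ s in 0..t, G s) (Ioo 0 T) := by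
    have := intervalIntegral.continuousOn_primitive_interval' hG' left_mem_uIcc
    rw [uIcc_of_le hT.le] at this
    exact this.integrableOn_Icc.mono_set Ioo_subset_Icc_self
  set R : ℝ → E := fun t => F t - ∫ s in 0..t, G s with hR
  have hRi : IntegrableOn R (Ioo 0 T) := hF.sub hP
  have hR0 : ∀ θ : ℝ → ℝ, IsTest (Ioo 0 T) θ → ∫ t in Ioo 0 T, _root_.deriv θ t • R t = 0 := by
    intro θ hθ
    simp only [hR, smul_sub]
    rw [integral_sub (hθ.deriv.integrable_smul hF) (hθ.deriv.integrable_smul hP), h θ hθ,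
      integral_deriv_smul_of_eq_primitive hT.le hG (c := 0) (fun t _ => (zero_add _).symm) hθ,
      sub_self]
  -- Let `χ` be a fixed test function of integral one. Any test function `ψ` is `(∫ ψ) χ` plus one
  -- of integral zero; the latter is a derivative, hence annihilated by `R`. So `R` acts as the
  -- constant `∫ χ R`.
  let f : ContDiffBump (T / 2) := ⟨T / 8, T / 4, by positivity, by linarith⟩
  set χ : ℝ → ℝ := f.normed volume with hχd
  have hχ : IsTest (Ioo 0 T) χ := by
    refine ⟨f.contDiff_normed, f.hasCompactSupport_normed, ?_⟩
    rw [f.tsupport_normed_eq, Real.closedBall_eq_Icc]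
    intro x hx
    have h1 := hx.1
    have h2 := hx.2
    simp only [f] at h1 h2
    exact ⟨by linarith, by linarith⟩
  have hχ1 : ∫ t, χ t = 1 := f.integral_normed
  have hi : ∀ ψ : ℝ → ℝ, IsTest (Ioo 0 T) ψ → Integrable ψ := fun ψ hψ =>
    hψ.smooth.continuous.integrable_of_hasCompactSupport hψ.compact
  refine ⟨∫ t in Ioo 0 T, χ t • R t, ?_⟩
  set c := ∫ t in Ioo 0 T, χ t • R t with hc
  have key : ∀ᵐ t ∂(volume : Measure ℝ), t ∈ Ioo 0 T → R t - c = 0 := by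
    refine isOpen_Ioo.ae_eq_zero_of_integral_contDiff_smul_eq_zero
      (hRi.sub (integrableOn_const (by simp))).locallyIntegrableOn fun ψ h1 h2 h3 => ?_
    have hψ : IsTest (Ioo 0 T) ψ := ⟨h1, h2, h3⟩
    have hη : IsTest (Ioo 0 T) (fun t => ψ t - (∫ s, ψ s) * χ t) := by
      refine ⟨h1.sub (contDiff_const.mul hχ.smooth), h2.sub (hχ.compact.mul_left), ?_⟩
      refine (tsupport_sub _ _).trans (union_subset h3 ?_)
      exact (tsupport_mul_subset_right (f := fun _ => ∫ s, ψ s)).trans hχ.subset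
    obtain ⟨θ, hθ, hθ'⟩ := hη.exists_deriv_eq hT (by
      rw [integral_sub (hi _ hψ) ((hi _ hχ).const_mul _), integral_const_mul, hχ1]
      ring)
    have h4 := hR0 θ hθ
    rw [hθ'] at h4
    simp only [sub_smul, mul_smul] at h4
    rw [integral_sub (hψ.integrable_smul hRi) (by exact (hχ.integrable_smul hRi).smul (∫ s, ψ s)),
      integral_smul, ← hc, sub_eq_zero] at h4
    have h5 : ∫ t, ψ t • (R t - c) = ∫ t in Ioo 0 T, ψ t • (R t - c) :=
      (setIntegral_eq_integral_of_forall_compl_eq_zero fun t ht => by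
        rw [hψ.eq_zero_of_notMem ht, zero_smul]).symm
    rw [h5]
    simp only [smul_sub]
    rw [integral_sub (hψ.integrable_smul hRi) ((hi _ hψ).integrableOn.smul_const c), h4,
      integral_smul_const, setIntegral_eq_integral_of_forall_compl_eq_zero fun t ht =>
        hψ.eq_zero_of_notMem ht, sub_self]
  rw [ae_restrict_iff' measurableSet_Ioo]
  filter_upwards [key] with t ht htT
  rw [← sub_eq_zero.1 (ht htT)]
  simp [hR]

end TimeDistribution

/-! ### The space `H¹₀(Ω)` -/

section Sobolev

variable {n : ℕ} {Ω : Set (Space n)}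

theorem H10_inner_eq (u w : H10 Ω) :
    inner ℝ u w = inner ℝ (toL2 Ω u) (toL2 Ω w) + inner ℝ (grad Ω u) (grad Ω w) :=
  WithLp.prod_inner_apply _ _

theorem H10_norm_sq_eq (u : H10 Ω) : ‖u‖ ^ 2 = ‖toL2 Ω u‖ ^ 2 + ‖grad Ω u‖ ^ 2 := by
  rw [← real_inner_self_eq_norm_sq, H10_inner_eq, real_inner_self_eq_norm_sq,
    real_inner_self_eq_norm_sq]

theorem norm_grad_le (u : H10 Ω) : ‖grad Ω u‖ ≤ ‖u‖ :=
  le_of_sq_le_sq (by nlinarith [H10_norm_sq_eq u, sq_nonneg ‖toL2 Ω u‖]) (norm_nonneg _)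

/-- `u ∈ H¹₀(Ω)` is (the class of) the test function `φ`. -/
structure IsClassOf (u : H10 Ω) (φ : Space n → ℝ) : Prop where
  isTest : IsTest Ω φ
  toL2_eq : toL2 Ω u =ᵐ[volume.restrict Ω] φ
  grad_eq : grad Ω u =ᵐ[volume.restrict Ω] gradient φ

theorem IsTest.continuous_gradient {φ : Space n → ℝ} (h : IsTest Ω φ) :
    Continuous (gradient φ) :=
  (InnerProductSpace.toDual ℝ (Space n)).symm.continuous.comp
    (h.smooth.continuous_fderiv (by simp))

theorem IsTest.hasCompactSupport_gradient {φ : Space n → ℝ} (h : IsTest Ω φ) :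
    HasCompactSupport (gradient φ) :=
  (HasCompactSupport.fderiv (𝕜 := ℝ) h.compact).comp_left (map_zero _)

theorem IsTest.exists_isClassOf {φ : Space n → ℝ} (h : IsTest Ω φ) :
    ∃ u : H10 Ω, IsClassOf u φ := by
  have m1 : MemLp φ 2 (volume.restrict Ω) :=
    h.smooth.continuous.memLp_of_hasCompactSupport h.compact
  have m2 : MemLp (gradient φ) 2 (volume.restrict Ω) :=
    h.continuous_gradient.memLp_of_hasCompactSupport h.hasCompactSupport_gradient
  refine ⟨⟨WithLp.toLp 2 (m1.toLp, m2.toLp),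
    Submodule.le_topologicalClosure _ ⟨φ, h, m1.coeFn_toLp, m2.coeFn_toLp⟩⟩, h, ?_, ?_⟩
  · exact m1.coeFn_toLp
  · exact m2.coeFn_toLp

theorem H10_induction {P : H10 Ω → Prop} (hP : IsClosed {u | P u})
    (h : ∀ u φ, IsClassOf u φ → P u) (u : H10 Ω) : P u := by
  obtain ⟨x, hx, hxu⟩ := mem_closure_iff_seq_limit.1 u.2
  have hx' : Tendsto (fun k => (⟨x k, Submodule.le_topologicalClosure _ (hx k)⟩ : H10 Ω)) atTop
      (𝓝 u) := tendsto_subtype_rng.2 hxu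
  refine hP.mem_of_tendsto hx' (Eventually.of_forall fun k => ?_)
  obtain ⟨φ, h1, h2, h3⟩ := hx k
  exact h _ φ ⟨h1, h2, h3⟩

theorem setIntegral_eq_of_isTest {φ f : Space n → ℝ} (h : IsTest Ω φ) :
    ∫ x in Ω, φ x * f x = ∫ x, φ x * f x :=
  setIntegral_eq_integral_of_forall_compl_eq_zero fun x hx => by
    rw [h.eq_zero_of_notMem hx, zero_mul]

/-- Integration by parts holds when `u` is a test function, and both sides are continuous in `u`. It
shows that the second component of an element of `H10 Ω` is the weak gradient of the first. -/
theorem integral_fderiv_mul_toL2 {ψ : Space n → ℝ} (hψ : IsTest Ω ψ) (e : Space n) (u : H10 Ω) :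
    ∫ x in Ω, ψ x * inner ℝ e (grad Ω u x) = -∫ x in Ω, fderiv ℝ ψ x e * toL2 Ω u x := by
  have c1 : Continuous fun x => ψ x • e := hψ.smooth.continuous.smul continuous_const
  have c2 : Continuous fun x => fderiv ℝ ψ x e :=
    (hψ.smooth.continuous_fderiv (by simp)).clm_apply continuous_const
  have s2 : HasCompactSupport fun x => fderiv ℝ ψ x e := hψ.compact.fderiv_apply ℝ e
  have m1 : MemLp (fun x => ψ x • e) 2 (volume.restrict Ω) :=
    c1.memLp_of_hasCompactSupport hψ.compact.smul_right
  have m2 : MemLp (fun x => fderiv ℝ ψ x e) 2 (volume.restrict Ω) :=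
    c2.memLp_of_hasCompactSupport s2
  have e1 : ∀ u : H10 Ω, inner ℝ m1.toLp (grad Ω u) =
      ∫ x in Ω, ψ x * inner ℝ e (grad Ω u x) := fun u => by
    rw [MeasureTheory.L2.inner_def]
    refine integral_congr_ae ?_
    filter_upwards [m1.coeFn_toLp] with x hx
    rw [hx, real_inner_smul_left]
  have e2 : ∀ u : H10 Ω, inner ℝ m2.toLp (toL2 Ω u) =
      ∫ x in Ω, fderiv ℝ ψ x e * toL2 Ω u x := fun u => by
    rw [MeasureTheory.L2.inner_def]
    refine integral_congr_ae ?_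
    filter_upwards [m2.coeFn_toLp] with x hx
    rw [hx, real_inner_comm]
    simp
  rw [← e1, ← e2]
  revert u
  refine H10_induction (isClosed_eq (by fun_prop) (by fun_prop)) fun u φ hu => ?_
  rw [e1, e2]
  have hφ := hu.isTest
  have i1 : ∫ x in Ω, ψ x * inner ℝ e (grad Ω u x) = ∫ x, ψ x * fderiv ℝ φ x e := by
    rw [← setIntegral_eq_of_isTest hψ]
    refine integral_congr_ae ?_
    filter_upwards [hu.grad_eq] with x hx
    rw [hx, gradient, real_inner_comm, InnerProductSpace.toDual_symm_apply]
  have i2 : ∫ x in Ω, fderiv ℝ ψ x e * toL2 Ω u x = ∫ x, fderiv ℝ ψ x e * φ x := by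
    have : ∫ x, fderiv ℝ ψ x e * φ x = ∫ x in Ω, fderiv ℝ ψ x e * φ x :=
      (setIntegral_eq_integral_of_forall_compl_eq_zero fun x hx => by
        rw [hφ.eq_zero_of_notMem hx, mul_zero]).symm
    rw [this]
    refine integral_congr_ae ?_
    filter_upwards [hu.toL2_eq] with x hx
    rw [hx]
  rw [i1, i2]
  have c3 : Continuous fun x => fderiv ℝ φ x e :=
    (hφ.smooth.continuous_fderiv (by simp)).clm_apply continuous_const
  refine integral_mul_fderiv_eq_neg_fderiv_mul_of_integrable ?_ ?_ ?_ ?_ ?_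
  · exact (c2.mul hφ.smooth.continuous).integrable_of_hasCompactSupport s2.mul_right
  · exact (hψ.smooth.continuous.mul c3).integrable_of_hasCompactSupport hψ.compact.mul_right
  · exact (hψ.smooth.continuous.mul hφ.smooth.continuous).integrable_of_hasCompactSupport
      hψ.compact.mul_right
  · exact fun x _ => hψ.smooth.differentiable (by simp) x
  · exact fun x _ => hφ.smooth.differentiable (by simp) x

theorem Lp_ae_eq_zero_of_integral_isTest {E : Type*} [NormedAddCommGroup E] [NormedSpace ℝ E]
    [CompleteSpace E] (hΩ : IsOpen Ω) {f : Space n → E} (hf : MemLp f 2 (volume.restrict Ω))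
    (h : ∀ ψ, IsTest Ω ψ → ∫ x in Ω, ψ x • f x = 0) : f =ᵐ[volume.restrict Ω] 0 := by
  refine (ae_restrict_iff' hΩ.measurableSet).2 ?_
  refine hΩ.ae_eq_zero_of_integral_contDiff_smul_eq_zero
    (locallyIntegrableOn_of_locallyIntegrable_restrict (hf.locallyIntegrable (by norm_num)))
    fun ψ h1 h2 h3 => ?_
  rw [← h ψ ⟨h1, h2, h3⟩]
  refine (setIntegral_eq_integral_of_forall_compl_eq_zero fun x hx => ?_).symm
  rw [IsTest.eq_zero_of_notMem ⟨h1, h2, h3⟩ hx, zero_smul]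

/-- Elements of `H10 Ω` are pairs in a closure, so this needs proof: a limit pair `(0, g)` must have
`g = 0`, that is, the gradient is closable. Integration by parts gives it. -/
theorem toL2_injective (hΩ : IsOpen Ω) : Function.Injective (toL2 Ω) := by
  refine (injective_iff_map_eq_zero _).2 fun u hu => ?_
  have key : ∀ i, ∀ᵐ x ∂volume.restrict Ω, inner ℝ (EuclideanSpace.single i (1 : ℝ))
      (grad Ω u x) = 0 := fun i => by
    refine Lp_ae_eq_zero_of_integral_isTest hΩ
      ((Lp.memLp (grad Ω u)).const_inner (𝕜 := ℝ) (EuclideanSpace.single i (1 : ℝ)))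
      fun ψ hψ => ?_
    simp only [smul_eq_mul]
    rw [integral_fderiv_mul_toL2 hψ, neg_eq_zero]
    refine integral_eq_zero_of_ae ?_
    rw [hu]
    filter_upwards [Lp.coeFn_zero ℝ 2 (volume.restrict Ω)] with x hx
    rw [hx]
    simp
  have hg : grad Ω u = 0 := by
    refine (Lp.eq_zero_iff_ae_eq_zero).2 ?_
    filter_upwards [ae_all_iff.2 key] with x hx
    ext i
    have := hx i
    rw [EuclideanSpace.inner_single_left] at this
    simpa using this
  rw [← norm_eq_zero, ← sq_eq_zero_iff, H10_norm_sq_eq, hu, hg]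
  simp

/-- A function orthogonal to the range is orthogonal to all test functions, hence zero. -/
theorem denseRange_toL2 (hΩ : IsOpen Ω) : DenseRange (toL2 Ω) := by
  have : Dense ((LinearMap.range (toL2 Ω : H10 Ω →ₗ[ℝ] L2 Ω) : Submodule ℝ (L2 Ω)) : Set (L2 Ω)) := by
    rw [Submodule.dense_iff_topologicalClosure_eq_top, Submodule.topologicalClosure_eq_top_iff,
      Submodule.eq_bot_iff]
    intro h hh
    refine (Lp.eq_zero_iff_ae_eq_zero).2 ?_
    refine Lp_ae_eq_zero_of_integral_isTest hΩ (Lp.memLp h) fun ψ hψ => ?_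
    obtain ⟨u, hu⟩ := hψ.exists_isClassOf
    have := hh (toL2 Ω u) ⟨u, rfl⟩
    rw [MeasureTheory.L2.inner_def] at this
    rw [← this]
    refine integral_congr_ae ?_
    filter_upwards [hu.toL2_eq] with x hx
    rw [hx]
    simp [mul_comm]
  exact this

end Sobolev

theorem exists_ae_norm_le_of_memLp_top {α E : Type*} [MeasurableSpace α] [NormedAddCommGroup E]
    {μ : Measure α} {g : α → E} (hg : MemLp g ∞ μ) : ∃ C, 0 ≤ C ∧ ∀ᵐ x ∂μ, ‖g x‖ ≤ C := by
  have h := hg.eLpNorm_lt_top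
  rw [eLpNorm_exponent_top] at h
  refine ⟨(eLpNormEssSup g μ).toReal, ENNReal.toReal_nonneg, ?_⟩
  filter_upwards [ae_le_eLpNormEssSup (f := g) (μ := μ)] with x hx
  have := ENNReal.toReal_mono h.ne hx
  simpa using this

theorem eqOn_Icc_of_ae_eq_Ioo {E : Type*} [TopologicalSpace E] [T2Space E] {T : ℝ} (hT : 0 < T)
    {f g : ℝ → E} (hf : ContinuousOn f (Icc 0 T)) (hg : ContinuousOn g (Icc 0 T))
    (h : f =ᵐ[volume.restrict (Ioo 0 T)] g) : EqOn f g (Icc 0 T) := by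
  refine Measure.eqOn_Icc_of_ae_eq volume hT.ne ?_ hf hg
  rwa [← restrict_Ioo_eq_restrict_Icc]

/-! ### The form `b` as a coercive operator, Lipschitz in time -/

section FormOperator

variable {n : ℕ} {Ω : Set (Space n)}

/-- Multiplication of `L²` vector fields by a bounded function. -/
def mulOp : Lp ℝ ∞ (volume.restrict Ω) →L[ℝ] L2Vec Ω →L[ℝ] L2Vec Ω :=
  (ContinuousLinearMap.lsmul ℝ ℝ).holderL (volume.restrict Ω) ∞ 2 2

theorem mulOp_apply_ae (g : Lp ℝ ∞ (volume.restrict Ω)) (f : L2Vec Ω) :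
    mulOp g f =ᵐ[volume.restrict Ω] fun x => g x • f x :=
  ContinuousLinearMap.coeFn_holder (r := 2) (ContinuousLinearMap.lsmul ℝ ℝ) g f

/-- The operator on `H¹₀(Ω)` that represents `∫ g ∇u · ∇w + ∫ u w`. -/
def formOp (g : Lp ℝ ∞ (volume.restrict Ω)) : H10 Ω →L[ℝ] H10 Ω :=
  (grad Ω).adjoint ∘L mulOp g ∘L grad Ω + (toL2 Ω).adjoint ∘L toL2 Ω

theorem norm_adjoint_comp_comp_add_le {V W : Type*} [NormedAddCommGroup V] [InnerProductSpace ℝ V]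
    [CompleteSpace V] [NormedAddCommGroup W] [InnerProductSpace ℝ W] [CompleteSpace W]
    (A : V →L[ℝ] W) (m : W →L[ℝ] W) (B : V →L[ℝ] V) :
    ‖A.adjoint ∘L m ∘L A + B‖ ≤ ‖A.adjoint‖ * (‖m‖ * ‖A‖) + ‖B‖ :=
  (norm_add_le _ _).trans (add_le_add_left ((ContinuousLinearMap.opNorm_comp_le _ _).trans
    (mul_le_mul_of_nonneg_left (ContinuousLinearMap.opNorm_comp_le _ _) (norm_nonneg _))) _)

theorem exists_norm_formOp_le (K : ℝ) :
    ∃ M, ∀ g : Lp ℝ ∞ (volume.restrict Ω), ‖g‖ ≤ K → ‖formOp g‖ ≤ M := by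
  refine ⟨‖(grad Ω).adjoint‖ * (‖mulOp (Ω := Ω)‖ * K * ‖grad Ω‖) +
    ‖(toL2 Ω).adjoint ∘L toL2 Ω‖, fun g hg => ?_⟩
  refine (norm_adjoint_comp_comp_add_le _ _ _).trans ?_
  gcongr
  exact (mulOp.le_opNorm g).trans (by gcongr)

theorem inner_mulOp (g : Lp ℝ ∞ (volume.restrict Ω)) (f f' : L2Vec Ω) :
    inner ℝ (mulOp g f) f' = ∫ x in Ω, g x * inner ℝ (f x) (f' x) := by
  rw [MeasureTheory.L2.inner_def]
  refine integral_congr_ae ?_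
  filter_upwards [mulOp_apply_ae g f] with x hx
  rw [hx, real_inner_smul_left]

theorem inner_formOp (g : Lp ℝ ∞ (volume.restrict Ω)) (u w : H10 Ω) :
    inner ℝ (formOp g u) w =
      (∫ x in Ω, g x * inner ℝ (grad Ω u x) (grad Ω w x)) + inner ℝ (toL2 Ω u) (toL2 Ω w) := by
  rw [← inner_mulOp, ← ContinuousLinearMap.adjoint_inner_left,
    ← ContinuousLinearMap.adjoint_inner_left, ← inner_add_left]
  rfl

theorem formOp_symm (g : Lp ℝ ∞ (volume.restrict Ω)) (u w : H10 Ω) :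
    inner ℝ (formOp g u) w = inner ℝ u (formOp g w) := by
  rw [← real_inner_comm u, inner_formOp, inner_formOp, real_inner_comm (toL2 Ω u)]
  congr 1
  refine integral_congr_ae (Eventually.of_forall fun x => ?_)
  simp only
  rw [real_inner_comm]

/-- The added `L²` product supplies the part of the `H¹` norm that `∫ g |∇u|²` does not see, so no
Poincaré inequality is needed. Its coefficient is one, whence `c ≤ 1`. -/
theorem formOp_coercive {g : Lp ℝ ∞ (volume.restrict Ω)} {c : ℝ} (hc1 : c ≤ 1)
    (hc : ∀ᵐ x ∂volume.restrict Ω, c ≤ g x) (u : H10 Ω) :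
    c * ‖u‖ ^ 2 ≤ inner ℝ (formOp g u) u := by
  have h1 : c * ‖grad Ω u‖ ^ 2 ≤ inner ℝ (mulOp g (grad Ω u)) (grad Ω u) := by
    rw [← real_inner_self_eq_norm_sq, ← real_inner_smul_left, MeasureTheory.L2.inner_def,
      MeasureTheory.L2.inner_def]
    refine integral_mono_ae (MeasureTheory.L2.integrable_inner _ _)
      (MeasureTheory.L2.integrable_inner _ _) ?_
    filter_upwards [mulOp_apply_ae g (grad Ω u), Lp.coeFn_smul c (grad Ω u), hc] with x h2 h3 h4
    rw [h2, h3, Pi.smul_apply, real_inner_smul_left, real_inner_smul_left]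
    exact mul_le_mul_of_nonneg_right h4 real_inner_self_nonneg
  rw [inner_formOp, ← inner_mulOp, H10_norm_sq_eq, real_inner_self_eq_norm_sq]
  nlinarith [sq_nonneg ‖toL2 Ω u‖]

theorem integral_abs_inner_le (f f' : L2Vec Ω) :
    ∫ x in Ω, |inner ℝ (f x) (f' x)| ≤ ‖f‖ * ‖f'‖ := by
  have m := (Lp.memLp f).norm
  have m' := (Lp.memLp f').norm
  have e : ‖f‖ = ‖m.toLp‖ := by rw [Lp.norm_toLp, eLpNorm_norm, Lp.norm_def]
  have e' : ‖f'‖ = ‖m'.toLp‖ := by rw [Lp.norm_toLp, eLpNorm_norm, Lp.norm_def]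
  rw [e, e']
  refine le_trans ?_ (real_inner_le_norm _ _)
  rw [MeasureTheory.L2.inner_def]
  refine integral_mono_ae (MeasureTheory.L2.integrable_inner f f').abs
    (MeasureTheory.L2.integrable_inner _ _) ?_
  filter_upwards [m.coeFn_toLp, m'.coeFn_toLp] with x h1 h2
  rw [h1, h2]
  refine (abs_real_inner_le_norm _ _).trans (le_of_eq ?_)
  simp [mul_comm]

theorem IsTest.prod {T : ℝ} {θ : ℝ → ℝ} {ψ : Space n → ℝ} (hθ : IsTest (Ioo 0 T) θ)
    (hψ : IsTest Ω ψ) : IsTest (Ioo 0 T ×ˢ Ω) fun p : ℝ × Space n => θ p.1 * ψ p.2 := by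
  have hs : tsupport (fun p : ℝ × Space n => θ p.1 * ψ p.2) ⊆ tsupport θ ×ˢ tsupport ψ := by
    refine closure_minimal (fun p hp => ?_) ((isClosed_tsupport _).prod (isClosed_tsupport _))
    have := Function.mem_support.1 hp
    exact ⟨subset_tsupport _ (left_ne_zero_of_mul this),
      subset_tsupport _ (right_ne_zero_of_mul this)⟩
  exact ⟨(hθ.smooth.comp contDiff_fst).mul (hψ.smooth.comp contDiff_snd),
    (IsCompact.prod hθ.compact hψ.compact).of_isClosed_subset (isClosed_tsupport _) hs,
    hs.trans (prod_mono hθ.subset hψ.subset)⟩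

theorem IsTest.inner_gradient {φ φ' : Space n → ℝ} (h : IsTest Ω φ) (h' : IsTest Ω φ') :
    IsTest Ω fun x => inner ℝ (gradient φ x) (gradient φ' x) := by
  have s : ∀ {φ : Space n → ℝ}, IsTest Ω φ → ContDiff ℝ ∞ (gradient φ) := fun h =>
    (InnerProductSpace.toDual ℝ (Space n)).symm.contDiff.comp
      (h.smooth.fderiv_right (m := ∞) (by simp))
  have hs : tsupport (fun x => inner ℝ (gradient φ x) (gradient φ' x)) ⊆ tsupport φ := by
    refine closure_minimal (fun x hx => ?_) (isClosed_tsupport _)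
    refine support_fderiv_subset ℝ fun h0 => hx ?_
    simp only [gradient]
    rw [h0, map_zero, inner_zero_left]
  exact ⟨(s h).inner ℝ (s h'), IsCompact.of_isClosed_subset h.compact (isClosed_tsupport _) hs,
    hs.trans h.subset⟩

/-- Weighted integrals `t ↦ ∫ γ(t, x) ψ(x) dx` are Lipschitz in time. -/
theorem abs_integral_mul_sub_le {T : ℝ} (hT : 0 < T) {γ : ℝ → Space n → ℝ}
    {g : ℝ × Space n → ℝ} (hgm : AEStronglyMeasurable g (volume.restrict (Ioo 0 T ×ˢ Ω))) {C : ℝ}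
    (hC : ∀ᵐ p ∂volume.restrict (Ioo 0 T ×ˢ Ω), ‖g p‖ ≤ C)
    (h : ∀ φ : ℝ × Space n → ℝ, IsTest (Ioo 0 T ×ˢ Ω) φ →
      ∫ t in Ioo 0 T, ∫ x in Ω, γ t x * deriv (fun s => φ (s, x)) t =
        -∫ p in Ioo 0 T ×ˢ Ω, g p * φ p)
    {ψ : Space n → ℝ} (hψ : IsTest Ω ψ)
    (hc : ContinuousOn (fun t => ∫ x in Ω, γ t x * ψ x) (Icc 0 T)) {s t : ℝ} (hs : s ∈ Icc 0 T)
    (ht : t ∈ Icc 0 T) :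
    |(∫ x in Ω, γ s x * ψ x) - ∫ x in Ω, γ t x * ψ x| ≤ C * (∫ x in Ω, |ψ x|) * |s - t| := by
  set μ : Measure ℝ := volume.restrict (Ioo 0 T)
  set ν : Measure (Space n) := volume.restrict Ω
  have hμν : volume.restrict (Ioo 0 T ×ˢ Ω) = μ.prod ν := by
    rw [Measure.volume_eq_prod, Measure.prod_restrict]
  rw [hμν] at hgm hC
  have hψi : Integrable ψ ν :=
    (hψ.smooth.continuous.integrable_of_hasCompactSupport hψ.compact).integrableOn
  have hi : Integrable (fun p : ℝ × Space n => g p * ψ p.2) (μ.prod ν) :=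
    (hψi.comp_snd μ).bdd_mul hgm hC
  set N : ℝ → ℝ := fun t => ∫ x in Ω, g (t, x) * ψ x with hN
  have hNi : IntegrableOn N (Ioo 0 T) := hi.integral_prod_left
  have hNb : ∀ᵐ t ∂μ, ‖N t‖ ≤ C * ∫ x in Ω, |ψ x| := by
    filter_upwards [Measure.ae_ae_of_ae_prod hC] with t ht
    rw [← integral_const_mul]
    refine norm_integral_le_of_norm_le (hψi.abs.const_mul C) ?_
    filter_upwards [ht] with x hx
    rw [norm_mul, Real.norm_eq_abs (ψ x)]
    exact mul_le_mul_of_nonneg_right hx (abs_nonneg _)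
  have hmi : IntegrableOn (fun t => ∫ x in Ω, γ t x * ψ x) (Ioo 0 T) :=
    hc.integrableOn_Icc.mono_set Ioo_subset_Icc_self
  -- Product test functions `θ(t) ψ(x)` show that `N` is the weak derivative of the weighted
  -- integral. As `N` is bounded by `C ∫ |ψ|`, its primitive is Lipschitz, and continuity extends
  -- the almost everywhere identity to all of `[0, T]`.
  obtain ⟨c, hcN⟩ := exists_eq_primitive_of_integral_deriv hT hmi hNi fun θ hθ => by
    have e := h _ (hθ.prod hψ)
    have e1 : ∀ t x, γ t x * deriv (fun s => θ s * ψ x) t = deriv θ t * (γ t x * ψ x) :=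
      fun t x => by
        rw [deriv_mul_const (hθ.smooth.differentiable (by simp) t)]
        ring
    simp only [e1, integral_const_mul] at e
    simp only [smul_eq_mul]
    rw [e, hμν]
    have hi2 : Integrable (fun p : ℝ × Space n => g p * (θ p.1 * ψ p.2)) (μ.prod ν) :=
      Integrable.bdd_mul ((((hθ.smooth.continuous.integrable_of_hasCompactSupport
        hθ.compact).integrableOn (s := Ioo 0 T)).mul_prod hψi)) hgm hC
    rw [integral_prod _ hi2]
    congr 1
    refine integral_congr_ae (Eventually.of_forall fun t => ?_)
    simp only [hN]
    rw [← integral_const_mul]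
    refine integral_congr_ae (Eventually.of_forall fun x => ?_)
    simp only
    ring
  have hN' : IntervalIntegrable N volume 0 T := by
    rwa [intervalIntegrable_iff_integrableOn_Ioo_of_le hT.le]
  have hcP : ContinuousOn (fun t => c + ∫ s in 0..t, N s) (Icc 0 T) := by
    have := intervalIntegral.continuousOn_primitive_interval' hN' left_mem_uIcc
    rw [uIcc_of_le hT.le] at this
    exact continuousOn_const.add this
  have heq := eqOn_Icc_of_ae_eq_Ioo hT hc hcP hcN
  have hNt : ∀ t ∈ Icc 0 T, IntervalIntegrable N volume 0 t := fun t ht => hN'.mono_set (by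
    rw [uIcc_of_le hT.le, uIcc_of_le ht.1]; exact Icc_subset_Icc_right ht.2)
  have es := heq hs
  have et := heq ht
  simp only at es et
  rw [es, et, add_sub_add_left_eq_sub, intervalIntegral.integral_interval_sub_left (hNt s hs)
    (hNt t ht)]
  rw [← Real.norm_eq_abs (∫ r in t..s, N r)]
  refine intervalIntegral.norm_integral_le_of_norm_le_const_ae ?_
  have hNb' := hNb
  rw [show μ = volume.restrict (Ioc 0 T) from restrict_Ioo_eq_restrict_Ioc,
    ae_restrict_iff' measurableSet_Ioc] at hNb'
  filter_upwards [hNb'] with r hr hr'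
  exact hr ⟨(le_min ht.1 hs.1).trans_lt hr'.1, hr'.2.trans (max_le ht.2 hs.2)⟩

/-- Cauchy–Schwarz bounds `∫ |∇φ · ∇φ'|` by the `H¹` norms, density passes from test functions to
`H10 Ω`, and duality gives the operator norm. With `ψ = ∇φ · ∇φ'` the hypothesis is the Lipschitz
bound for weighted integrals. -/
theorem norm_formOp_sub_le {g g' : Lp ℝ ∞ (volume.restrict Ω)} {K : ℝ} (hK : 0 ≤ K)
    (h : ∀ φ φ', IsTest Ω φ → IsTest Ω φ' →
      |(∫ x in Ω, g x * inner ℝ (gradient φ x) (gradient φ' x)) -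
        ∫ x in Ω, g' x * inner ℝ (gradient φ x) (gradient φ' x)| ≤
        K * ∫ x in Ω, |inner ℝ (gradient φ x) (gradient φ' x)|) :
    ‖formOp g - formOp g'‖ ≤ K := by
  have key : ∀ u w : H10 Ω, |inner ℝ (formOp g u - formOp g' u) w| ≤ K * (‖u‖ * ‖w‖) := by
    intro u
    refine H10_induction (isClosed_le (by fun_prop) (by fun_prop)) fun w φ' hw => ?_
    revert u
    refine H10_induction (isClosed_le (by fun_prop) (by fun_prop)) fun u φ hu => ?_
    rw [inner_sub_left, inner_formOp, inner_formOp,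
      add_sub_add_right_eq_sub]
    have e : ∀ g : Lp ℝ ∞ (volume.restrict Ω),
        ∫ x in Ω, g x * inner ℝ (grad Ω u x) (grad Ω w x) =
          ∫ x in Ω, g x * inner ℝ (gradient φ x) (gradient φ' x) := fun g => by
      refine integral_congr_ae ?_
      filter_upwards [hu.grad_eq, hw.grad_eq] with x h1 h2
      rw [h1, h2]
    rw [e, e]
    refine (h φ φ' hu.isTest hw.isTest).trans (mul_le_mul_of_nonneg_left ?_ hK)
    have e2 : ∫ x in Ω, |inner ℝ (gradient φ x) (gradient φ' x)| =
        ∫ x in Ω, |inner ℝ (grad Ω u x) (grad Ω w x)| := by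
      refine integral_congr_ae ?_
      filter_upwards [hu.grad_eq, hw.grad_eq] with x h1 h2
      rw [h1, h2]
    rw [e2]
    exact (integral_abs_inner_le _ _).trans
      (mul_le_mul (norm_grad_le u) (norm_grad_le w) (norm_nonneg _) (norm_nonneg _))
  refine ContinuousLinearMap.opNorm_le_bound _ hK fun u => ?_
  change ‖formOp g u - formOp g' u‖ ≤ _
  set x := formOp g u - formOp g' u with hx
  rcases eq_or_ne x 0 with h0 | h0
  · rw [h0, norm_zero]; positivity
  · have h1 := key u x
    rw [← hx, real_inner_self_eq_norm_sq, abs_of_nonneg (sq_nonneg _)] at h1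
    have h2 : 0 < ‖x‖ := norm_pos_iff.2 h0
    nlinarith

/-- The assumptions on `γ` enter the proof here: the bound on `γ⁻¹` gives coercivity, that on `γ`
boundedness, and the bound on `∂ₜγ` is the Lipschitz constant. -/
theorem exists_waveForm (hΩ : IsOpen Ω) {T : ℝ} (hT : 0 < T) {γ : ℝ → Space n → ℝ}
    (hγ_pos : ∀ t ∈ Icc 0 T, ∀ᵐ x ∂volume.restrict Ω, 0 < γ t x)
    (hγ : IsContLinfty Ω T γ) (hγ_inv : IsContLinfty Ω T (fun t x => (γ t x)⁻¹))
    (hγ_deriv : HasTimeDerivLinfty Ω T γ) :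
    ∃ D : WaveForm (H10 Ω) (L2 Ω) T, D.incl = toL2 Ω ∧ ∀ t ∈ Icc 0 T, ∀ u w,
      inner ℝ (D.op t u) w = form γ t u w + inner ℝ (toL2 Ω u) (toL2 Ω w) := by
  obtain ⟨Γ, hΓ, hΓe⟩ := hγ
  obtain ⟨Γi, hΓi, hΓie⟩ := hγ_inv
  obtain ⟨g, hg, hgd⟩ := hγ_deriv
  obtain ⟨G, hG0, hG⟩ := exists_ae_norm_le_of_memLp_top hg
  obtain ⟨K, hK⟩ := isCompact_Icc.exists_bound_of_continuousOn hΓ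
  obtain ⟨M, hM⟩ := exists_norm_formOp_le (Ω := Ω) K
  obtain ⟨m, hm⟩ := isCompact_Icc.exists_bound_of_continuousOn hΓi
  have e : ∀ t ∈ Icc 0 T, ∀ ψ : Space n → ℝ,
      ∫ x in Ω, γ t x * ψ x = ∫ x in Ω, Γ t x * ψ x := fun t ht ψ => by
    refine integral_congr_ae ?_
    filter_upwards [hΓe t ht] with x hx
    rw [hx]
  refine ⟨{ incl := toL2 Ω, dense := denseRange_toL2 hΩ, inj := toL2_injective hΩ
            op := fun t => formOp (Γ t)
            symm := fun t _ => formOp_symm _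
            -- The maximum with one ensures `c ≤ 1`, as `formOp_coercive` requires.
            c := (max m 1)⁻¹
            c_pos := by positivity
            coercive := ?_
            M := max M 1
            M_pos := by positivity
            bound := fun t ht => (hM _ (hK t ht)).trans (le_max_left _ _)
            L := G
            L_nonneg := hG0
            lip := ?_ }, rfl, fun t ht u w => ?_⟩
  · intro t ht u
    refine formOp_coercive (inv_le_one_of_one_le₀ (le_max_right _ _)) ?_ u
    have hb : ∀ᵐ x ∂volume.restrict Ω, ‖Γi t x‖ ≤ ‖Γi t‖ := by
      have := ae_le_eLpNormEssSup (f := Γi t) (μ := volume.restrict Ω)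
      filter_upwards [this] with x hx
      rw [Lp.norm_def, eLpNorm_exponent_top, ← toReal_enorm]
      refine ENNReal.toReal_mono ?_ hx
      rw [← eLpNorm_exponent_top]
      exact Lp.eLpNorm_ne_top _
    filter_upwards [hΓe t ht, hΓie t ht, hγ_pos t ht, hb] with x h1 h2 h3 h4
    rw [← h1]
    rw [← h2] at h4
    refine inv_le_of_inv_le₀ h3 ?_
    exact (le_abs_self _).trans (h4.trans ((hm t ht).trans (le_max_left _ _)))
  · intro s hs t ht
    refine norm_formOp_sub_le (by positivity) fun φ φ' hφ hφ' => ?_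
    have hψ := hφ.inner_gradient hφ'
    have hc : ContinuousOn (fun t => ∫ x in Ω, γ t x *
        inner ℝ (gradient φ x) (gradient φ' x)) (Icc 0 T) := by
      obtain ⟨u, hu⟩ := hφ.exists_isClassOf
      obtain ⟨w, hw⟩ := hφ'.exists_isClassOf
      have : ContinuousOn (fun t => inner ℝ (mulOp (Γ t) (grad Ω u)) (grad Ω w)) (Icc 0 T) :=
        ContinuousOn.inner
          ((mulOp.continuous.comp_continuousOn hΓ).clm_apply continuousOn_const) continuousOn_const
      refine this.congr fun t ht => ?_
      simp only
      rw [e t ht, inner_mulOp]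
      refine integral_congr_ae ?_
      filter_upwards [hu.grad_eq, hw.grad_eq] with x h1 h2
      rw [h1, h2]
    have := abs_integral_mul_sub_le hT hg.1 hG hgd hψ hc hs ht
    rw [e s hs, e t ht] at this
    linarith
  · simp only [inner_formOp, form, e t ht]

end FormOperator

/-! ### Riesz representation, and control of sources in time -/

section Riesz

variable {V : Type*} [NormedAddCommGroup V] [InnerProductSpace ℝ V] [CompleteSpace V]

/-- The Riesz isometry from the dual of a real Hilbert space onto the space. -/
def riesz : StrongDual ℝ V →ₗᵢ[ℝ] V where
  toFun F := (InnerProductSpace.toDual ℝ V).symm F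
  map_add' := map_add _
  map_smul' c F := by simp
  norm_map' F := by simp

theorem inner_riesz (F : StrongDual ℝ V) (φ : V) : inner ℝ (riesz F) φ = F φ :=
  InnerProductSpace.toDual_symm_apply

theorem exists_Lp_riesz {α : Type*} [MeasurableSpace α] {μ : Measure α}
    (G : Lp (StrongDual ℝ V) 2 μ) :
    ∃ Q : Lp V 2 μ, Q =ᵐ[μ] (fun t => riesz (G t)) ∧ ‖Q‖ ≤ ‖G‖ :=
  ⟨riesz.toContinuousLinearMap.compLp G, riesz.toContinuousLinearMap.coeFn_compLp G,
    (riesz.toContinuousLinearMap.norm_compLp_le G).trans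
      (mul_le_of_le_one_left (norm_nonneg _) riesz.norm_toContinuousLinearMap_le)⟩

end Riesz

section LpTime

variable {E : Type*} [NormedAddCommGroup E] {T : ℝ}

/-- Averaging `c = F(t) - ∫₀ᵗ G` over `(0, T)` bounds the initial value of an element of `W` by its
norm. -/
theorem norm_le_of_ae_eq_add_primitive [NormedSpace ℝ E] (hT : 0 < T) {F G : Lp E 2 (volume.restrict (Ioo 0 T))}
    {c : E} (h : ∀ᵐ t ∂volume.restrict (Ioo 0 T), F t = c + ∫ s in 0..t, G s) :
    ‖c‖ ≤ √T / T * ‖F‖ + √T * ‖G‖ := by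
  have h1 : ∫ _ in Ioo 0 T, ‖c‖ ≤ ∫ t in Ioo 0 T, (‖F t‖ + √T * ‖G‖) := by
    refine integral_mono_ae (integrableOn_const (by simp))
      ((Lp_integrableOn F).norm.add (integrableOn_const (by simp))) ?_
    filter_upwards [h, ae_restrict_mem measurableSet_Ioo] with t ht htT
    have e : c = F t - ∫ s in 0..t, G s := by rw [ht]; abel
    have := norm_sub_le (F t) (∫ s in 0..t, G s)
    rw [← e] at this
    exact this.trans (add_le_add_right (norm_primitive_le hT.le G (Ioo_subset_Icc_self htT)) _)
  rw [integral_add (Lp_integrableOn F).norm (integrableOn_const (by simp))] at h1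
  simp only [integral_const, MeasurableSet.univ, measureReal_restrict_apply, univ_inter,
    Real.volume_real_Ioo, sub_zero, max_eq_left hT.le, smul_eq_mul] at h1
  have h2 := Lp_integral_norm_le hT.le F
  rw [div_mul_eq_mul_div, div_add' _ _ _ hT.ne', le_div_iff₀ hT]
  nlinarith

theorem exists_Lp_extension {t : ℝ} (ht : t ≤ T) (f : Lp E 2 (volume.restrict (Ioo 0 t))) :
    ∃ f' : Lp E 2 (volume.restrict (Ioo 0 T)), ‖f'‖ = ‖f‖ ∧
      f' =ᵐ[volume.restrict (Ioo 0 t)] f := by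
  have hsub : Ioo 0 t ⊆ Ioo 0 T := Ioo_subset_Ioo_right ht
  have hμ : (volume.restrict (Ioo 0 T)).restrict (Ioo 0 t) = volume.restrict (Ioo 0 t) := by
    rw [Measure.restrict_restrict measurableSet_Ioo, inter_eq_left.2 hsub]
  have m : MemLp ((Ioo 0 t).indicator f) 2 (volume.restrict (Ioo 0 T)) := by
    rw [memLp_indicator_iff_restrict measurableSet_Ioo, hμ]
    exact Lp.memLp f
  refine ⟨m.toLp, ?_, ?_⟩
  · rw [Lp.norm_toLp, eLpNorm_indicator_eq_eLpNorm_restrict measurableSet_Ioo, hμ, Lp.norm_def]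
  · have h1 : m.toLp =ᵐ[volume.restrict (Ioo 0 t)] (Ioo 0 t).indicator f := by
      have := m.coeFn_toLp
      exact (Measure.absolutelyContinuous_of_le (Measure.restrict_mono hsub le_rfl)).ae_le this
    filter_upwards [h1, ae_restrict_mem measurableSet_Ioo] with s hs hs'
    rw [hs, indicator_of_mem hs']

end LpTime

namespace WaveForm

variable {V H : Type*} [NormedAddCommGroup V] [InnerProductSpace ℝ V] [CompleteSpace V]
  [NormedAddCommGroup H] [InnerProductSpace ℝ H] [CompleteSpace H] {T : ℝ}

/-- Restriction to a shorter time interval. -/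
def restrict (D : WaveForm V H T) {t : ℝ} (ht : t ≤ T) : WaveForm V H t :=
  { D with
    symm := fun s hs => D.symm s (Icc_subset_Icc_right ht hs)
    coercive := fun s hs => D.coercive s (Icc_subset_Icc_right ht hs)
    bound := fun s hs => D.bound s (Icc_subset_Icc_right ht hs)
    lip := fun s hs r hr => D.lip s (Icc_subset_Icc_right ht hs) r (Icc_subset_Icc_right ht hr) }

variable {D : WaveForm V H T}

theorem IsSolution.restrict {F v : ℝ → V} {u : ℝ → H} (h : D.IsSolution F v u) {t : ℝ}
    (ht : t ≤ T) : (D.restrict ht).IsSolution F v u where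
  continuousOn_fst := h.continuousOn_fst.mono (Icc_subset_Icc_right ht)
  continuousOn_snd := h.continuousOn_snd.mono (Icc_subset_Icc_right ht)
  eq_fst s hs := h.eq_fst s (Icc_subset_Icc_right ht hs)
  eq_snd s hs := h.eq_snd s (Icc_subset_Icc_right ht hs)

end WaveForm

/-! ### Weak solutions and the norm of `L²(Ω_t) + W` -/

section WeakSolution

variable {n : ℕ} {Ω : Set (Space n)} {T : ℝ} {γ : ℝ → Space n → ℝ}

theorem integrableOn_riesz (F : HH Ω T) : IntegrableOn (fun t => riesz (F t)) (Ioo 0 T) :=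
  riesz.toContinuousLinearMap.integrable_comp (Lp_integrableOn F)

theorem integrableOn_of_continuousOn {E : Type*} [NormedAddCommGroup E] {f : ℝ → E}
    (hf : ContinuousOn f (Icc 0 T)) : IntegrableOn f (Ioo 0 T) :=
  hf.integrableOn_Icc.mono_set Ioo_subset_Icc_self

variable {D : WaveForm (H10 Ω) (L2 Ω) T} {F : HH Ω T}

theorem integrableOn_gram_sub_op_add_riesz {v : ℝ → H10 Ω} (hv : ContinuousOn v (Icc 0 T)) :
    IntegrableOn (fun t => D.gram (v t) - D.op t (v t) + riesz (F t)) (Ioo 0 T) :=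
  (integrableOn_of_continuousOn (WaveForm.continuousOn_gram_sub_op (D := D) hv)).add
    (integrableOn_riesz F)

/-- The term `S v` cancels the `L²` product built into `B`, leaving exactly the form `b`. -/
theorem integral_inner_eq_of_waveForm (hD : D.incl = toL2 Ω) (hop : ∀ t ∈ Icc 0 T, ∀ u w,
      inner ℝ (D.op t u) w = form γ t u w + inner ℝ (toL2 Ω u) (toL2 Ω w))
    {v : ℝ → H10 Ω} (hv : ContinuousOn v (Icc 0 T)) (φ : H10 Ω) {θ : ℝ → ℝ}
    (hθ : IsTest (Ioo 0 T) θ) :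
    inner ℝ φ (∫ t in Ioo 0 T, θ t • (D.gram (v t) - D.op t (v t) + riesz (F t))) =
      (∫ t in Ioo 0 T, F t φ * θ t) - ∫ t in Ioo 0 T, form γ t (v t) φ * θ t := by
  have i1 := integrableOn_of_continuousOn (WaveForm.continuousOn_gram_sub_op (D := D) hv)
  have i2 := integrableOn_riesz F
  have j1 : IntegrableOn (fun t => F t φ * θ t) (Ioo 0 T) := by
    refine ((hθ.integrable_smul i2).const_inner φ).congr (Eventually.of_forall fun t => ?_)
    simp only
    rw [real_inner_smul_right, real_inner_comm, inner_riesz, mul_comm]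
  have j2 : IntegrableOn (fun t => form γ t (v t) φ * θ t) (Ioo 0 T) := by
    refine ((hθ.integrable_smul i1).const_inner φ).neg.congr ?_
    filter_upwards [ae_restrict_mem measurableSet_Ioo] with t ht
    rw [Pi.neg_apply, real_inner_smul_right, real_inner_comm, inner_sub_left,
      hop t (Ioo_subset_Icc_self ht), D.inner_gram_left, hD]
    ring
  rw [← integral_inner (hθ.integrable_smul (integrableOn_gram_sub_op_add_riesz hv)), ← integral_sub j1 j2]
  refine setIntegral_congr_fun measurableSet_Ioo fun t ht => ?_
  rw [real_inner_smul_right, real_inner_comm, inner_add_left, inner_sub_left,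
    hop t (Ioo_subset_Icc_self ht), D.inner_gram_left, hD, inner_riesz]
  ring

theorem inner_integral_deriv_smul_coincl (hD : D.incl = toL2 Ω) {u : ℝ → L2 Ω}
    (hu : ContinuousOn u (Icc 0 T)) (φ : H10 Ω) {θ : ℝ → ℝ} (hθ : IsTest (Ioo 0 T) θ) :
    inner ℝ φ (∫ t in Ioo 0 T, deriv θ t • D.coincl (u t)) =
      ∫ t in Ioo 0 T, inner ℝ (u t) (toL2 Ω φ) * deriv θ t := by
  have hi : IntegrableOn (fun t => D.coincl (u t)) (Ioo 0 T) :=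
    integrableOn_of_continuousOn (D.coincl.continuous.comp_continuousOn hu)
  rw [← integral_inner (hθ.deriv.integrable_smul hi)]
  refine integral_congr_ae (Eventually.of_forall fun t => ?_)
  simp only
  rw [real_inner_smul_right, D.inner_coincl_right, hD, real_inner_comm, mul_comm]

/-- Taken over all `φ`, the weak equation says that `i† ∂ₜv` has weak derivative `S v - B v + F` in
`V`. The lemma of du Bois-Reymond integrates it, and continuity of the velocity gives the identity
at every time. -/
theorem IsWeakSolution.isSolution (hT : 0 < T) (hD : D.incl = toL2 Ω)
    (hop : ∀ t ∈ Icc 0 T, ∀ u w,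
      inner ℝ (D.op t u) w = form γ t u w + inner ℝ (toL2 Ω u) (toL2 Ω w))
    {v₀ : H10 Ω} {v₁ : L2 Ω} {v : ℝ → H10 Ω} (h : IsWeakSolution γ F v₀ v₁ v) :
    D.IsSolution (fun t => riesz (F t)) v (velocity T v) where
  continuousOn_fst := h.continuousOn
  continuousOn_snd := h.continuousOn_velocity
  eq_fst t ht := by
    rw [hD, ← eq_integral_of_hasDerivWithinAt (left_mem_Icc.2 hT.le) ht h.continuousOn_velocity
      (fun s hs => (h.differentiableOn s hs).hasDerivWithinAt)]
    abel
  eq_snd t ht := by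
    have hx := D.coincl.continuous.comp_continuousOn h.continuousOn_velocity
    have hG := integrableOn_gram_sub_op_add_riesz (D := D) (F := F) h.continuousOn
    obtain ⟨c, hc⟩ := exists_eq_primitive_of_integral_deriv hT
      (F := fun t => D.coincl (velocity T v t)) (integrableOn_of_continuousOn hx) hG
      fun θ hθ => by
        refine ext_inner_left ℝ fun φ => ?_
        rw [inner_integral_deriv_smul_coincl hD h.continuousOn_velocity φ hθ, inner_neg_right,
          integral_inner_eq_of_waveForm hD hop h.continuousOn φ hθ, ← h.equation φ θ hθ]
        ring
    have hP : ContinuousOn (fun t => c + ∫ s in 0..t,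
        (D.gram (v s) - D.op s (v s) + riesz (F s))) (Icc 0 T) := by
      have := intervalIntegral.continuousOn_primitive_interval' (a := 0) (b₁ := 0) (b₂ := T)
        ((intervalIntegrable_iff_integrableOn_Ioo_of_le hT.le).2 hG) left_mem_uIcc
      rw [uIcc_of_le hT.le] at this
      exact continuousOn_const.add this
    have key := eqOn_Icc_of_ae_eq_Ioo hT hx hP hc
    have k0 := key (left_mem_Icc.2 hT.le)
    simp only [Function.comp_apply, intervalIntegral.integral_same, add_zero] at k0
    rw [k0]
    exact key ht

theorem velocity_eq_of_isSolution (hT : 0 < T) (hD : D.incl = toL2 Ω) {F v : ℝ → H10 Ω}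
    {u : ℝ → L2 Ω} (h : D.IsSolution F v u) {t : ℝ} (ht : t ∈ Icc 0 T) :
    HasDerivWithinAt (fun s => toL2 Ω (v s)) (u t) (Icc 0 T) t ∧ velocity T v t = u t := by
  have := hasDerivWithinAt_of_eq_integral hT.le (left_mem_Icc.2 hT.le) h.continuousOn_snd
    h.eq_fst t ht
  rw [hD] at this
  exact ⟨this, this.derivWithin (uniqueDiffOn_Icc hT t ht)⟩

theorem isWeakSolution_of_isSolution (hT : 0 < T) (hD : D.incl = toL2 Ω)
    (hop : ∀ t ∈ Icc 0 T, ∀ u w,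
      inner ℝ (D.op t u) w = form γ t u w + inner ℝ (toL2 Ω u) (toL2 Ω w))
    {v : ℝ → H10 Ω} {u : ℝ → L2 Ω} (h : D.IsSolution (fun t => riesz (F t)) v u) :
    IsWeakSolution γ F (v 0) (u 0) v where
  continuousOn := h.continuousOn_fst
  differentiableOn t ht := (velocity_eq_of_isSolution hT hD h ht).1.differentiableWithinAt
  continuousOn_velocity := h.continuousOn_snd.congr fun _ ht =>
    (velocity_eq_of_isSolution hT hD h ht).2
  initial := rfl
  initial_velocity := (velocity_eq_of_isSolution hT hD h (left_mem_Icc.2 hT.le)).2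
  equation φ θ hθ := by
    have e : ∫ t in Ioo 0 T, inner ℝ (velocity T v t) (toL2 Ω φ) * deriv θ t =
        ∫ t in Ioo 0 T, inner ℝ (u t) (toL2 Ω φ) * deriv θ t :=
      setIntegral_congr_fun measurableSet_Ioo fun t ht => by
        rw [(velocity_eq_of_isSolution hT hD h (Ioo_subset_Icc_self ht)).2]
    have hG := integrableOn_gram_sub_op_add_riesz (D := D) (F := F) h.continuousOn_fst
    rw [e, ← inner_integral_deriv_smul_coincl hD h.continuousOn_snd φ hθ,
      integral_deriv_smul_of_eq_primitive hT.le hG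
        (fun t ht => h.eq_snd t (Ioo_subset_Icc_self ht)) hθ, inner_neg_right,
      integral_inner_eq_of_waveForm hD hop h.continuousOn_fst φ hθ]
    ring

theorem riesz_toHm1 (hD : D.incl = toL2 Ω) (f : L2 Ω) : riesz f.toHm1 = D.coincl f := by
  refine ext_inner_right ℝ fun φ => ?_
  rw [inner_riesz, D.inner_coincl_left, hD]
  rfl

theorem HasTimeDeriv.exists_eq_primitive (hT : 0 < T) {F₂ G₂ : HH Ω T} (h : HasTimeDeriv F₂ G₂) :
    ∃ (p₀ : H10 Ω) (Q : Lp (H10 Ω) 2 (volume.restrict (Ioo 0 T))),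
      (∀ᵐ t ∂volume.restrict (Ioo 0 T), riesz (F₂ t) = p₀ + ∫ s in 0..t, Q s) ∧
      ‖p₀‖ ≤ √T / T * ‖F₂‖ + √T * ‖G₂‖ ∧ ‖Q‖ ≤ ‖G₂‖ := by
  obtain ⟨c, hc⟩ := exists_eq_primitive_of_integral_deriv hT (Lp_integrableOn F₂)
    (Lp_integrableOn G₂) h
  obtain ⟨Q, hQ, hQn⟩ := exists_Lp_riesz G₂
  refine ⟨riesz c, Q, ?_, ?_, hQn⟩
  · filter_upwards [hc, ae_restrict_mem measurableSet_Ioo] with t ht htT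
    have e : ∫ s in 0..t, riesz (G₂ s) = riesz (∫ s in 0..t, G₂ s) :=
      riesz.toContinuousLinearMap.intervalIntegral_comp_comm
        (Lp_intervalIntegrable G₂ (Ioo_subset_Icc_self htT))
    rw [primitive_congr_ae hQ (Ioo_subset_Icc_self htT), e, ← map_add, ← ht]
  · exact (riesz.norm_map c).trans_le (norm_le_of_ae_eq_add_primitive hT hc)

/-- One of the two summands is zero. This serves existence, with `t = T`, and shows that the infimum
defining `sumNorm` runs over a nonempty set. -/
theorem exists_decomposition {t : ℝ} (ht : t ≤ T) (h : MemL2 F ∨ MemW F) :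
    ∃ (f : L2Time Ω t) (F₂ G₂ : HH Ω T), HasTimeDeriv F₂ G₂ ∧
      ∀ᵐ s ∂volume.restrict (Ioo 0 t), F s = (f s).toHm1 + F₂ s := by
  have hle : volume.restrict (Ioo 0 t) ≤ volume.restrict (Ioo 0 T) :=
    Measure.restrict_mono (Ioo_subset_Ioo_right ht) le_rfl
  have hac := (Measure.absolutelyContinuous_of_le hle).ae_le
  rcases h with ⟨f, hf⟩ | ⟨G, hG⟩
  · have m : MemLp f 2 (volume.restrict (Ioo 0 t)) := (Lp.memLp f).mono_measure hle
    refine ⟨m.toLp, 0, 0, fun θ _ => ?_, ?_⟩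
    · have z : ∀ θ : ℝ → ℝ, ∫ t in Ioo 0 T, θ t • (0 : HH Ω T) t = 0 := fun θ => by
        refine integral_eq_zero_of_ae ?_
        filter_upwards [Lp.coeFn_zero (Hm1 Ω) 2 (volume.restrict (Ioo 0 T))] with s hs
        rw [hs]
        simp
      rw [z, z, neg_zero]
    · filter_upwards [hac hf, hac (Lp.coeFn_zero (Hm1 Ω) 2 (volume.restrict (Ioo 0 T))),
        m.coeFn_toLp] with s h1 h2 h3
      rw [h1, h2, h3]
      simp
  · refine ⟨0, F, G, hG, ?_⟩
    filter_upwards [Lp.coeFn_zero (L2 Ω) 2 (volume.restrict (Ioo 0 t))] with s hs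
    rw [hs]
    simp [L2.toHm1]

theorem riesz_ae_eq_source (hD : D.incl = toL2 Ω) {t : ℝ} (ht : t ≤ T) {f : L2Time Ω t}
    {f' : L2Time Ω T} (hf : f' =ᵐ[volume.restrict (Ioo 0 t)] f) {F₂ : HH Ω T} {p₀ : H10 Ω}
    {Q : Lp (H10 Ω) 2 (volume.restrict (Ioo 0 T))}
    (hp : ∀ᵐ t ∂volume.restrict (Ioo 0 T), riesz (F₂ t) = p₀ + ∫ s in 0..t, Q s)
    (h : ∀ᵐ s ∂volume.restrict (Ioo 0 t), F s = (f s).toHm1 + F₂ s) :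
    (fun s => riesz (F s)) =ᵐ[volume.restrict (Ioo 0 t)] D.source f' p₀ Q := by
  have hle : volume.restrict (Ioo 0 t) ≤ volume.restrict (Ioo 0 T) :=
    Measure.restrict_mono (Ioo_subset_Ioo_right ht) le_rfl
  filter_upwards [hf, (Measure.absolutelyContinuous_of_le hle).ae_le hp, h] with s h1 h2 h3
  rw [h3, map_add, riesz_toHm1 hD, h2, WaveForm.source, h1]

/-- The energy estimate in terms of a decomposition of the source on `(0, t)`. -/
theorem exists_estimate_of_decomposition (hT : 0 < T) (hD : D.incl = toL2 Ω) :
    ∃ C, 0 < C ∧ ∀ (F : HH Ω T) (v : ℝ → H10 Ω) (u : ℝ → L2 Ω),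
      D.IsSolution (fun t => riesz (F t)) v u → ∀ t ∈ Icc 0 T,
      ∀ (f : L2Time Ω t) (F₂ G₂ : HH Ω T), HasTimeDeriv F₂ G₂ →
      (∀ᵐ s ∂volume.restrict (Ioo 0 t), F s = (f s).toHm1 + F₂ s) →
      ‖u t‖ + ‖grad Ω (v t)‖ ≤
        C * (‖f‖ + √(‖F₂‖ ^ 2 + ‖G₂‖ ^ 2) + ‖v 0‖ + ‖u 0‖) := by
  obtain ⟨C, hC, hex⟩ := D.exists_isSolution hT.le
  set K := √T / T + √T + 1
  have hK : 1 ≤ K := le_add_of_nonneg_left (by positivity)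
  -- The summand one makes the constant strictly positive, so that one may divide by it when taking
  -- the infimum.
  refine ⟨C * K + 1, by positivity, fun F v u h t ht f F₂ G₂ hW hdec => ?_⟩
  obtain ⟨p₀, Q, hp, hp₀, hQ⟩ := hW.exists_eq_primitive hT
  obtain ⟨f', hf'n, hf'⟩ := exists_Lp_extension ht.2 f
  -- The source `f' + F₂`, with `f` extended by zero, may differ from `F` after time `t` but equals
  -- it on `(0, t)`. Uniqueness on `[0, t]` makes the solutions agree at `t`, so the constant for
  -- `[0, T]` applies.
  obtain ⟨v', u', h', hv', hu', hest⟩ := hex f' p₀ Q (v 0) (u 0)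
  have hFi : IntervalIntegrable (fun s => riesz (F s)) volume 0 t := by
    rw [intervalIntegrable_iff_integrableOn_Ioo_of_le ht.1]
    exact (integrableOn_riesz F).mono_set (Ioo_subset_Ioo_right ht.2)
  obtain ⟨e1, e2⟩ := (h.restrict ht.2).unique ht.1 (h'.restrict ht.2) hFi
    (riesz_ae_eq_source hD ht.2 hf' hp hdec) hv'.symm hu'.symm t (right_mem_Icc.2 ht.1)
  have h1 := hest t ht
  rw [← e1, ← e2, hf'n] at h1
  set N := √(‖F₂‖ ^ 2 + ‖G₂‖ ^ 2)
  have hF₂ : ‖F₂‖ ≤ N := Real.le_sqrt_of_sq_le (le_add_of_nonneg_right (sq_nonneg _))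
  have hG₂ : ‖G₂‖ ≤ N := Real.le_sqrt_of_sq_le (le_add_of_nonneg_left (sq_nonneg _))
  have hpK : ‖p₀‖ + ‖Q‖ ≤ K * N :=
    calc ‖p₀‖ + ‖Q‖ ≤ (√T / T * ‖F₂‖ + √T * ‖G₂‖) + ‖G₂‖ := add_le_add hp₀ hQ
      _ ≤ (√T / T * N + √T * N) + N := by gcongr
      _ = K * N := by ring
  have hmono : ∀ x : ℝ, 0 ≤ x → x ≤ K * x := fun x hx => le_mul_of_one_le_left hx hK
  have h2 : ‖f‖ + ‖p₀‖ + ‖Q‖ + ‖v 0‖ + ‖u 0‖ ≤ K * (‖f‖ + N + ‖v 0‖ + ‖u 0‖) := by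
    linarith [hmono _ (norm_nonneg f), hmono _ (norm_nonneg (v 0)), hmono _ (norm_nonneg (u 0))]
  calc ‖u t‖ + ‖grad Ω (v t)‖ ≤ ‖u t‖ + ‖v t‖ := add_le_add_right (norm_grad_le _) _
    _ ≤ C * (‖f‖ + ‖p₀‖ + ‖Q‖ + ‖v 0‖ + ‖u 0‖) := h1
    _ ≤ C * (K * (‖f‖ + N + ‖v 0‖ + ‖u 0‖)) := mul_le_mul_of_nonneg_left h2 hC
    _ ≤ (C * K + 1) * (‖f‖ + N + ‖v 0‖ + ‖u 0‖) := by
      have : 0 ≤ ‖f‖ + N + ‖v 0‖ + ‖u 0‖ := by positivity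
      linarith

end WeakSolution

end WaveDirichlet

end

open WaveDirichlet in
theorem theorem2 {n : ℕ} (hn : 1 ≤ n) (Ω : Set (EuclideanSpace ℝ (Fin n))) (hΩ : IsOpen Ω)
    (hcompact : IsCompactOperator (toL2 Ω))
    (T : ℝ) (hT : 0 < T) (γ : ℝ → EuclideanSpace ℝ (Fin n) → ℝ)
    (hγ_pos : ∀ t ∈ Icc 0 T, ∀ᵐ x ∂volume.restrict Ω, 0 < γ t x)
    (hγ : IsContLinfty Ω T γ)
    (hγ_inv : IsContLinfty Ω T (fun t x => (γ t x)⁻¹))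
    (hγ_deriv : HasTimeDerivLinfty Ω T γ) :
    ∃ C : ℝ, ∀ (F : HH Ω T) (v₀ : H10 Ω) (v₁ : L2 Ω), MemL2 F ∨ MemW F →
      ∃ v : ℝ → H10 Ω, IsWeakSolution γ F v₀ v₁ v ∧
        (∀ w : ℝ → H10 Ω, IsWeakSolution γ F v₀ v₁ w → EqOn w v (Icc 0 T)) ∧
        ∀ t ∈ Icc 0 T, ‖velocity T v t‖ + ‖grad Ω (v t)‖ ≤
          C * (sumNorm t F + ‖v₀‖ + ‖v₁‖) := by
  obtain ⟨D, hD, hop⟩ := exists_waveForm hΩ hT hγ_pos hγ hγ_inv hγ_deriv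
  obtain ⟨C, hC, hest⟩ := exists_estimate_of_decomposition hT hD
  refine ⟨C, fun F v₀ v₁ hF => ?_⟩
  obtain ⟨v, u, h, rfl, rfl⟩ : ∃ (v : ℝ → H10 Ω) (u : ℝ → L2 Ω),
      D.IsSolution (fun t => riesz (F t)) v u ∧ v 0 = v₀ ∧ u 0 = v₁ := by
    obtain ⟨f, F₂, G₂, hW, hdec⟩ := exists_decomposition (le_refl T) hF
    obtain ⟨p₀, Q, hp, -, -⟩ := hW.exists_eq_primitive hT
    obtain ⟨C', -, hex⟩ := D.exists_isSolution hT.le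
    obtain ⟨v, u, h, hv, hu, -⟩ := hex f p₀ Q v₀ v₁
    exact ⟨v, u, h.congr_ae (riesz_ae_eq_source hD le_rfl Filter.EventuallyEq.rfl hp hdec).symm,
      hv, hu⟩
  have hweak := isWeakSolution_of_isSolution hT hD hop h
  refine ⟨v, hweak, fun w hw t ht => ?_, fun t ht => ?_⟩
  · refine ((hw.isSolution hT hD hop).unique hT.le h ?_ Filter.EventuallyEq.rfl hw.initial
      hw.initial_velocity t ht).1
    rw [intervalIntegrable_iff_integrableOn_Ioo_of_le hT.le]
    exact integrableOn_riesz F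
  · rw [(velocity_eq_of_isSolution hT hD h ht).2, ← div_le_iff₀' hC, add_assoc, ← sub_le_iff_le_add]
    -- The estimate is rearranged into a lower bound for the norm of each decomposition.
    -- Nonemptiness matters, since the infimum of the empty set is zero by convention.
    refine le_csInf ?_ ?_
    · obtain ⟨f, F₂, G₂, hW, hdec⟩ := exists_decomposition ht.2 hF
      exact ⟨_, f, F₂, G₂, hW, hdec, rfl⟩
    · rintro r ⟨f, F₂, G₂, hW, hdec, rfl⟩
      rw [sub_le_iff_le_add, div_le_iff₀' hC, ← add_assoc]
      exact hest F v u h t ht f F₂ G₂ hW hdec
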